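/- Let $N\ge 0$ and $0\le p\le N$, and let $\mathfrak g=sp(N)$ be the complex symplectic Lie algebra of rank $N$, realised by $2N\times 2N$ matrices, with $$H_{ii}=\tfrac12(e_{i,i}-e_{N+i,N+i}),\qquad E_{i-j}=e_{i,j}-e_{N+j,N+i}\ (i<j),\qquad E_{i+j}=e_{i,N+j}+e_{j,N+i}\ (i\le j),$$ where the $e_{a,b}$ are the matrix units. Write $a\wedge b=a\otimes b-b\otimes a$. Let $\mathbf L_p\subset\mathfrak g$ be the Lie subalgebra generated by $H_{kk}$, $E_{k+i}$ $(i\ge k)$ and $E_{k-i}$ $(i>k)$ for $k\le p$ (so $\mathbf L_N=\mathbf B^+(sp(N))$). Let $E^*_{i+i}$ and $H^*_{ii}$ be the functionals on $\mathbf L_p$ that belong to the dual basis. $U(\mathfrak g)$ carries the coproduct $\Delta$ and counit $\epsilon$ for which $\mathfrak g$ is primitive; $\xi$ is a formal variable. **The chain.** Let $\eta_k\in\mathbb C$ and $\kappa_k\in\{0,1\}$ $(1\le k\le N)$. Define series in $U(\mathfrak g)[[\xi]]$ by $E^{(0)}_{i+j}=E_{i+j}$, $$\sigma_k=\ln\bigl(1+\xi\eta_kE^{(k-1)}_{k+k}\bigr),\qquad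 E^{(k)}_{i+j}=E^{(k-1)}_{i+j}-\kappa_k\,\xi\eta_k\,E^{(k-1)}_{k+i}E^{(k-1)}_{k+j}e^{-\sigma_k},$$ and in $(U(\mathfrak g)\otimes U(\mathfrak g))[[\xi]]$ $$\mathcal F_k=\Bigl(\prod_{i=k+1}^{\stackrel{N}{\leftarrow}}\exp\bigl\{\kappa_k\,\xi\eta_k\,E_{k-i}\otimes E^{(k-1)}_{k+i}e^{-\frac12\sigma_k}\bigr\}\Bigr)\exp\{H_{kk}\otimes\sigma_k\},\qquad \mathcal F_{\mathcal B}=\mathcal F_p\cdots\mathcal F_2\mathcal F_1 .$$ A twist is an invertible $\mathcal F$ with $\mathcal F_{12}(\Delta\otimes\mathrm{id})\mathcal F=\mathcal F_{23}(\mathrm{id}\otimes\Delta)\mathcal F$ and $(\epsilon\otimes\mathrm{id})\mathcal F=(\mathrm{id}\otimes\epsilon)\mathcal F=1$; $\Delta_{\mathcal F}(a)=\mathcal F\Delta(a)\mathcal F^{-1}$. We say that $\mathcal F$ has the classical $r$-matrix $r\in\mathfrak g\otimes\mathfrak g$ if $\mathcal F_{21}\mathcal F^{-1}=1\otimes1-\xi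 r+O(\xi^2)$. **(1)** For all $\eta_k,\kappa_k$: $\mathcal F_{\mathcal B}$ is a twist, and its classical $r$-matrix is $$r=\sum_{k=1}^p\eta_k\Bigl(H_{kk}\wedge E_{k+k}+\kappa_k\sum_{i=k+1}^NE_{k-i}\wedge E_{k+i}\Bigr),$$ which solves the classical Yang–Baxter equation. **(2)** The elements $\sigma_1,\dots,\sigma_p$ commute with each other and are primitive for $\Delta_{\mathcal F_{\mathcal B}}$. For all $\xi_{ij}=c_{ij}/\xi$ with $c_{ij}\in\mathbb C[[\xi]]$, the element $\Phi_{\mathcal R}=\exp\bigl\{\sum_{i,j\le p}\xi_{ij}\,\sigma_i\otimes\sigma_j\bigr\}$ is a twist for the Hopf algebra with coproduct $\Delta_{\mathcal F_{\mathcal B}}$, and $\Phi_{\mathcal R}\mathcal F_{\mathcal B}$ is a twist for $U(\mathfrak g)$. The classical $r$-matrix of $\Phi_{\mathcal R}\mathcal F_{\mathcal B}$ is $$\hat r=r+\sum_{i<k\le p}\zeta_{ik}\,E_{i+i}\wedge E_{k+k},\qquad \zeta_{ik}=\bigl(c_{ik}(0)-c_{ki}(0)\bigr)\eta_i\eta_k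 ,$$ and it solves the classical Yang–Baxter equation. **(3)** For $i<k\le p$ the form $H^*_{ii}\wedge H^*_{kk}$ is a 2-cocycle of $\mathbf L_p$ that is not a 2-coboundary. **(4)** Let $\gamma_k\ne0$ for $k\le p$, let $w_{ik}\in\mathbb C$, and put $$\omega_p=\sum_{k\le p}\gamma_kE^*_{k+k}([\cdot,\cdot]),\qquad \hat\omega_p=\omega_p+\sum_{i<k\le p}w_{ik}H^*_{ii}\wedge H^*_{kk}$$ on $\mathbf L_p$. Then $\omega_p$ is a nondegenerate 2-coboundary and $\hat\omega_p$ is a nondegenerate 2-cocycle. Call $t\in\mathbf L_p\otimes\mathbf L_p$ the inverse of a form $b$ on $\mathbf L_p$ if $\mathbf L_p^*\to\mathbf L_p$, $f\mapsto(\mathrm{id}\otimes f)(t)$, is inverse to $\mathbf L_p\to\mathbf L_p^*$, $x\mapsto b(x,\cdot)$. Then, for $\eta_k=1/\gamma_k$ and all $\kappa_k=1$, $$\omega_p^{-1}=r,\qquad \hat\omega_p^{-1}=r-\sum_{i<k\le p}\frac{w_{ik}}{\gamma_i\gamma_k}E_{i+i}\wedge E_{k+k},$$ and $\hat\omega_p^{-1}$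 is the classical $r$-matrix of $\Phi_{\mathcal R}\mathcal F_{\mathcal B}$ whenever $c_{ik}(0)-c_{ki}(0)=-w_{ik}$ for all $i<k\le p$. In particular this holds for $p=N$, where $\mathbf L_N=\mathbf B^+(sp(N))$. -/

import Mathlib

open scoped TensorProduct
open PowerSeries

noncomputable section

namespace ChainTwist

attribute [local instance] LieRing.ofAssociativeRing

/-! ### Two-cochains of a Lie algebra and inverse tensors -/

section Forms

variable {l : Type} [LieRing l] [LieAlgebra ℂ l]

/-- The bilinear form `(x, y) ↦ f ⁅x, y⁆` of a linear functional `f`. -/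
def cobForm (f : Module.Dual ℂ l) : LinearMap.BilinForm ℂ l :=
  LinearMap.mk₂ ℂ (fun x y => f ⁅x, y⁆)
    (fun x y z => by simp) (fun c x y => by simp) (fun x y z => by simp) (fun c x y => by simp)

/-- `f ∧ g : (x, y) ↦ f x * g y - g x * f y`. -/
def wedgeForm (f g : Module.Dual ℂ l) : LinearMap.BilinForm ℂ l :=
  LinearMap.mk₂ ℂ (fun x y => f x * g y - g x * f y)
    (fun x y z => by simp; ring) (fun c x y => by simp; ring)
    (fun x y z => by simp; ring) (fun c x y => by simp; ring)

/-- 2-cocycles with trivial coefficients: alternating forms with vanishing cyclic sum. -/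
def IsTwoCocycle (b : LinearMap.BilinForm ℂ l) : Prop :=
  (∀ x, b x x = 0) ∧ ∀ x y z, b ⁅x, y⁆ z + b ⁅z, x⁆ y + b ⁅y, z⁆ x = 0

/-- 2-coboundaries: the forms `f ⁅·, ·⁆`. -/
def IsTwoCoboundary (b : LinearMap.BilinForm ℂ l) : Prop :=
  ∃ f : Module.Dual ℂ l, b = cobForm f

end Forms

/-- `a ∧ b = a ⊗ b - b ⊗ a`. -/
def wedge {V : Type} [AddCommGroup V] [Module ℂ V] (a b : V) : V ⊗[ℂ] V :=
  a ⊗ₜ b - b ⊗ₜ a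

/-- `(id ⊗ f) t`, contraction of the second tensor factor. -/
def contract {V : Type} [AddCommGroup V] [Module ℂ V] (t : V ⊗[ℂ] V) (f : Module.Dual ℂ V) : V :=
  TensorProduct.rid ℂ V (LinearMap.lTensor V f t)

/-- `r` lies in `L ⊗ L`, and the map `f ↦ (id ⊗ f) r` from the dual of `L` to `L` is
the two-sided inverse of the map `x ↦ b(x, ·)` from `L` to its dual. -/
def IsInverseOf {g : Type} [LieRing g] [LieAlgebra ℂ g] (L : LieSubalgebra ℂ g)
    (b : LinearMap.BilinForm ℂ L) (r : g ⊗[ℂ] g) : Prop :=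
  ∃ t : L ⊗[ℂ] L,
    TensorProduct.map (L.toSubmodule.subtype) (L.toSubmodule.subtype) t = r ∧
    (∀ x : L, contract t (b x) = x) ∧ ∀ f : Module.Dual ℂ L, b (contract t f) = f

/-! ### Formal power series with coefficients in a noncommutative algebra -/

section Series

variable {A : Type} [Ring A] [Algebra ℂ A]

/-- `∑ₖ aₖ fᵏ`, where `φ = ∑ₖ aₖ tᵏ`, for a series `f` without constant term (then only
`k ≤ n` contribute to the `n`-th coefficient). -/
def substScalar (φ : PowerSeries ℂ) (f : PowerSeries A) : PowerSeries A :=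
  PowerSeries.mk fun n => ∑ k ∈ Finset.range (n + 1), coeff k φ • coeff n (f ^ k)

/-- `exp f`, for `f` without constant term. -/
def expS (f : PowerSeries A) : PowerSeries A := substScalar (PowerSeries.exp ℂ) f

/-- `log (1 + f)`, for `f` without constant term. -/
def log1p (f : PowerSeries A) : PowerSeries A := substScalar (PowerSeries.log ℂ) f

/-- `f / ξ`, for `f` without constant term, where `ξ` is the formal variable. -/
def divXi (f : PowerSeries A) : PowerSeries A := PowerSeries.mk fun n => coeff (n + 1) f

/-- A scalar series, viewed as a (central) series with coefficients in `A`. -/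
def scal (c : PowerSeries ℂ) : PowerSeries A := PowerSeries.map (algebraMap ℂ A) c

/-- `f ⊗ g`, as a series with coefficients in `A ⊗ A`. -/
def tens (f g : PowerSeries A) : PowerSeries (A ⊗[ℂ] A) :=
  PowerSeries.map (Algebra.TensorProduct.includeLeft : A →ₐ[ℂ] A ⊗[ℂ] A).toRingHom f *
    PowerSeries.map (Algebra.TensorProduct.includeRight : A →ₐ[ℂ] A ⊗[ℂ] A).toRingHom g

end Series

/-! ### The Hopf algebra `U(g)`, twists, `R`-matrices -/

section Hopf

variable (g : Type) [LieRing g] [LieAlgebra ℂ g]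

/-- `U(g)`. -/
abbrev U := UniversalEnvelopingAlgebra ℂ g

/-- `U(g) ⊗ U(g)`. -/
abbrev U2 := U g ⊗[ℂ] U g

/-- `U(g) ⊗ U(g) ⊗ U(g)`. -/
abbrev U3 := U g ⊗[ℂ] (U g ⊗[ℂ] U g)

variable {g}

/-- The inclusion of `g` in `U(g)`. -/
def inc : g →ₗ[ℂ] U g := (UniversalEnvelopingAlgebra.ι ℂ : g →ₗ⁅ℂ⁆ U g)

variable (g)

/-- `x ↦ x ⊗ 1 + 1 ⊗ x` on `g`. -/
def primHom : g →ₗ⁅ℂ⁆ U2 g :=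
  { (Algebra.TensorProduct.includeLeft : U g →ₐ[ℂ] U2 g).toLinearMap ∘ₗ inc +
      (Algebra.TensorProduct.includeRight : U g →ₐ[ℂ] U2 g).toLinearMap ∘ₗ inc with
    map_lie' := by
      intro x y
      simp [inc, LieRing.of_associative_ring_bracket, mul_add, add_mul,
        TensorProduct.sub_tmul, TensorProduct.tmul_sub]
      abel }

/-- The primitive coproduct of `U(g)`: the algebra map with `Δ x = x ⊗ 1 + 1 ⊗ x` on `g`. -/
def comul : U g →ₐ[ℂ] U2 g := UniversalEnvelopingAlgebra.lift ℂ (primHom g)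

/-- The counit of `U(g)`: the algebra map which vanishes on `g`. -/
def counit : U g →ₐ[ℂ] ℂ := UniversalEnvelopingAlgebra.lift ℂ (0 : g →ₗ⁅ℂ⁆ ℂ)

/-- `Δ ⊗ id`. -/
def comulLeft : U2 g →ₐ[ℂ] U3 g :=
  (Algebra.TensorProduct.assoc ℂ ℂ ℂ (U g) (U g) (U g)).toAlgHom.comp
    (Algebra.TensorProduct.map (comul g) (AlgHom.id ℂ (U g)))

/-- `id ⊗ Δ`. -/
def comulRight : U2 g →ₐ[ℂ] U3 g :=
  Algebra.TensorProduct.map (AlgHom.id ℂ (U g)) (comul g)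

/-- `a ⊗ b ↦ a ⊗ b ⊗ 1`. -/
def leg12 : U2 g →ₐ[ℂ] U3 g :=
  (Algebra.TensorProduct.assoc ℂ ℂ ℂ (U g) (U g) (U g)).toAlgHom.comp
    Algebra.TensorProduct.includeLeft

/-- `a ⊗ b ↦ 1 ⊗ a ⊗ b`. -/
def leg23 : U2 g →ₐ[ℂ] U3 g := Algebra.TensorProduct.includeRight

/-- `a ⊗ b ↦ a ⊗ 1 ⊗ b`. -/
def leg13 : U2 g →ₐ[ℂ] U3 g :=
  Algebra.TensorProduct.map (AlgHom.id ℂ (U g)) Algebra.TensorProduct.includeRight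

/-- `ε ⊗ id`. -/
def counitLeft : U2 g →ₐ[ℂ] U g :=
  (Algebra.TensorProduct.lid ℂ (U g)).toAlgHom.comp
    (Algebra.TensorProduct.map (counit g) (AlgHom.id ℂ (U g)))

/-- `id ⊗ ε`. -/
def counitRight : U2 g →ₐ[ℂ] U g :=
  (Algebra.TensorProduct.rid ℂ ℂ (U g)).toAlgHom.comp
    (Algebra.TensorProduct.map (AlgHom.id ℂ (U g)) (counit g))

variable {g}

/-- Apply an algebra map to all coefficients of a series. -/
abbrev ap {A B : Type} [Ring A] [Algebra ℂ A] [Ring B] [Algebra ℂ B] (f : A →ₐ[ℂ] B) :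
    PowerSeries A →+* PowerSeries B := PowerSeries.map f.toRingHom

/-- `F` is a twist for `U(g)⟦ξ⟧`: `F` is invertible,
`F₁₂ (Δ ⊗ id) F = F₂₃ (id ⊗ Δ) F` and `(ε ⊗ id) F = (id ⊗ ε) F = 1`. -/
def IsTwist (F : PowerSeries (U2 g)) : Prop :=
  IsUnit F ∧
  ap (leg12 g) F * ap (comulLeft g) F = ap (leg23 g) F * ap (comulRight g) F ∧
  ap (counitLeft g) F = 1 ∧ ap (counitRight g) F = 1

/-- The twisted coproduct `Δ_F a = F Δ(a) F⁻¹`. -/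
def twistedComul (F : PowerSeries (U2 g)) (a : PowerSeries (U g)) : PowerSeries (U2 g) :=
  F * ap (comul g) a * Ring.inverse F

/-- `P` is a twist for the Hopf algebra with coproduct `Δ_F`:
`P₁₂ (Δ_F ⊗ id) P = P₂₃ (id ⊗ Δ_F) P`, where `(Δ_F ⊗ id) P = F₁₂ ((Δ ⊗ id) P) F₁₂⁻¹` and
`(id ⊗ Δ_F) P = F₂₃ ((id ⊗ Δ) P) F₂₃⁻¹`. -/
def IsTwistOver (F P : PowerSeries (U2 g)) : Prop :=
  IsUnit P ∧
  ap (leg12 g) P * (ap (leg12 g) F * ap (comulLeft g) P * ap (leg12 g) (Ring.inverse F)) =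
    ap (leg23 g) P * (ap (leg23 g) F * ap (comulRight g) P * ap (leg23 g) (Ring.inverse F)) ∧
  ap (counitLeft g) P = 1 ∧ ap (counitRight g) P = 1

/-- `R_F = F₂₁ F⁻¹`. -/
def rMatrix (F : PowerSeries (U2 g)) : PowerSeries (U2 g) :=
  ap (Algebra.TensorProduct.comm ℂ (U g) (U g)).toAlgHom F * Ring.inverse F

/-- The inclusion of `g ⊗ g` in `U(g) ⊗ U(g)`. -/
def inc2 : g ⊗[ℂ] g →ₗ[ℂ] U2 g := TensorProduct.map inc inc

/-- The classical Yang-Baxter equation `[r₁₂, r₁₃] + [r₁₂, r₂₃] + [r₁₃, r₂₃] = 0`. -/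
def IsCYBE (r : g ⊗[ℂ] g) : Prop :=
  ⁅leg12 g (inc2 r), leg13 g (inc2 r)⁆ + ⁅leg12 g (inc2 r), leg23 g (inc2 r)⁆ +
    ⁅leg13 g (inc2 r), leg23 g (inc2 r)⁆ = 0

/-- `r` is the classical `r`-matrix of the twist `F`:
`F₂₁ F⁻¹ = 1 ⊗ 1 - ξ r + O(ξ²)`; equivalently `F F₂₁⁻¹ = 1 ⊗ 1 + ξ r + O(ξ²)`. -/
def HasClassicalLimit (F : PowerSeries (U2 g)) (r : g ⊗[ℂ] g) : Prop :=
  coeff 0 (rMatrix F) = 1 ∧ coeff 1 (rMatrix F) = -inc2 r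

end Hopf

/-! ### The symplectic algebra -/

section Symplectic

variable (N : ℕ)

/-- The symplectic Lie algebra of rank `N`. -/
abbrev spN := LieAlgebra.Symplectic.sp (Fin N) ℂ

variable {N}

/-- `e_{i, N+j} + e_{j, N+i}`, where `e` are the matrix units. -/
def ePlusMat (i j : Fin N) : Matrix (Fin N ⊕ Fin N) (Fin N ⊕ Fin N) ℂ :=
  Matrix.single (Sum.inl i) (Sum.inr j) 1 + Matrix.single (Sum.inl j) (Sum.inr i) 1

/-- `e_{i, j} - e_{N+j, N+i}`. -/
def eMinusMat (i j : Fin N) : Matrix (Fin N ⊕ Fin N) (Fin N ⊕ Fin N) ℂ :=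
  Matrix.single (Sum.inl i) (Sum.inl j) 1 - Matrix.single (Sum.inr j) (Sum.inr i) 1

theorem ePlusMat_mem (i j : Fin N) : ePlusMat i j ∈ spN N := by
  refine (mem_skewAdjointMatricesSubmodule (Matrix.J (Fin N) ℂ) _).mpr ?_
  rw [Matrix.IsSkewAdjoint, Matrix.IsAdjointPair]
  have e : ePlusMat i j = Matrix.fromBlocks 0 (Matrix.single i j 1 + Matrix.single j i 1) 0 0 := by
    ext a b; rcases a with a | a <;> rcases b with b | b <;> simp [ePlusMat, Matrix.single]
  rw [e, Matrix.fromBlocks_transpose, Matrix.fromBlocks_neg, Matrix.J,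
    Matrix.fromBlocks_multiply, Matrix.fromBlocks_multiply]
  simp [add_comm]

theorem eMinusMat_mem (i j : Fin N) : eMinusMat i j ∈ spN N := by
  refine (mem_skewAdjointMatricesSubmodule (Matrix.J (Fin N) ℂ) _).mpr ?_
  rw [Matrix.IsSkewAdjoint, Matrix.IsAdjointPair]
  have e : eMinusMat i j =
      Matrix.fromBlocks (Matrix.single i j 1) 0 0 (-Matrix.single j i 1) := by
    ext a b; rcases a with a | a <;> rcases b with b | b <;> simp [eMinusMat, Matrix.single]
  rw [e, Matrix.fromBlocks_transpose, Matrix.fromBlocks_neg, Matrix.J,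
    Matrix.fromBlocks_multiply, Matrix.fromBlocks_multiply]
  simp

/-- `E_{i+j}` (root `e_i + e_j`); in particular `E_{i+i} = 2 e_{i, N+i}` (root `2 e_i`). -/
def ePlus (i j : Fin N) : spN N := ⟨ePlusMat i j, ePlusMat_mem i j⟩

/-- `E_{i-j}` for `i ≠ j` (root `e_i - e_j`). -/
def eMinus (i j : Fin N) : spN N := ⟨eMinusMat i j, eMinusMat_mem i j⟩

/-- `H_{ii}`, normalized by `[H_{ii}, E_{i+i}] = E_{i+i}`. -/
def hh (i : Fin N) : spN N := (1 / 2 : ℂ) • ⟨eMinusMat i i, eMinusMat_mem i i⟩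

/-- The functional `E*_{i+i}`. -/
def ePlusDual (i : Fin N) : Module.Dual ℂ (spN N) :=
  { toFun := fun x => (1 / 2 : ℂ) * x.1 (Sum.inl i) (Sum.inr i)
    map_add' := fun x y => by simp [mul_add]
    map_smul' := fun c x => by simp; ring }

theorem ePlusDual_ePlus (i j : Fin N) : ePlusDual i (ePlus j j) = if i = j then 1 else 0 := by
  by_cases h : i = j
  · subst h; simp [ePlusDual, ePlus, ePlusMat]; norm_num
  · simp [ePlusDual, ePlus, ePlusMat, Matrix.single_apply, Ne.symm h, h]

/-- The functional `H*_{ii}`. -/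
def hDual (i : Fin N) : Module.Dual ℂ (spN N) :=
  { toFun := fun x => 2 * x.1 (Sum.inl i) (Sum.inl i)
    map_add' := fun x y => by simp [mul_add]
    map_smul' := fun c x => by simp; ring }

theorem hDual_hh (i j : Fin N) : hDual i (hh j) = if i = j then 1 else 0 := by
  by_cases h : i = j
  · subst h; simp [hDual, hh, eMinusMat]
  · simp [hDual, hh, eMinusMat, Matrix.single_apply, Ne.symm h, h]

/-- The carrier algebra of the first `p` links: the Lie subalgebra generated by `H_{kk}`,
`E_{k+i}` (`i ≥ k`) and `E_{k-i}` (`i > k`) with `k` among the first `p` indices. For `p = N`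
it is the Borel subalgebra `B⁺(sp(N))`. -/
def carrier (N p : ℕ) : LieSubalgebra ℂ (spN N) :=
  LieSubalgebra.lieSpan ℂ (spN N)
    ({x | ∃ k : Fin N, k.val < p ∧ x = hh k} ∪
      {x | ∃ k i : Fin N, k.val < p ∧ k ≤ i ∧ x = ePlus k i} ∪
      {x | ∃ k i : Fin N, k.val < p ∧ k < i ∧ x = eMinus k i})

/-- The restriction of a functional on `sp(N)` to the carrier algebra. -/
def res (p : ℕ) (f : Module.Dual ℂ (spN N)) : Module.Dual ℂ (carrier N p) :=
  { toFun := fun x => f x.1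
    map_add' := fun x y => by simp
    map_smul' := fun c x => by simp }

/-- The indices of the first `p` links. -/
def links (N p : ℕ) : Finset (Fin N) := Finset.univ.filter fun k => k.val < p

/-- The pairs `i < k` of indices among the first `p` links. -/
def pairs (N p : ℕ) : Finset (Fin N × Fin N) :=
  Finset.univ.filter fun q => q.1 < q.2 ∧ q.2.val < p

/-- `ω_p = ∑_{k ≤ p} γ_k E*_{k+k}([·, ·])`. -/
def omega (p : ℕ) (γ : Fin N → ℂ) : LinearMap.BilinForm ℂ (carrier N p) :=
  ∑ k ∈ links N p, γ k • cobForm (res p (ePlusDual k))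

/-- `ω̂_p = ω_p + ∑_{i < k ≤ p} w_{ik} H*_{ii} ∧ H*_{kk}`. -/
def omegaHat (p : ℕ) (γ : Fin N → ℂ) (w : Fin N → Fin N → ℂ) :
    LinearMap.BilinForm ℂ (carrier N p) :=
  omega p γ + ∑ q ∈ pairs N p, w q.1 q.2 • wedgeForm (res p (hDual q.1)) (res p (hDual q.2))

/-- `r = ∑_{k ≤ p} η_k (H_{kk} ∧ E_{k+k} + κ_k ∑_{i > k} E_{k-i} ∧ E_{k+i})`. -/
def rCl (p : ℕ) (η κ : Fin N → ℂ) : spN N ⊗[ℂ] spN N :=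
  ∑ k ∈ links N p, η k • (wedge (hh k) (ePlus k k) +
    κ k • ∑ i ∈ Finset.univ.filter (fun i : Fin N => k < i), wedge (eMinus k i) (ePlus k i))

/-- `r̂ = r + ∑_{i < k ≤ p} ζ_{ik} E_{i+i} ∧ E_{k+k}`. -/
def rHat (p : ℕ) (η κ : Fin N → ℂ) (ζ : Fin N → Fin N → ℂ) : spN N ⊗[ℂ] spN N :=
  rCl p η κ + ∑ q ∈ pairs N p, ζ q.1 q.2 • wedge (ePlus q.1 q.1) (ePlus q.2 q.2)

/-! ### The chain of twists

The formal parameter `ξ` and the multipliers `η_k` enter through the automorphism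
`E_{i+j} ↦ ξ √(η_i η_j) E_{i+j}`, `E_{i-j} ↦ √(η_i / η_j) E_{i-j}`, `H_{ii} ↦ H_{ii}`.
Written out, `E^{(m)}_{i+j}` turns into `ξ √(η_i η_j)` times the series `eIter`, and
`E_{k-i} ⊗ E^{(k-1)}_{k+i}` into `ξ η_k` times the same expression, so that no root remains. -/

/-- `log (1 + ξ η E)`. -/
def logOne (η : ℂ) (E : PowerSeries (U (spN N))) : PowerSeries (U (spN N)) :=
  log1p (X * (η • E))

/-- The generators `E^{(m)}_{i+j}` (up to the scalar above): `E^{(0)} = E` and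
`E^{(k)}_{i+j} = E^{(k-1)}_{i+j} - κ_k ξ η_k E^{(k-1)}_{k+i} E^{(k-1)}_{k+j} e^{-σ}` with
`σ = log (1 + ξ η_k E^{(k-1)}_{k+k})`. The links are numbered from `0` here, so link `m`
leads from `E^{(m)}` to `E^{(m+1)}`. A link without extension (`κ = 0`) changes nothing. -/
def eIter (η κ : Fin N → ℂ) : ℕ → Fin N → Fin N → PowerSeries (U (spN N))
  | 0, i, j => C (inc (ePlus i j))
  | m + 1, i, j =>
      if h : m < N then
        eIter η κ m i j - X * ((κ ⟨m, h⟩ * η ⟨m, h⟩) •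
          (eIter η κ m ⟨m, h⟩ i * eIter η κ m ⟨m, h⟩ j *
            expS (-logOne (η ⟨m, h⟩) (eIter η κ m ⟨m, h⟩ ⟨m, h⟩))))
      else eIter η κ m i j

/-- `σ_k = log (1 + E^{(k-1)}_{k+k})`, with the parameters inserted. -/
def sigma (η κ : Fin N → ℂ) (k : Fin N) : PowerSeries (U (spN N)) :=
  logOne (η k) (eIter η κ k.val k k)

/-- The jordanian factor `exp (H_{kk} ⊗ σ_k)`. -/
def jordanian (η κ : Fin N → ℂ) (k : Fin N) : PowerSeries (U2 (spN N)) :=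
  expS (tens (C (inc (hh k))) (sigma η κ k))

/-- The factor `exp (κ_k ξ η_k E_{k-i} ⊗ E^{(k-1)}_{k+i} e^{-σ_k / 2})` of the extension. -/
def extension (η κ : Fin N → ℂ) (k i : Fin N) : PowerSeries (U2 (spN N)) :=
  expS (X * ((κ k * η k) • tens (C (inc (eMinus k i)))
    (eIter η κ k.val k i * expS (-((1 / 2 : ℂ) • sigma η κ k)))))

/-- The `k`-th link: the extension factors, with larger `i` to the left, times the
jordanian factor. -/
def link (η κ : Fin N → ℂ) (k : Fin N) : PowerSeries (U2 (spN N)) :=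
  (((List.finRange N).reverse.filter fun i => k < i).map (extension η κ k)).prod *
    jordanian η κ k

/-- The chain of the first `p` links, later links to the left. -/
def chain (η κ : Fin N → ℂ) : ℕ → PowerSeries (U2 (spN N))
  | 0 => 1
  | p + 1 => if h : p < N then link η κ ⟨p, h⟩ * chain η κ p else chain η κ p

/-- `Φ_R = exp (∑_{i, j ≤ p} ξ_{ij} σ_i ⊗ σ_j)` with `ξ_{ij} = c_{ij} / ξ`, where `c_{ij}` is a
formal power series in `ξ`. -/
def phiR (p : ℕ) (η κ : Fin N → ℂ) (c : Fin N → Fin N → PowerSeries ℂ) :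
    PowerSeries (U2 (spN N)) :=
  expS (∑ i ∈ links N p, ∑ j ∈ links N p,
    scal (c i j) * divXi (tens (sigma η κ i) (sigma η κ j)))

end Symplectic

end ChainTwist

end

noncomputable section

namespace ChainTwist

attribute [local instance] LieRing.ofAssociativeRing

/-! ### Substitution of series in a noncommutative algebra -/

section Series

variable {A : Type} [Ring A]

/-! Quantum side. A link is an extended jordanian twist `L = exp(T) J` in generators `h, e, a_i,
b_i` with `[h,e] = e`, `[h,a_i] = a_i/2`, `[h,b_i] = b_i/2`, `[a_i,b_j] = δ_ij e` and all other
brackets relevant to the link zero (`LinkData`). Write `σ = log(1+e)`, `β_i = b_i e^{-σ/2}`.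
Everything rests on two conjugation rules: `L` carries `log(1 + e⊗1 + 1⊗e)` to `σ⊗1 + 1⊗σ`
(`L_mul_S`), and it carries the primitive version `B i` of `β_i` to `β_i⊗1 + e^{σ/2}⊗β_i`
(`L_mul_B`). With them both sides of the twist equation become one and the same product of
exponentials (`left_eq_cubeProd`, `right_eq_cubeProd`). The computation uses the previous twist `F`
only through its own twist equation and the primitivity of `h, e, a_i, b_i` for `Δ_F`, so links can
be stacked (`isTwist_L_mul`).

For the next link one needs generators that are still primitive. The remaining `E_{i-j}` are,
because `T` is a `gl`-invariant pairing (`L_mul_invariant`). The remaining `E_{i+j}` are not, but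
their defect is quadratic in the `β`'s and is removed exactly by the correction that defines
`E^{(k)}_{i+j}` (`L_mul_deformed`). The corrected elements transform under the remaining `gl` as the
old ones did (`gl_mul_eIter`), so the induction `ChainInvariant.succ` closes. Each `σ_k` becomes
primitive at its own link and commutes with all later ones. The exponential of a bilinear expression
in commuting primitive elements is a twist, since `(Δ_F ⊗ id)A = A₁₃ + A₂₃` and `(id ⊗ Δ_F)A = A₁₂ +
A₁₃` (`abelian_isTwist`).

Classical limit. If `F = 1 + ξ f + O(ξ²)`, then `r = f - f₂₁`, and the classical Yang-Baxter
equation is the alternating sum over `S₃` of the `ξ²` part of the twist equation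
(`isCYBE_of_isTwist`).

Forms. The carrier consists of block upper triangular matrices, so the `H*_{ii}` vanish on brackets
and their wedges are cocycles; they are no coboundaries because the `H_{ii}` commute. The values of
`ω̂_p(x, ·)` on the generators are matrix entries of `x` up to scalars, plus `w`-terms on the
`H_{kk}`. Contracting the tensor `r̂` with this functional writes `x` in coordinates, and the `E ∧
E` terms cancel the `w`-terms (`contract_carrierTensor`). In finite dimension this one-sided inverse
is two-sided, and nondegeneracy follows. -/

theorem eq_of_forall_X_pow_dvd_sub {x y : PowerSeries A}
    (h : ∀ m, (X : PowerSeries A) ^ m ∣ x - y) : x = y := by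
  ext n
  have := X_pow_dvd_iff.mp (h (n + 1)) n n.lt_succ_self
  rwa [map_sub, sub_eq_zero] at this

/-- `X` is central, so divisibility by its powers is a two-sided condition although `A` is not
commutative. -/
theorem X_pow_dvd_mul_left {m : ℕ} {x : PowerSeries A} (y : PowerSeries A)
    (h : (X : PowerSeries A) ^ m ∣ x) : (X : PowerSeries A) ^ m ∣ y * x := by
  obtain ⟨z, rfl⟩ := h
  exact ⟨y * z, by rw [← mul_assoc, ← X_pow_mul, mul_assoc]⟩

theorem X_pow_dvd_pow {f : PowerSeries A} (hf : constantCoeff f = 0) (k : ℕ) :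
    (X : PowerSeries A) ^ k ∣ f ^ k := by
  obtain ⟨g, rfl⟩ := X_dvd_iff.mpr hf
  exact ⟨g ^ k, ((commute_X g).symm).mul_pow k⟩

theorem X_pow_dvd_pow_mul_pow {f g : PowerSeries A} (hf : constantCoeff f = 0)
    (hg : constantCoeff g = 0) (a b : ℕ) : (X : PowerSeries A) ^ (a + b) ∣ f ^ a * g ^ b := by
  obtain ⟨u, hu⟩ := X_pow_dvd_pow hf a
  obtain ⟨v, hv⟩ := X_pow_dvd_pow hg b
  refine ⟨u * v, ?_⟩
  rw [hu, hv, pow_add, mul_assoc, mul_assoc, ← mul_assoc u, ← X_pow_mul, mul_assoc]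

theorem coeff_pow_eq_zero {f : PowerSeries A} (hf : constantCoeff f = 0) {n k : ℕ} (h : n < k) :
    coeff n (f ^ k) = 0 :=
  X_pow_dvd_iff.mp (X_pow_dvd_pow hf k) n h

/-- Telescoping: every further factor `f` or `g` contributes one more power of `X`. This gain drives
`expS_injective`. -/
theorem pow_sub_pow_dvd {n : ℕ} {f g : PowerSeries A} (hf : constantCoeff f = 0)
    (hg : constantCoeff g = 0) (h : (X : PowerSeries A) ^ n ∣ f - g) (k : ℕ) :
    (X : PowerSeries A) ^ (n + k) ∣ f ^ (k + 1) - g ^ (k + 1) := by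
  induction k with
  | zero => simpa using h
  | succ k ih =>
    have e : f ^ (k + 1 + 1) - g ^ (k + 1 + 1) =
        f * (f ^ (k + 1) - g ^ (k + 1)) + (f - g) * g ^ (k + 1) := by
      rw [pow_succ' f (k + 1), pow_succ' g (k + 1)]; noncomm_ring
    rw [e]
    refine dvd_add ?_ ?_
    · obtain ⟨u, hu⟩ := ih
      obtain ⟨v, hv⟩ := X_dvd_iff.mpr hf
      exact ⟨v * u, by
        rw [hu, hv, ← add_assoc, pow_succ', mul_assoc, ← mul_assoc v, ← X_pow_mul, mul_assoc,
          mul_assoc]⟩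
    · obtain ⟨u, hu⟩ := h
      obtain ⟨v, hv⟩ := X_pow_dvd_pow hg (k + 1)
      exact ⟨u * v, by
        rw [hu, hv, pow_add X n, mul_assoc, mul_assoc, ← mul_assoc u, ← X_pow_mul, mul_assoc]⟩

variable [Algebra ℂ A]

theorem X_pow_dvd_smul {m : ℕ} {x : PowerSeries A} (c : ℂ)
    (h : (X : PowerSeries A) ^ m ∣ x) : (X : PowerSeries A) ^ m ∣ c • x := by
  obtain ⟨z, rfl⟩ := h
  exact ⟨c • z, by rw [mul_smul_comm]⟩

/-- The partial sum `∑_{k < m} aₖ fᵏ` of `substScalar φ f`. -/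
def partialSubst (φ : PowerSeries ℂ) (m : ℕ) (f : PowerSeries A) : PowerSeries A :=
  ∑ k ∈ Finset.range m, coeff k φ • f ^ k

/-- Since `X ^ k` divides `f ^ k`, identities between substituted series reduce modulo `X ^ m` to
identities of finite sums. The freedom in the cut-off `m'` is needed in `expS_mul_of_lie`, where
sums of different lengths meet. -/
theorem X_pow_dvd_substScalar_sub (φ : PowerSeries ℂ) {f : PowerSeries A}
    (hf : constantCoeff f = 0) {m m' : ℕ} (h : m ≤ m') :
    (X : PowerSeries A) ^ m ∣ substScalar φ f - partialSubst φ m' f := by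
  refine X_pow_dvd_iff.mpr fun n hn => ?_
  rw [map_sub, sub_eq_zero, substScalar, coeff_mk, partialSubst, map_sum]
  simp only [coeff_smul]
  refine Finset.sum_subset (fun k hk => ?_) fun k _ hk => ?_
  · simp only [Finset.mem_range] at hk ⊢; omega
  · rw [coeff_pow_eq_zero hf (by simpa using hk), smul_zero]

theorem constantCoeff_substScalar (φ : PowerSeries ℂ) (f : PowerSeries A) :
    constantCoeff (substScalar φ f) = algebraMap ℂ A (constantCoeff φ) := by
  rw [← coeff_zero_eq_constantCoeff_apply, substScalar, coeff_mk]
  simp [Algebra.algebraMap_eq_smul_one]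

/-- An intertwining relation passes to powers, linear combinations and `X`-adic limits. Most
conjugation rules below are obtained by finding such a relation between exponents. -/
theorem mul_substScalar (φ : PowerSeries ℂ) {f g y : PowerSeries A} (hf : constantCoeff f = 0)
    (hg : constantCoeff g = 0) (h : y * f = g * y) :
    y * substScalar φ f = substScalar φ g * y := by
  have hp : ∀ k, y * f ^ k = g ^ k * y := fun k => (SemiconjBy.pow_right h k)
  refine eq_of_forall_X_pow_dvd_sub fun m => ?_
  obtain ⟨u, hu⟩ := X_pow_dvd_substScalar_sub φ hf (le_refl m)
  obtain ⟨v, hv⟩ := X_pow_dvd_substScalar_sub φ hg (le_refl m)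
  rw [sub_eq_iff_eq_add] at hu hv
  have e : y * partialSubst φ m f = partialSubst φ m g * y := by
    simp only [partialSubst, Finset.mul_sum, Finset.sum_mul, mul_smul_comm, smul_mul_assoc, hp]
  rw [hu, hv, mul_add, add_mul, e, add_sub_add_right_eq_sub]
  exact dvd_sub (X_pow_dvd_mul_left _ (dvd_mul_right _ _)) (by rw [mul_assoc]; exact dvd_mul_right _ _)

theorem map_substScalar {B : Type} [Ring B] [Algebra ℂ B] (F : A →ₐ[ℂ] B) (φ : PowerSeries ℂ)
    (f : PowerSeries A) : ap F (substScalar φ f) = substScalar φ (ap F f) := by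
  ext n
  simp only [substScalar, coeff_map, coeff_mk, map_sum, ← map_pow]
  exact Finset.sum_congr rfl fun k _ => map_smul F _ _

/-- The square `a, b < m` and the triangle `a + b < m` differ by terms of order at least `m`. This
is the Cauchy product modulo `X ^ m`. -/
theorem X_pow_dvd_sum_sub {B : Type} [Ring B] (G : ℕ → ℕ → PowerSeries B)
    (hG : ∀ a b, (X : PowerSeries B) ^ (a + b) ∣ G a b) (m : ℕ) :
    (X : PowerSeries B) ^ m ∣ (∑ a ∈ Finset.range m, ∑ b ∈ Finset.range m, G a b) -
      ∑ k ∈ Finset.range m, ∑ q ∈ (Finset.HasAntidiagonal.antidiagonal k : Finset (ℕ × ℕ)), G q.1 q.2 := by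
  rw [← Finset.sum_product', ← Finset.sum_filter_add_sum_filter_not _ (fun q : ℕ × ℕ => q.1 + q.2 < m)]
  have e : ∑ k ∈ Finset.range m, ∑ q ∈ (Finset.HasAntidiagonal.antidiagonal k : Finset (ℕ × ℕ)), G q.1 q.2 =
      ∑ q ∈ (Finset.range m ×ˢ Finset.range m).filter (fun q => q.1 + q.2 < m), G q.1 q.2 := by
    rw [← Finset.sum_fiberwise_of_maps_to (t := Finset.range m) (g := fun q : ℕ × ℕ => q.1 + q.2)
      (fun q hq => by simpa using (Finset.mem_filter.mp hq).2)]
    refine Finset.sum_congr rfl fun k hk => Finset.sum_congr ?_ fun _ _ => rfl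
    ext q
    simp only [Finset.HasAntidiagonal.mem_antidiagonal, Finset.mem_filter, Finset.mem_product, Finset.mem_range]
      at hk ⊢
    omega
  rw [e, add_sub_cancel_left]
  refine Finset.dvd_sum fun q hq => (pow_dvd_pow _ ?_).trans (hG _ _)
  exact not_lt.mp (Finset.mem_filter.mp hq).2

theorem substScalar_mul (φ ψ : PowerSeries ℂ) {f : PowerSeries A} (hf : constantCoeff f = 0) :
    substScalar (φ * ψ) f = substScalar φ f * substScalar ψ f := by
  refine (eq_of_forall_X_pow_dvd_sub fun m => ?_).symm
  obtain ⟨u, hu⟩ := X_pow_dvd_substScalar_sub φ hf (le_refl m)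
  obtain ⟨v, hv⟩ := X_pow_dvd_substScalar_sub ψ hf (le_refl m)
  obtain ⟨w, hw⟩ := X_pow_dvd_substScalar_sub (φ * ψ) hf (le_refl m)
  rw [sub_eq_iff_eq_add] at hu hv hw
  have key := X_pow_dvd_sum_sub (fun a b => (coeff a φ * coeff b ψ) • f ^ (a + b))
    (fun a b => X_pow_dvd_smul _ (X_pow_dvd_pow hf _)) m
  have e1 : (∑ a ∈ Finset.range m, ∑ b ∈ Finset.range m,
      (coeff a φ * coeff b ψ) • f ^ (a + b)) = partialSubst φ m f * partialSubst ψ m f := by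
    simp only [partialSubst, Finset.sum_mul_sum, smul_mul_smul_comm, pow_add]
  have e2 : (∑ k ∈ Finset.range m, ∑ q ∈ Finset.HasAntidiagonal.antidiagonal k,
      (coeff q.1 φ * coeff q.2 ψ) • f ^ (q.1 + q.2)) = partialSubst (φ * ψ) m f := by
    refine Finset.sum_congr rfl fun k _ => ?_
    rw [coeff_mul, Finset.sum_smul]
    exact Finset.sum_congr rfl fun q hq => by rw [Finset.HasAntidiagonal.mem_antidiagonal.mp hq]
  rw [e1, e2] at key
  rw [hu, hv, hw]
  have : (X ^ m * u + partialSubst φ m f) * (X ^ m * v + partialSubst ψ m f) -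
      (X ^ m * w + partialSubst (φ * ψ) m f) =
      (partialSubst φ m f * partialSubst ψ m f - partialSubst (φ * ψ) m f) +
      X ^ m * (u * (X ^ m * v + partialSubst ψ m f) - w) + partialSubst φ m f * (X ^ m * v) := by
    noncomm_ring
  rw [this]
  exact dvd_add (dvd_add key (dvd_mul_right _ _)) (X_pow_dvd_mul_left _ (dvd_mul_right _ _))

theorem substScalar_one (f : PowerSeries A) : substScalar 1 f = 1 := by
  ext n
  rw [substScalar, coeff_mk, Finset.sum_eq_single 0]
  · simp
  · intro k _ hk; simp [coeff_one, hk]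
  · simp

theorem substScalar_one_add_X {f : PowerSeries A} (hf : constantCoeff f = 0) :
    substScalar (1 + X) f = 1 + f := by
  ext n
  rw [substScalar, coeff_mk]
  rcases n with _ | n
  · simp [hf]
  · rw [Finset.sum_range_succ', Finset.sum_range_succ', Finset.sum_eq_zero]
    · simp [coeff_one, coeff_X]
    · intro k _; simp [coeff_one, coeff_X]

theorem substScalar_pow (φ : PowerSeries ℂ) {f : PowerSeries A} (hf : constantCoeff f = 0)
    (k : ℕ) : substScalar (φ ^ k) f = substScalar φ f ^ k := by
  induction k with
  | zero => rw [pow_zero, pow_zero, substScalar_one]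
  | succ k ih => rw [pow_succ, pow_succ, substScalar_mul _ _ hf, ih]

/-- In the `n`-th coefficient both substitutions stop at exponent `n`, so associativity is an
exchange of two finite sums. -/
theorem substScalar_substScalar (φ : PowerSeries ℂ) {ψ : PowerSeries ℂ}
    (hψ : constantCoeff ψ = 0) {f : PowerSeries A} (hf : constantCoeff f = 0) :
    substScalar φ (substScalar ψ f) = substScalar (φ.subst ψ) f := by
  ext n
  have h : ∀ j ∈ Finset.range (n + 1), coeff j (φ.subst ψ) =
      ∑ k ∈ Finset.range (n + 1), coeff k φ * coeff j (ψ ^ k) := by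
    intro j hj
    rw [coeff_subst' (HasSubst.of_constantCoeff_zero' hψ), finsum_eq_sum_of_support_subset]
    · rfl
    · intro k hk
      by_contra hk'
      simp only [Finset.coe_range, Set.mem_Iio, Finset.mem_range] at hk' hj
      exact hk (by simp only [coeff_pow_eq_zero hψ (show j < k by omega), smul_zero])
  calc coeff n (substScalar φ (substScalar ψ f))
      = ∑ k ∈ Finset.range (n + 1), coeff k φ • coeff n (substScalar (ψ ^ k) f) := by
        rw [substScalar, coeff_mk]
        exact Finset.sum_congr rfl fun k _ => by rw [substScalar_pow ψ hf]
    _ = ∑ k ∈ Finset.range (n + 1), ∑ j ∈ Finset.range (n + 1),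
          (coeff k φ * coeff j (ψ ^ k)) • coeff n (f ^ j) := by
        refine Finset.sum_congr rfl fun k _ => ?_
        rw [substScalar, coeff_mk, Finset.smul_sum]
        exact Finset.sum_congr rfl fun j _ => by rw [mul_smul]
    _ = ∑ j ∈ Finset.range (n + 1), coeff j (φ.subst ψ) • coeff n (f ^ j) := by
        rw [Finset.sum_comm]
        exact Finset.sum_congr rfl fun j hj => by rw [h j hj, Finset.sum_smul]
    _ = coeff n (substScalar (φ.subst ψ) f) := by rw [substScalar, coeff_mk]

/-- The composite `E` solves `(1 + X) E' = E` with `E(0) = 1`, and this determines its coefficients.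
-/
theorem exp_subst_log : (PowerSeries.exp ℂ).subst (PowerSeries.log ℂ) = 1 + X := by
  set E := (PowerSeries.exp ℂ).subst (PowerSeries.log ℂ) with hE
  have h0 : coeff 0 E = 1 := by
    rw [hE, coeff_subst' HasSubst.log, finsum_eq_single _ 0]
    · simp
    · intro k hk
      rw [coeff_pow_eq_zero constantCoeff_log (Nat.pos_of_ne_zero hk), smul_zero]
  have hd : derivative ℂ E * (1 + X) = E := by
    rw [hE, derivative_subst HasSubst.log, derivative_exp, deriv_log, mul_assoc]
    have : (PowerSeries.mk fun n => algebraMap ℚ ℂ ((-1 : ℚ) ^ n)) * (1 + X : PowerSeries ℂ) = 1 := by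
      ext n
      rcases n with _ | n
      · simp
      · rw [mul_add, mul_one, map_add, coeff_succ_mul_X, coeff_mk, coeff_mk, coeff_one]
        simp [pow_succ]
    rw [this, mul_one]
  -- In other words `(n+2) a_{n+2} = -n a_{n+1}`: the factor `n` kills `a_2`, hence everything after
  -- it.
  have hs : ∀ n, coeff (n + 2) E * (n + 2) + coeff (n + 1) E * (n + 1) = coeff (n + 1) E := by
    intro n
    conv_rhs => rw [← hd]
    rw [mul_add (derivative ℂ E), mul_one, map_add, coeff_succ_mul_X, coeff_derivative,
      coeff_derivative]
    push_cast; ring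
  have h1 : coeff 1 E = 1 := by
    have := congrArg (coeff 0) hd
    rw [h0, mul_add, mul_one, map_add, coeff_zero_mul_X, coeff_derivative] at this
    simpa using this
  have h2 : ∀ n, coeff (n + 2) E = 0 := by
    intro n
    induction n with
    | zero =>
      have := hs 0
      simp only [Nat.cast_zero, zero_add, h1] at this
      linear_combination this / 2
    | succ n ih =>
      have := hs (n + 1)
      rw [show n + 1 + 1 = n + 2 from rfl, ih, zero_mul, add_zero] at this
      refine (mul_eq_zero.mp this).resolve_right ?_
      exact_mod_cast (n + 2).succ_ne_zero
  ext n
  rcases n with _ | _ | n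
  · simp [h0]
  · simp [h1, coeff_one]
  · simp [h2, coeff_one, coeff_X]

end Series

/-! ### Exponentials and logarithms -/

section Exp

variable {A : Type} [Ring A] [Algebra ℂ A]

theorem expS_log1p {f : PowerSeries A} (hf : constantCoeff f = 0) : expS (log1p f) = 1 + f := by
  rw [expS, log1p, substScalar_substScalar _ constantCoeff_log hf, exp_subst_log,
    substScalar_one_add_X hf]

theorem constantCoeff_log1p (f : PowerSeries A) : constantCoeff (log1p f) = 0 := by
  rw [log1p, constantCoeff_substScalar, constantCoeff_log, map_zero]

theorem map_expS {B : Type} [Ring B] [Algebra ℂ B] (F : A →ₐ[ℂ] B) (f : PowerSeries A) :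
    ap F (expS f) = expS (ap F f) := map_substScalar F _ f

theorem map_log1p {B : Type} [Ring B] [Algebra ℂ B] (F : A →ₐ[ℂ] B) (f : PowerSeries A) :
    ap F (log1p f) = log1p (ap F f) := map_substScalar F _ f

theorem mul_expS {f g y : PowerSeries A} (hf : constantCoeff f = 0) (hg : constantCoeff g = 0)
    (h : y * f = g * y) : y * expS f = expS g * y := mul_substScalar _ hf hg h

theorem mul_log1p {f g y : PowerSeries A} (hf : constantCoeff f = 0) (hg : constantCoeff g = 0)
    (h : y * f = g * y) : y * log1p f = log1p g * y := mul_substScalar _ hf hg h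

theorem commute_expS {f y : PowerSeries A} (hf : constantCoeff f = 0) (h : Commute y f) :
    Commute y (expS f) := mul_expS hf hf h

theorem commute_log1p {f y : PowerSeries A} (hf : constantCoeff f = 0) (h : Commute y f) :
    Commute y (log1p f) := mul_log1p hf hf h

theorem expS_zero : expS (0 : PowerSeries A) = 1 := by
  ext n
  rw [expS, substScalar, coeff_mk, Finset.sum_eq_single 0]
  · simp
  · intro k _ hk; simp [hk]
  · simp

theorem log1p_zero : log1p (0 : PowerSeries A) = 0 := by
  ext n
  rw [log1p, substScalar, coeff_mk, Finset.sum_eq_zero, map_zero]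
  intro k _
  rcases k with _ | k <;> simp

theorem coeff_exp' (k : ℕ) : coeff k (PowerSeries.exp ℂ) = ((k.factorial : ℂ))⁻¹ := by
  simp [PowerSeries.coeff_exp]

/-- The binomial theorem for commuting elements, summed over the triangle of `X_pow_dvd_sum_sub`. -/
theorem expS_add {f g : PowerSeries A} (hf : constantCoeff f = 0) (hg : constantCoeff g = 0)
    (h : Commute f g) : expS (f + g) = expS f * expS g := by
  refine (eq_of_forall_X_pow_dvd_sub fun m => ?_).symm
  have hfg : constantCoeff (f + g) = 0 := by rw [map_add, hf, hg, add_zero]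
  obtain ⟨u, hu⟩ := X_pow_dvd_substScalar_sub (PowerSeries.exp ℂ) hf (le_refl m)
  obtain ⟨v, hv⟩ := X_pow_dvd_substScalar_sub (PowerSeries.exp ℂ) hg (le_refl m)
  obtain ⟨w, hw⟩ := X_pow_dvd_substScalar_sub (PowerSeries.exp ℂ) hfg (le_refl m)
  rw [sub_eq_iff_eq_add] at hu hv hw
  have key := X_pow_dvd_sum_sub (fun a b => ((a.factorial : ℂ)⁻¹ * (b.factorial : ℂ)⁻¹) •
    (f ^ a * g ^ b)) (fun a b => X_pow_dvd_smul _ (X_pow_dvd_pow_mul_pow hf hg a b)) m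
  have e1 : (∑ a ∈ Finset.range m, ∑ b ∈ Finset.range m,
      ((a.factorial : ℂ)⁻¹ * (b.factorial : ℂ)⁻¹) • (f ^ a * g ^ b)) =
      partialSubst (PowerSeries.exp ℂ) m f * partialSubst (PowerSeries.exp ℂ) m g := by
    simp only [partialSubst, Finset.sum_mul_sum, smul_mul_smul_comm, coeff_exp']
  have e2 : (∑ k ∈ Finset.range m, ∑ q ∈ Finset.HasAntidiagonal.antidiagonal k,
      ((q.1.factorial : ℂ)⁻¹ * (q.2.factorial : ℂ)⁻¹) • (f ^ q.1 * g ^ q.2)) =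
      partialSubst (PowerSeries.exp ℂ) m (f + g) := by
    refine Finset.sum_congr rfl fun k _ => ?_
    rw [coeff_exp', h.add_pow', Finset.smul_sum]
    refine Finset.sum_congr rfl fun q hq => ?_
    rw [← Nat.cast_smul_eq_nsmul ℂ, smul_smul]
    congr 1
    rw [← Finset.HasAntidiagonal.mem_antidiagonal.mp hq, Nat.choose_symm_add, Nat.add_choose,
      Nat.cast_div (Nat.factorial_mul_factorial_dvd_factorial_add _ _)
        (by exact_mod_cast (Nat.mul_ne_zero (Nat.factorial_ne_zero _) (Nat.factorial_ne_zero _)))]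
    have h1 : ((q.1 + q.2).factorial : ℂ) ≠ 0 := by exact_mod_cast Nat.factorial_ne_zero _
    push_cast
    field_simp
  rw [e1, e2] at key
  rw [expS, expS, expS, hu, hv, hw]
  generalize partialSubst (PowerSeries.exp ℂ) m f = a at *
  generalize partialSubst (PowerSeries.exp ℂ) m g = b at *
  generalize partialSubst (PowerSeries.exp ℂ) m (f + g) = c at *
  have : (X ^ m * u + a) * (X ^ m * v + b) - (X ^ m * w + c) =
      (a * b - c) + X ^ m * (u * (X ^ m * v + b) - w) + a * (X ^ m * v) := by
    noncomm_ring
  rw [this]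
  exact dvd_add (dvd_add key (dvd_mul_right _ _)) (X_pow_dvd_mul_left _ (dvd_mul_right _ _))

theorem expS_mul_expS_neg {f : PowerSeries A} (hf : constantCoeff f = 0) :
    expS f * expS (-f) = 1 := by
  rw [← expS_add hf (by rw [map_neg, hf, neg_zero]) (Commute.refl f).neg_right, add_neg_cancel,
    expS_zero]

theorem expS_neg_mul_expS {f : PowerSeries A} (hf : constantCoeff f = 0) :
    expS (-f) * expS f = 1 := by
  have := expS_mul_expS_neg (f := -f) (by rw [map_neg, hf, neg_zero])
  rwa [neg_neg] at this

theorem isUnit_expS {f : PowerSeries A} (hf : constantCoeff f = 0) : IsUnit (expS f) :=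
  ⟨⟨_, _, expS_mul_expS_neg hf, expS_neg_mul_expS hf⟩, rfl⟩

/-- If `f` and `g` agree to some order, their powers from the second on agree to one order more, so
equality of the exponentials forces the linear terms to agree there too. It serves to recognise
logarithms. -/
theorem expS_injective {f g : PowerSeries A} (hf : constantCoeff f = 0)
    (hg : constantCoeff g = 0) (h : expS f = expS g) : f = g := by
  refine eq_of_forall_X_pow_dvd_sub fun m => ?_
  induction m with
  | zero => simp
  | succ n ih =>
    refine X_pow_dvd_iff.mpr fun j hj => ?_
    rcases Nat.lt_succ_iff_lt_or_eq.mp hj with hj | rfl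
    · exact X_pow_dvd_iff.mp ih j hj
    rcases j with _ | j
    · simp [hf, hg]
    have h1 := congrArg (coeff (j + 1)) h
    simp only [expS, substScalar, coeff_mk] at h1
    rw [Finset.sum_range_succ', Finset.sum_range_succ', Finset.sum_range_succ',
      Finset.sum_range_succ'] at h1
    have h2 : ∀ k, coeff (j + 1) (f ^ (k + 1 + 1)) = coeff (j + 1) (g ^ (k + 1 + 1)) := by
      intro k
      have := X_pow_dvd_iff.mp (pow_sub_pow_dvd hf hg ih (k + 1)) (j + 1) (by omega)
      rwa [map_sub, sub_eq_zero] at this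
    simp only [h2, zero_add, pow_one, pow_zero] at h1
    have h3 := add_left_cancel (add_right_cancel h1)
    rw [coeff_exp'] at h3
    simpa [sub_eq_zero] using h3

/-- If `[T, y] = c`, `[T, c] = d` and `[T, d] = 0`, then
`exp T · y = (y + c + d / 2) · exp T`. -/
theorem expS_mul_of_lie {T y c d : PowerSeries A} (hT : constantCoeff T = 0)
    (hy : T * y = y * T + c) (hc : T * c = c * T + d) (hd : T * d = d * T) :
    expS T * y = (y + c + (1 / 2 : ℂ) • d) * expS T := by
  -- This is `T^n y = y T^n + n c T^{n-1} + (n choose 2) d T^{n-2}`, with `n = k + 2` to keep the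
  -- exponents natural.
  have hp : ∀ k : ℕ, T ^ (k + 2) * y =
      y * T ^ (k + 2) + (k + 2 : ℂ) • (c * T ^ (k + 1)) + ((k + 2) * (k + 1) / 2 : ℂ) • (d * T ^ k) := by
    intro k
    induction k with
    | zero =>
      simp only [Nat.cast_zero, zero_add, pow_one, pow_zero, mul_one]
      rw [pow_two, mul_assoc, hy, mul_add, ← mul_assoc, hy, hc, add_mul]
      norm_num [two_smul]
      rw [mul_assoc]; abel
    | succ k ih =>
      have hdk : d * T = T * d := hd.symm
      rw [pow_succ' T (k + 1 + 1), mul_assoc, ih, mul_add, mul_add, mul_smul_comm, mul_smul_comm,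
        ← mul_assoc T y, hy, ← mul_assoc T c, hc, ← mul_assoc T d, hd]
      simp only [add_mul, mul_assoc, ← pow_succ', smul_add]
      push_cast
      module
  -- Each commutator lowers the power of `T` by one, whence the lengths `m + 2`, `m + 1`, `m`;
  -- modulo `X ^ m` all three sums are `expS T`.
  have hq : ∀ m, partialSubst (PowerSeries.exp ℂ) (m + 2) T * y =
      y * partialSubst (PowerSeries.exp ℂ) (m + 2) T +
        c * partialSubst (PowerSeries.exp ℂ) (m + 1) T +
        (1 / 2 : ℂ) • (d * partialSubst (PowerSeries.exp ℂ) m T) := by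
    intro m
    induction m with
    | zero =>
      simp [partialSubst, Finset.sum_range_succ, add_mul, mul_add, hy]; abel
    | succ m ih =>
      have hs : ∀ j, partialSubst (PowerSeries.exp ℂ) (j + 1) T =
          partialSubst (PowerSeries.exp ℂ) j T + ((j.factorial : ℂ)⁻¹) • T ^ j := by
        intro j; rw [partialSubst, Finset.sum_range_succ, ← partialSubst, coeff_exp']
      have f0 : (m.factorial : ℂ) ≠ 0 := by exact_mod_cast m.factorial_ne_zero
      have f1 : (m + 1 : ℂ) ≠ 0 := by exact_mod_cast m.succ_ne_zero
      have f2 : (m + 2 : ℂ) ≠ 0 := by exact_mod_cast (m + 1).succ_ne_zero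
      have g1 : (((m + 1).factorial : ℕ) : ℂ) = (m + 1) * m.factorial := by
        push_cast [Nat.factorial_succ]; ring
      have g2 : (((m + 2).factorial : ℕ) : ℂ) = (m + 2) * ((m + 1) * m.factorial) := by
        push_cast [Nat.factorial_succ]; ring
      have k1 : ((m + 2 : ℂ) * ((m + 1) * m.factorial))⁻¹ * (m + 2) =
          ((m + 1 : ℂ) * m.factorial)⁻¹ := by field_simp
      have k2 : ((m + 2 : ℂ) * ((m + 1) * m.factorial))⁻¹ * ((m + 2) * (m + 1) / 2) =
          1 / 2 * (m.factorial : ℂ)⁻¹ := by field_simp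
      rw [hs (m + 2), add_mul, ih, smul_mul_assoc, hp, hs (m + 1), hs m, g1, g2, smul_add,
        smul_add, smul_smul, smul_smul, k1, k2]
      simp only [mul_add, smul_add, mul_smul_comm, smul_smul]
      abel
  refine eq_of_forall_X_pow_dvd_sub fun m => ?_
  obtain ⟨u, hu⟩ := X_pow_dvd_substScalar_sub (PowerSeries.exp ℂ) hT (Nat.le_add_right m 2)
  obtain ⟨v, hv⟩ := X_pow_dvd_substScalar_sub (PowerSeries.exp ℂ) hT (Nat.le_add_right m 1)
  obtain ⟨w, hw⟩ := X_pow_dvd_substScalar_sub (PowerSeries.exp ℂ) hT (le_refl m)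
  rw [sub_eq_iff_eq_add] at hu hv hw
  have e : expS T * y - (y + c + (1 / 2 : ℂ) • d) * expS T =
      X ^ m * (u * y) - y * (X ^ m * u) - c * (X ^ m * v) - (1 / 2 : ℂ) • (d * (X ^ m * w)) := by
    rw [add_mul, add_mul, smul_mul_assoc, expS]
    conv_lhs =>
      lhs
      rw [hu]
    conv_lhs =>
      rhs
      lhs
      lhs
      rw [hu]
    conv_lhs =>
      rhs
      lhs
      rhs
      rw [hv]
    rw [hw, add_mul, hq, mul_add, mul_add, mul_add, smul_add, mul_assoc]
    abel
  rw [e]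
  exact dvd_sub (dvd_sub (dvd_sub (dvd_mul_right _ _) (X_pow_dvd_mul_left _ (dvd_mul_right _ _)))
    (X_pow_dvd_mul_left _ (dvd_mul_right _ _)))
    (X_pow_dvd_smul _ (X_pow_dvd_mul_left _ (dvd_mul_right _ _)))

theorem coeff_zero_expS {f : PowerSeries A} : coeff 0 (expS f) = 1 := by
  rw [coeff_zero_eq_constantCoeff_apply, expS, constantCoeff_substScalar]; simp

theorem coeff_one_expS {f : PowerSeries A} : coeff 1 (expS f) = coeff 1 f := by
  rw [expS, substScalar, coeff_mk]
  simp [Finset.sum_range_succ, coeff_one]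

theorem coeff_one_log1p {f : PowerSeries A} : coeff 1 (log1p f) = coeff 1 f := by
  rw [log1p, substScalar, coeff_mk]
  simp [Finset.sum_range_succ, coeff_log]

end Exp

/-! ### Legs of the tensor square -/

section Legs

variable {A : Type} [Ring A] [Algebra ℂ A]

theorem ap_smul {B : Type} [Ring B] [Algebra ℂ B] (F : A →ₐ[ℂ] B) (c : ℂ) (f : PowerSeries A) :
    ap F (c • f) = c • ap F f := by
  ext n; simp only [coeff_map, coeff_smul]; exact map_smul F _ _

/-- `f ↦ f ⊗ 1`. -/
abbrev inL : PowerSeries A →+* PowerSeries (A ⊗[ℂ] A) :=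
  ap (Algebra.TensorProduct.includeLeft : A →ₐ[ℂ] A ⊗[ℂ] A)

/-- `f ↦ 1 ⊗ f`. -/
abbrev inR : PowerSeries A →+* PowerSeries (A ⊗[ℂ] A) :=
  ap (Algebra.TensorProduct.includeRight : A →ₐ[ℂ] A ⊗[ℂ] A)

theorem tens_eq (f g : PowerSeries A) : tens f g = inL f * inR g := rfl

theorem commute_of_coeff {B : Type} [Ring B] {f g : PowerSeries B}
    (h : ∀ m n, Commute (coeff m f) (coeff n g)) : Commute f g := by
  ext n
  rw [coeff_mul, coeff_mul, ← Finset.Nat.sum_antidiagonal_swap]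
  exact Finset.sum_congr rfl fun q _ => h q.2 q.1

theorem commute_inL_inR (f g : PowerSeries A) : Commute (inL f) (inR g) := by
  refine commute_of_coeff fun m n => ?_
  rw [coeff_map, coeff_map]
  exact (Commute.one_right _).tmul (Commute.one_left _)

theorem constantCoeff_mul_eq_zero {B : Type} [Ring B] {f : PowerSeries B} (g : PowerSeries B)
    (h : constantCoeff f = 0) : constantCoeff (f * g) = 0 := by rw [map_mul, h, zero_mul]

theorem constantCoeff_neg_eq_zero {B : Type} [Ring B] {f : PowerSeries B}
    (h : constantCoeff f = 0) : constantCoeff (-f) = 0 := by rw [map_neg, h, neg_zero]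

theorem constantCoeff_add_eq_zero {B : Type} [Ring B] {f g : PowerSeries B}
    (h : constantCoeff f = 0) (h' : constantCoeff g = 0) : constantCoeff (f + g) = 0 := by
  rw [map_add, h, h', add_zero]

theorem constantCoeff_ap {B : Type} [Ring B] [Algebra ℂ B] (F : A →ₐ[ℂ] B) {f : PowerSeries A}
    (h : constantCoeff f = 0) : constantCoeff (ap F f) = 0 := by
  rw [← coeff_zero_eq_constantCoeff_apply, coeff_map, coeff_zero_eq_constantCoeff_apply, h,
    map_zero]

theorem constantCoeff_smul_eq_zero {f : PowerSeries A} (c : ℂ)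
    (h : constantCoeff f = 0) : constantCoeff (c • f) = 0 := by
  rw [← coeff_zero_eq_constantCoeff_apply, coeff_smul, coeff_zero_eq_constantCoeff_apply, h,
    smul_zero]

theorem constantCoeff_tens {f g : PowerSeries A} (h : constantCoeff g = 0) :
    constantCoeff (tens f g) = 0 := by
  rw [tens_eq, map_mul, constantCoeff_ap _ h, mul_zero]

end Legs

/-! ### Extended jordanian twists -/

/-- Generators `h, e, aᵢ, bᵢ` of a link, with the parameters absorbed in `e`, `aᵢ`, `bᵢ`. -/
structure LinkData (A : Type) [Ring A] [Algebra ℂ A] (ι : Type) where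
  idx : Finset ι
  h : PowerSeries A
  e : PowerSeries A
  a : ι → PowerSeries A
  b : ι → PowerSeries A
  const_e : constantCoeff e = 0
  const_b : ∀ i, constantCoeff (b i) = 0
  h_e : h * e = e * h + e
  h_a : ∀ i ∈ idx, h * a i = a i * h + (1 / 2 : ℂ) • a i
  h_b : ∀ i ∈ idx, h * b i = b i * h + (1 / 2 : ℂ) • b i
  a_a : ∀ i ∈ idx, ∀ j ∈ idx, Commute (a i) (a j)
  b_b : ∀ i ∈ idx, ∀ j ∈ idx, Commute (b i) (b j)
  e_a : ∀ i ∈ idx, Commute e (a i)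
  e_b : ∀ i ∈ idx, Commute e (b i)
  a_b_self : ∀ i ∈ idx, a i * b i = b i * a i + e
  a_b_ne : ∀ i ∈ idx, ∀ j ∈ idx, i ≠ j → Commute (a i) (b j)

namespace LinkData

variable {A : Type} [Ring A] [Algebra ℂ A] {ι : Type} (D : LinkData A ι)

/-- `σ = log (1 + e)`. -/
def σ : PowerSeries A := log1p D.e

/-- `e^{-σ/2}`. -/
def q : PowerSeries A := expS (-((1 / 2 : ℂ) • D.σ))

/-- `e^{σ/2}`. -/
def r : PowerSeries A := expS ((1 / 2 : ℂ) • D.σ)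

/-- `bᵢ e^{-σ/2}`. -/
def β (i : ι) : PowerSeries A := D.b i * D.q

/-- The exponent of the extension. -/
def T : PowerSeries (A ⊗[ℂ] A) := ∑ i ∈ D.idx, tens (D.a i) (D.β i)

/-- The jordanian factor. -/
def J : PowerSeries (A ⊗[ℂ] A) := expS (tens D.h D.σ)

/-- The extended jordanian twist. -/
def L : PowerSeries (A ⊗[ℂ] A) := expS D.T * D.J

/-- `log (1 + e ⊗ 1 + 1 ⊗ e)`. -/
def S : PowerSeries (A ⊗[ℂ] A) := log1p (inL D.e + inR D.e)

/-- `(bᵢ ⊗ 1 + 1 ⊗ bᵢ) (1 + e ⊗ 1 + 1 ⊗ e)^{-1/2}`. -/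
def B (i : ι) : PowerSeries (A ⊗[ℂ] A) :=
  (inL (D.b i) + inR (D.b i)) * expS (-((1 / 2 : ℂ) • D.S))

theorem const_σ : constantCoeff D.σ = 0 := constantCoeff_log1p _

theorem const_half : constantCoeff ((1 / 2 : ℂ) • D.σ) = 0 :=
  constantCoeff_smul_eq_zero _ D.const_σ

theorem const_neg_half : constantCoeff (-((1 / 2 : ℂ) • D.σ)) = 0 :=
  constantCoeff_neg_eq_zero D.const_half

theorem const_S : constantCoeff D.S = 0 := constantCoeff_log1p _

theorem const_β (i : ι) : constantCoeff (D.β i) = 0 :=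
  constantCoeff_mul_eq_zero _ (D.const_b i)

theorem const_T : constantCoeff D.T = 0 := by
  rw [T, map_sum]
  exact Finset.sum_eq_zero fun i _ => constantCoeff_tens (D.const_β i)

theorem const_H : constantCoeff (tens D.h D.σ) = 0 := constantCoeff_tens D.const_σ

theorem commute_σ {x : PowerSeries A} (h : Commute x D.e) : Commute x D.σ :=
  commute_log1p D.const_e h

theorem commute_q {x : PowerSeries A} (h : Commute x D.e) : Commute x D.q :=
  commute_expS D.const_neg_half ((D.commute_σ h).smul_right _).neg_right

theorem commute_r {x : PowerSeries A} (h : Commute x D.e) : Commute x D.r :=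
  commute_expS D.const_half ((D.commute_σ h).smul_right _)

theorem e_q : Commute D.e D.q := D.commute_q (Commute.refl _)

theorem e_β {i : ι} (hi : i ∈ D.idx) : Commute D.e (D.β i) := (D.e_b i hi).mul_right D.e_q

theorem b_q {i : ι} (hi : i ∈ D.idx) : Commute (D.b i) D.q := D.commute_q (D.e_b i hi).symm
theorem a_q {i : ι} (hi : i ∈ D.idx) : Commute (D.a i) D.q := D.commute_q (D.e_a i hi).symm

theorem b_β {i j : ι} (hi : i ∈ D.idx) (hj : j ∈ D.idx) : Commute (D.b i) (D.β j) :=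
  (D.b_b i hi j hj).mul_right (D.b_q hi)

theorem β_β {i j : ι} (hi : i ∈ D.idx) (hj : j ∈ D.idx) : Commute (D.β i) (D.β j) :=
  (D.b_β hi hj).mul_left (D.commute_q (D.e_β hj).symm).symm

theorem r_mul_q : D.r * D.q = 1 := expS_mul_expS_neg D.const_half
theorem q_mul_r : D.q * D.r = 1 := expS_neg_mul_expS D.const_half

theorem expS_σ : expS D.σ = 1 + D.e := expS_log1p D.const_e

theorem r_mul_r : D.r * D.r = 1 + D.e := by
  rw [r, ← expS_add D.const_half D.const_half (Commute.refl _), ← expS_σ, ← add_smul]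
  norm_num

/-- With this identity the commutator with `T` in `L_mul_B` turns `q ⊗ β` into `r ⊗ β`. -/
theorem e_mul_q : D.e * D.q = D.r - D.q := by
  have : D.e = D.r * D.r - 1 := by rw [r_mul_r]; abel
  rw [this, sub_mul, mul_assoc, r_mul_q]; simp

theorem β_mul_r (i : ι) : D.β i * D.r = D.b i := by rw [β, mul_assoc, q_mul_r, mul_one]

/-- Moving an element of weight `c` past `h` shifts `h` by `c`, so past `exp(h ⊗ σ)` it acquires
`e^{cσ}` in the second leg. -/
theorem J_mul_inL {x : PowerSeries A} (c : ℂ) (hx : D.h * x = x * D.h + c • x) :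
    D.J * inL x = inL x * inR (expS (c • D.σ)) * D.J := by
  have hc : constantCoeff (c • inR D.σ) = 0 :=
    constantCoeff_smul_eq_zero _ (constantCoeff_ap _ D.const_σ)
  have hcomm : Commute (tens D.h D.σ) (c • inR D.σ) :=
    (((commute_inL_inR D.h D.σ).mul_left (Commute.refl _))).smul_right c
  have key : inL x * (tens D.h D.σ + c • inR D.σ) = tens D.h D.σ * inL x := by
    rw [tens_eq, mul_assoc, ← (commute_inL_inR x D.σ).eq, ← mul_assoc (inL D.h), ← map_mul, hx,
      map_add, ap_smul, map_mul, add_mul, mul_add, mul_smul_comm, smul_mul_assoc, mul_assoc]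
  have := mul_expS (constantCoeff_add_eq_zero D.const_H hc) D.const_H key
  have hr : inR (expS (c • D.σ)) = expS (c • inR D.σ) := by rw [map_expS, ap_smul]
  have hc' : Commute (expS (c • inR D.σ)) (expS (tens D.h D.σ)) :=
    commute_expS D.const_H (commute_expS hc hcomm).symm
  rw [J, ← this, expS_add D.const_H hc hcomm, hr, mul_assoc, hc'.eq]

theorem J_mul_inL_of_commute {x : PowerSeries A} (hx : Commute D.h x) :
    Commute D.J (inL x) :=
  (commute_expS D.const_H ((hx.symm.map inL).mul_right (commute_inL_inR _ _))).symm

theorem J_mul_inR {x : PowerSeries A} (hx : Commute x D.e) : Commute D.J (inR x) :=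
  (commute_expS D.const_H ((commute_inL_inR _ _).symm.mul_right
    ((D.commute_σ hx).map inR))).symm

theorem T_inR {x : PowerSeries A} (hx : ∀ i ∈ D.idx, Commute x (D.β i)) :
    Commute D.T (inR x) :=
  Commute.sum_left _ _ _ fun i hi =>
    (commute_inL_inR _ _).mul_left ((hx i hi).symm.map inR)

theorem T_inL {x : PowerSeries A} (hx : ∀ i ∈ D.idx, Commute x (D.a i)) :
    Commute D.T (inL x) :=
  Commute.sum_left _ _ _ fun i hi =>
    ((hx i hi).symm.map inL).mul_left (commute_inL_inR _ _).symm

theorem expT_comm {x : PowerSeries (A ⊗[ℂ] A)} (h : Commute D.T x) : Commute (expS D.T) x :=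
  (commute_expS D.const_T h.symm).symm

theorem inL_e_T : Commute D.T (inL D.e) := D.T_inL fun i hi => D.e_a i hi

/-- The right-hand factor is `(1+e) ⊗ (1+e) - 1`: conjugation by `J` makes `1 + e` group-like, hence
`σ` primitive in `J_mul_S`. -/
theorem J_mul_Δe : D.J * (inL D.e + inR D.e) =
    (inL D.e * inR (1 + D.e) + inR D.e) * D.J := by
  have h1 := D.J_mul_inL 1 (x := D.e) (by rw [one_smul, D.h_e])
  rw [one_smul, expS_σ] at h1
  rw [mul_add, h1, add_mul, (D.J_mul_inR (Commute.refl _)).eq]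

theorem J_mul_S : D.J * D.S = (inL D.σ + inR D.σ) * D.J := by
  have c1 : constantCoeff (inL D.e + inR D.e : PowerSeries (A ⊗[ℂ] A)) = 0 :=
    constantCoeff_add_eq_zero (constantCoeff_ap _ D.const_e) (constantCoeff_ap _ D.const_e)
  have c2 : constantCoeff (inL D.e * inR (1 + D.e) + inR D.e : PowerSeries (A ⊗[ℂ] A)) = 0 :=
    constantCoeff_add_eq_zero (constantCoeff_mul_eq_zero _ (constantCoeff_ap _ D.const_e))
      (constantCoeff_ap _ D.const_e)
  have h := mul_log1p c1 c2 D.J_mul_Δe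
  rw [S, h]
  congr 1
  have d1 := constantCoeff_ap (Algebra.TensorProduct.includeLeft : A →ₐ[ℂ] A ⊗[ℂ] A) D.const_σ
  have d2 := constantCoeff_ap (Algebra.TensorProduct.includeRight : A →ₐ[ℂ] A ⊗[ℂ] A) D.const_σ
  refine expS_injective (constantCoeff_log1p _) (constantCoeff_add_eq_zero d1 d2) ?_
  rw [expS_log1p c2, expS_add d1 d2 (commute_inL_inR _ _), ← map_expS, ← map_expS, expS_σ]
  simp only [map_add, map_one]
  noncomm_ring

theorem T_σ : Commute D.T (inL D.σ + inR D.σ) :=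
  (D.T_inL fun i hi => (D.commute_σ (D.e_a i hi).symm).symm).add_right
    (D.T_inR fun _ hi => (D.commute_σ (D.e_β hi).symm).symm)

theorem L_mul_S : D.L * D.S = (inL D.σ + inR D.σ) * D.L := by
  rw [L, mul_assoc, J_mul_S, ← mul_assoc, (D.expT_comm D.T_σ).eq, mul_assoc]

theorem const_neg_half_S : constantCoeff (-((1 / 2 : ℂ) • D.S)) = 0 :=
  constantCoeff_neg_eq_zero (constantCoeff_smul_eq_zero _ D.const_S)

theorem J_mul_expS : D.J * expS (-((1 / 2 : ℂ) • D.S)) = inL D.q * inR D.q * D.J := by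
  have d1 := constantCoeff_ap (Algebra.TensorProduct.includeLeft : A →ₐ[ℂ] A ⊗[ℂ] A)
    D.const_neg_half
  have d2 := constantCoeff_ap (Algebra.TensorProduct.includeRight : A →ₐ[ℂ] A ⊗[ℂ] A)
    D.const_neg_half
  rw [mul_expS D.const_neg_half_S (constantCoeff_add_eq_zero d1 d2), expS_add d1 d2
    (commute_inL_inR _ _), ← map_expS, ← map_expS]
  · rfl
  · rw [map_neg, map_neg, ap_smul, ap_smul, mul_neg, mul_smul_comm, J_mul_S, ← neg_add, ← smul_add,
      neg_mul, smul_mul_assoc]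

/-- The weight `1/2` of `b_i` turns `b_i ⊗ 1` into `b_i ⊗ r`; multiplying by `q ⊗ q` leaves `β_i ⊗
1`, while `1 ⊗ b_i` gives `q ⊗ β_i`. -/
theorem J_mul_B {i : ι} (hi : i ∈ D.idx) :
    D.J * D.B i = (inL (D.β i) + inL D.q * inR (D.β i)) * D.J := by
  have h1 := D.J_mul_inL _ (D.h_b i hi)
  change _ = inL (D.b i) * inR D.r * D.J at h1
  have h2 := (D.J_mul_inR (D.e_b i hi).symm).eq
  rw [B, ← mul_assoc, mul_add, h1, h2, ← add_mul, mul_assoc, J_mul_expS, ← mul_assoc]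
  congr 1
  have h3 : (inR D.r * inR D.q : PowerSeries (A ⊗[ℂ] A)) = 1 := by rw [← map_mul, r_mul_q, map_one]
  rw [β, map_mul, map_mul, add_mul, mul_assoc (inL (D.b i)), ← mul_assoc (inR D.r),
    ← (commute_inL_inR D.q D.r).eq, mul_assoc (inL D.q), h3, mul_one, ← mul_assoc (inR _),
    ← (commute_inL_inR D.q (D.b i)).eq, mul_assoc (inL D.q)]

theorem T_comm_inL_inR {i : ι} (hi : i ∈ D.idx) {x : PowerSeries A}
    (hx' : ∀ j ∈ D.idx, Commute x (D.a j)) : Commute D.T (inL x * inR (D.β i)) :=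
  (D.T_inL hx').mul_right (D.T_inR fun _ hj => D.β_β hi hj)

/-- Meant for the earlier `σ`'s and, at a link without extension, for all generators that remain. -/
theorem L_mul_commuting {z : PowerSeries A} (hh : Commute D.h z) (he : Commute z D.e)
    (ha : ∀ l ∈ D.idx, Commute z (D.a l)) (hb : ∀ l ∈ D.idx, Commute z (D.b l)) :
    Commute D.L (inL z) ∧ Commute D.L (inR z) :=
  ⟨(D.expT_comm (D.T_inL ha)).mul_left (D.J_mul_inL_of_commute hh),
    (D.expT_comm (D.T_inR fun l hl => (hb l hl).mul_right (D.commute_q he))).mul_left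
      (D.J_mul_inR he)⟩

variable [DecidableEq ι]

theorem a_b {i j : ι} (hi : i ∈ D.idx) (hj : j ∈ D.idx) :
    D.a i * D.b j = D.b j * D.a i + if i = j then D.e else 0 := by
  split_ifs with h
  · subst h; exact D.a_b_self i hi
  · rw [add_zero]; exact D.a_b_ne i hi j hj h

theorem T_mul_inL_b {i : ι} (hi : i ∈ D.idx) :
    D.T * inL (D.b i) = inL (D.b i) * D.T + inL D.e * inR (D.β i) := by
  have : ∀ l ∈ D.idx, tens (D.a l) (D.β l) * inL (D.b i) =
      inL (D.b i) * tens (D.a l) (D.β l) +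
        if l = i then inL D.e * inR (D.β l) else 0 := by
    intro l hl
    rw [tens_eq, mul_assoc, ← (commute_inL_inR _ _).eq, ← mul_assoc, ← map_mul, D.a_b hl hi,
      map_add, add_mul, map_mul, mul_assoc]
    split_ifs <;> simp
  rw [T, Finset.sum_mul, Finset.sum_congr rfl this, Finset.sum_add_distrib, ← Finset.mul_sum,
    Finset.sum_ite_eq' D.idx i, if_pos hi]

theorem T_mul_inL_β {i : ι} (hi : i ∈ D.idx) :
    D.T * inL (D.β i) = inL (D.β i) * D.T + inL (D.e * D.q) * inR (D.β i) := by
  have hq : Commute D.T (inL D.q) := D.T_inL fun j hj => (D.a_q hj).symm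
  rw [β, map_mul, ← mul_assoc, D.T_mul_inL_b hi, add_mul, mul_assoc, hq.eq, mul_assoc (inL D.e),
    ← (commute_inL_inR _ _).eq, map_mul]
  simp only [mul_assoc, β]

/-- After `J` there stands `β_i ⊗ 1 + q ⊗ β_i`. Conjugation by `exp T` fixes the second term and
adds `[T, β_i ⊗ 1] = eq ⊗ β_i = (r - q) ⊗ β_i` to the first. -/
theorem L_mul_B {i : ι} (hi : i ∈ D.idx) :
    D.L * D.B i = (inL (D.β i) + inL D.r * inR (D.β i)) * D.L := by
  have hd : D.T * (inL (D.e * D.q) * inR (D.β i)) = (inL (D.e * D.q) * inR (D.β i)) * D.T :=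
    (D.T_comm_inL_inR hi fun j hj =>
      (D.e_a j hj).mul_left (D.a_q hj).symm).eq
  have h := expS_mul_of_lie D.const_T (D.T_mul_inL_β hi) (d := 0) (by rw [add_zero, hd]) (by simp)
  have h' : Commute (expS D.T) (inL D.q * inR (D.β i)) := D.expT_comm
    (D.T_comm_inL_inR hi fun j hj => (D.a_q hj).symm)
  rw [L, mul_assoc, D.J_mul_B hi, ← mul_assoc, mul_add, h, h'.eq, ← add_mul, ← mul_assoc, e_mul_q,
    map_sub, smul_zero]
  congr 2
  noncomm_ring

/-- If `Δ y` is primitive before the twist and `[a_l, y] = η (δ_{li} b_j + δ_{lj} b_i)`, then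
`y - η βᵢ βⱼ` is primitive after it. -/
theorem L_mul_deformed {i j : ι} (hi : i ∈ D.idx) (hj : j ∈ D.idx) {y : PowerSeries A} (η : ℂ)
    (hh : Commute D.h y) (he : Commute y D.e) (hb : ∀ l ∈ D.idx, Commute y (D.b l))
    (ha : ∀ l ∈ D.idx, D.a l * y = y * D.a l +
      η • ((if l = i then D.b j else 0) + (if l = j then D.b i else 0))) :
    D.L * (inL y + inR y - η • (D.B i * D.B j)) =
      (inL (y - η • (D.β i * D.β j)) + inR (y - η • (D.β i * D.β j))) * D.L := by
  -- The iterated commutators of `T` with `y ⊗ 1` end after two steps: the first is linear in the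
  -- `b`'s, the second is `2η e ⊗ βᵢβⱼ`, and the latter commutes with `T`.
  have hc1 : D.T * inL y = inL y * D.T +
      η • (inL (D.b j) * inR (D.β i) + inL (D.b i) * inR (D.β j)) := by
    have : ∀ l ∈ D.idx, tens (D.a l) (D.β l) * inL y = inL y * tens (D.a l) (D.β l) +
        ((if l = i then η • (inL (D.b j) * inR (D.β l)) else 0) +
          if l = j then η • (inL (D.b i) * inR (D.β l)) else 0) := by
      intro l hl
      rw [tens_eq, mul_assoc, ← (commute_inL_inR _ _).eq, ← mul_assoc, ← map_mul, ha l hl,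
        map_add, add_mul, map_mul, mul_assoc, ap_smul, map_add, smul_mul_assoc, add_mul, smul_add]
      split_ifs <;> simp
    rw [T, Finset.sum_mul, Finset.sum_congr rfl this, Finset.sum_add_distrib, ← Finset.mul_sum,
      Finset.sum_add_distrib, Finset.sum_ite_eq' D.idx i, if_pos hi, Finset.sum_ite_eq' D.idx j,
      if_pos hj, smul_add]
  have hT : ∀ i ∈ D.idx, ∀ j ∈ D.idx, D.T * (inL (D.b j) * inR (D.β i)) =
      (inL (D.b j) * inR (D.β i)) * D.T + inL D.e * inR (D.β i * D.β j) := by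
    intro i hi j hj
    have h1 : Commute D.T (inR (D.β i)) := D.T_inR fun l hl => D.β_β hi hl
    rw [← mul_assoc, D.T_mul_inL_b hj, add_mul, mul_assoc, h1.eq, mul_assoc, mul_assoc, ← map_mul,
      (D.β_β hj hi).eq]
  have hc2 : D.T * (η • (inL (D.b j) * inR (D.β i) + inL (D.b i) * inR (D.β j))) =
      (η • (inL (D.b j) * inR (D.β i) + inL (D.b i) * inR (D.β j))) * D.T +
        (2 * η) • (inL D.e * inR (D.β i * D.β j)) := by
    rw [mul_smul_comm, mul_add, hT i hi j hj, hT j hj i hi, (D.β_β hj hi).eq, smul_mul_assoc,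
      add_mul]
    module
  have hc3 : Commute D.T ((2 * η) • (inL D.e * inR (D.β i * D.β j))) :=
    ((D.inL_e_T).mul_right
      (D.T_inR fun l hl => (D.β_β hi hl).mul_left (D.β_β hj hl))).smul_right _
  have h1 := expS_mul_of_lie D.const_T hc1 hc2 hc3
  have h2 : D.L * inL y = (inL y + η • (inL (D.b j) * inR (D.β i) + inL (D.b i) * inR (D.β j)) +
      η • (inL D.e * inR (D.β i * D.β j))) * D.L := by
    rw [L, mul_assoc, (D.J_mul_inL_of_commute hh).eq, ← mul_assoc, h1, mul_assoc, smul_smul]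
    congr 4; ring
  have h3 : Commute D.L (inR y) :=
    (D.expT_comm (D.T_inR fun l hl => (hb l hl).mul_right (D.commute_q he))).mul_left
      (D.J_mul_inR he)
  have h4 : D.L * (D.B i * D.B j) = ((inL (D.β i) + inL D.r * inR (D.β i)) *
      (inL (D.β j) + inL D.r * inR (D.β j))) * D.L := by
    rw [← mul_assoc, D.L_mul_B hi, mul_assoc, D.L_mul_B hj, mul_assoc]
  -- The mixed terms `b ⊗ β` and the part `e ⊗ βᵢβⱼ` are precisely what `exp T` added to `y ⊗ 1`;
  -- subtracting `η` times this product leaves a primitive expression.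
  have h5 : (inL (D.β i) + inL D.r * inR (D.β i)) * (inL (D.β j) + inL D.r * inR (D.β j)) =
      inL (D.β i * D.β j) + inL (D.b i) * inR (D.β j) + inL (D.b j) * inR (D.β i) +
        inL (1 + D.e) * inR (D.β i * D.β j) := by
    have k : ∀ i ∈ D.idx, Commute D.r (D.β i) := fun i hi => (D.commute_r (D.e_β hi).symm).symm
    rw [← r_mul_r, ← D.β_mul_r i, ← D.β_mul_r j, ← (k j hj).eq]
    simp only [map_mul, add_mul, mul_add]
    have c1 := (commute_inL_inR (D.β j) (D.β i)).eq
    have c2 := (commute_inL_inR D.r (D.β i)).eq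
    rw [mul_assoc (inL D.r) (inR (D.β i)), ← c1, mul_assoc (inL D.r) (inR (D.β i)),
      ← mul_assoc (inR (D.β i)), ← c2]
    noncomm_ring
  rw [mul_sub, mul_add, mul_smul_comm, h2, h3.eq, h4, h5, ← add_mul, ← smul_mul_assoc η (_ + _), ← sub_mul]
  congr 1
  simp only [map_sub, ap_smul, map_add, map_one, add_mul, one_mul]
  module

/-- The extension is invariant under `gl`. -/
theorem L_mul_invariant {i j : ι} (hi : i ∈ D.idx) (hj : j ∈ D.idx) {z : PowerSeries A}
    (hh : Commute D.h z) (he : Commute z D.e)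
    (ha : ∀ l ∈ D.idx, z * D.a l = D.a l * z - if l = i then D.a j else 0)
    (hb : ∀ l ∈ D.idx, z * D.b l = D.b l * z + if l = j then D.b i else 0) :
    Commute D.L (inL z + inR z) := by
  refine Commute.mul_left (D.expT_comm ?_) ((D.J_mul_inL_of_commute hh).add_right (D.J_mul_inR he))
  have h : ∀ l ∈ D.idx, (inL z + inR z) * tens (D.a l) (D.β l) =
      tens (D.a l) (D.β l) * (inL z + inR z) -
        (if l = i then inL (D.a j) * inR (D.β l) else 0) +
        (if l = j then inL (D.a l) * inR (D.β i) else 0) := by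
    intro l hl
    have hβ : z * D.β l = D.β l * z + if l = j then D.β i else 0 := by
      simp only [β]
      rw [← mul_assoc, hb l hl, add_mul, mul_assoc, (D.commute_q he).eq, mul_assoc]
      split_ifs <;> simp
    rw [tens_eq, add_mul, ← mul_assoc, ← map_mul, ha l hl, ← mul_assoc,
      ← (commute_inL_inR _ _).eq, mul_assoc (inL (D.a l)), ← map_mul, hβ]
    simp only [map_sub, map_mul, map_add, sub_mul, mul_add]
    rw [mul_assoc (inL (D.a l)) (inR (D.β l)) (inL z), ← (commute_inL_inR z (D.β l)).eq]
    split_ifs <;> (try simp only [map_zero, zero_mul, mul_zero, sub_zero, add_zero]) <;>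
      noncomm_ring
  refine (Commute.symm ?_)
  -- Both delta sums collapse to `a j ⊗ β i`: the variations of the two legs cancel.
  rw [commute_iff_eq, T, Finset.mul_sum, Finset.sum_congr rfl h, Finset.sum_add_distrib,
    Finset.sum_sub_distrib, Finset.sum_ite_eq' D.idx i, if_pos hi, Finset.sum_ite_eq' D.idx j,
    if_pos hj, ← Finset.sum_mul, sub_add_cancel]

end LinkData

/-! ### Legs of the tensor cube -/

section Cube

variable {g : Type} [LieRing g] [LieAlgebra ℂ g]

variable (g) in
/-- `a ↦ a ⊗ 1 ⊗ 1`. -/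
def leg1 : U g →ₐ[ℂ] U3 g := Algebra.TensorProduct.includeLeft

variable (g) in
/-- `a ↦ 1 ⊗ a ⊗ 1`. -/
def leg2 : U g →ₐ[ℂ] U3 g :=
  Algebra.TensorProduct.includeRight.comp Algebra.TensorProduct.includeLeft

variable (g) in
/-- `a ↦ 1 ⊗ 1 ⊗ a`. -/
def leg3 : U g →ₐ[ℂ] U3 g :=
  Algebra.TensorProduct.includeRight.comp Algebra.TensorProduct.includeRight

theorem ap_eq_of_forall {A B C D : Type} [Ring A] [Algebra ℂ A] [Ring B] [Algebra ℂ B]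
    [Ring C] [Algebra ℂ C] [Ring D] [Algebra ℂ D] {F : B →ₐ[ℂ] C} {G : A →ₐ[ℂ] B}
    {F' : D →ₐ[ℂ] C} {G' : A →ₐ[ℂ] D} (h : ∀ a, F (G a) = F' (G' a)) (f : PowerSeries A) :
    ap F (ap G f) = ap F' (ap G' f) := by
  ext n; simp only [coeff_map]; exact h _

theorem ap_ap_eq {A B C : Type} [Ring A] [Algebra ℂ A] [Ring B] [Algebra ℂ B]
    [Ring C] [Algebra ℂ C] {F : B →ₐ[ℂ] C} {G : A →ₐ[ℂ] B}
    {H : A →ₐ[ℂ] C} (h : ∀ a, F (G a) = H a) (f : PowerSeries A) :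
    ap F (ap G f) = ap H f := by
  ext n; simp only [coeff_map]; exact h _

theorem ap_leg12_inL (x : PowerSeries (U g)) : ap (leg12 g) (inL x) = ap (leg1 g) x :=
  ap_ap_eq (fun a => by simp [leg12, leg1, Algebra.TensorProduct.one_def]) x

theorem ap_leg12_inR (x : PowerSeries (U g)) : ap (leg12 g) (inR x) = ap (leg2 g) x :=
  ap_ap_eq (fun a => by simp [leg12, leg2]) x

theorem ap_leg23_inL (x : PowerSeries (U g)) : ap (leg23 g) (inL x) = ap (leg2 g) x :=
  ap_ap_eq (fun a => by simp [leg23, leg2]) x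

theorem ap_leg23_inR (x : PowerSeries (U g)) : ap (leg23 g) (inR x) = ap (leg3 g) x :=
  ap_ap_eq (fun a => by simp [leg23, leg3]) x

theorem ap_comulLeft_inL (x : PowerSeries (U g)) :
    ap (comulLeft g) (inL x) = ap (leg12 g) (ap (comul g) x) :=
  ap_eq_of_forall (fun a => by simp [comulLeft, leg12]) x

theorem ap_comulLeft_inR (x : PowerSeries (U g)) : ap (comulLeft g) (inR x) = ap (leg3 g) x :=
  ap_ap_eq (fun a => by simp [comulLeft, leg3, Algebra.TensorProduct.one_def]) x

theorem ap_comulRight_inL (x : PowerSeries (U g)) : ap (comulRight g) (inL x) = ap (leg1 g) x :=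
  ap_ap_eq (fun a => by simp [comulRight, leg1]) x

theorem ap_comulRight_inR (x : PowerSeries (U g)) :
    ap (comulRight g) (inR x) = ap (leg23 g) (ap (comul g) x) :=
  ap_eq_of_forall (fun a => by simp [comulRight, leg23]) x

theorem commute_leg12_leg3 (f : PowerSeries (U2 g)) (x : PowerSeries (U g)) :
    Commute (ap (leg12 g) f) (ap (leg3 g) x) := by
  refine commute_of_coeff fun m n => ?_
  rw [coeff_map, coeff_map]
  generalize coeff m f = a
  change leg12 g a * leg3 g (coeff n x) = leg3 g (coeff n x) * leg12 g a
  induction a using TensorProduct.induction_on with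
  | zero => simp
  | add a b ha hb => rw [map_add, add_mul, mul_add, ha, hb]
  | tmul a b => simp [leg12, leg3]

theorem commute_leg23_leg1 (f : PowerSeries (U2 g)) (x : PowerSeries (U g)) :
    Commute (ap (leg23 g) f) (ap (leg1 g) x) := by
  refine commute_of_coeff fun m n => ?_
  rw [coeff_map, coeff_map]
  exact ((Commute.one_right _).tmul (Commute.one_left _)).symm

theorem commute_leg1_leg2 (x y : PowerSeries (U g)) :
    Commute (ap (leg1 g) x) (ap (leg2 g) y) := by
  rw [← ap_leg23_inL]; exact (commute_leg23_leg1 _ _).symm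

theorem commute_leg1_leg3 (x y : PowerSeries (U g)) :
    Commute (ap (leg1 g) x) (ap (leg3 g) y) := by
  rw [← ap_leg23_inR]; exact (commute_leg23_leg1 _ _).symm

theorem commute_leg2_leg3 (x y : PowerSeries (U g)) :
    Commute (ap (leg2 g) x) (ap (leg3 g) y) := by
  rw [← ap_leg12_inR]; exact commute_leg12_leg3 _ _

/-- `x ⊗ y ⊗ z`. -/
def tri (x y z : PowerSeries (U g)) : PowerSeries (U3 g) :=
  ap (leg1 g) x * ap (leg2 g) y * ap (leg3 g) z

theorem commute_tri {x y z x' y' z' : PowerSeries (U g)} (hx : Commute x x') (hy : Commute y y')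
    (hz : Commute z z') : Commute (tri x y z) (tri x' y' z') := by
  have h12 := commute_leg1_leg2 (g := g)
  have h13 := commute_leg1_leg3 (g := g)
  have h23 := commute_leg2_leg3 (g := g)
  refine Commute.mul_left (Commute.mul_left ?_ ?_) ?_ <;>
    refine Commute.mul_right (Commute.mul_right ?_ ?_) ?_
  · exact hx.map _
  · exact h12 _ _
  · exact h13 _ _
  · exact (h12 _ _).symm
  · exact hy.map _
  · exact h23 _ _
  · exact (h13 _ _).symm
  · exact (h23 _ _).symm
  · exact hz.map _

theorem constantCoeff_tri_left {x y z : PowerSeries (U g)} (h : constantCoeff y = 0) :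
    constantCoeff (tri x y z) = 0 := by
  rw [tri, map_mul, map_mul, constantCoeff_ap _ h, mul_zero, zero_mul]

theorem constantCoeff_tri_right {x y z : PowerSeries (U g)} (h : constantCoeff z = 0) :
    constantCoeff (tri x y z) = 0 := by
  rw [tri, map_mul, map_mul, constantCoeff_ap _ h, mul_zero]

/-! ### Primitive elements of a twisted coproduct -/

/-- `F Δ(x) = (x ⊗ 1 + 1 ⊗ x) F`. -/
def IsPrim (F : PowerSeries (U2 g)) (x : PowerSeries (U g)) : Prop :=
  F * ap (comul g) x = (inL x + inR x) * F

theorem IsPrim.smul {F : PowerSeries (U2 g)} {x : PowerSeries (U g)} (h : IsPrim F x) (c : ℂ) :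
    IsPrim F (c • x) := by
  rw [IsPrim, ap_smul, ap_smul, ap_smul, mul_smul_comm, h, ← smul_add, smul_mul_assoc]

theorem IsPrim.X_mul {F : PowerSeries (U2 g)} {x : PowerSeries (U g)} (h : IsPrim F x) :
    IsPrim F (X * x) := by
  rw [IsPrim, map_mul, map_mul, map_mul, map_X, map_X, map_X, ← mul_assoc, ← PowerSeries.X_mul (φ := F), mul_assoc, h,
    ← mul_add, mul_assoc]

/-- `LinkData` absorbs `ξ` into `e` and `b`, so primitivity of the deformed generators first appears
multiplied by `X`. -/
theorem IsPrim.of_X_mul {F : PowerSeries (U2 g)} {x : PowerSeries (U g)} (h : IsPrim F (X * x)) :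
    IsPrim F x := by
  rw [IsPrim, map_mul, map_mul, map_mul, map_X, map_X, map_X, ← mul_assoc, ← PowerSeries.X_mul (φ := F), mul_assoc,
    ← mul_add, mul_assoc] at h
  exact X_mul_cancel h

theorem IsPrim.of_commute {L F : PowerSeries (U2 g)} {x : PowerSeries (U g)} (h : IsPrim F x)
    (hL : Commute L (inL x + inR x)) : IsPrim (L * F) x := by
  rw [IsPrim, mul_assoc, h, ← mul_assoc, hL.eq, mul_assoc]

theorem isPrim_one_C_inc (x : g) : IsPrim 1 (C (inc x)) := by
  rw [IsPrim, one_mul, mul_one, map_C, map_C, map_C, ← map_add]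
  congr 1
  change comul g (UniversalEnvelopingAlgebra.ι ℂ x) = _
  rw [comul, UniversalEnvelopingAlgebra.lift_ι_apply]
  rfl

theorem isPrim_iff_twistedComul {F : PowerSeries (U2 g)} (hF : IsUnit F) (x : PowerSeries (U g)) :
    IsPrim F x ↔ twistedComul F x = tens x 1 + tens 1 x := by
  have e : (tens x 1 + tens 1 x : PowerSeries (U2 g)) = inL x + inR x := by
    rw [tens_eq, tens_eq, map_one, map_one, mul_one, one_mul]
  rw [IsPrim, twistedComul, e]
  constructor
  · intro h
    rw [h, mul_assoc, Ring.mul_inverse_cancel _ hF, mul_one]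
  · intro h
    rw [← h, mul_assoc _ (Ring.inverse F), Ring.inverse_mul_cancel _ hF, mul_one]

/-- The product `F₁₂ (Δ ⊗ id)P` equals `(Δ_F ⊗ id)P · F₁₂`; grouping the factors so avoids the
inverse of `F`. -/
theorem isTwist_mul {P F : PowerSeries (U2 g)} (hP : IsUnit P) (hF : IsTwist F)
    (h : ap (leg12 g) P * (ap (leg12 g) F * ap (comulLeft g) P) * ap (comulLeft g) F =
      ap (leg23 g) P * (ap (leg23 g) F * ap (comulRight g) P) * ap (comulRight g) F)
    (hl : ap (counitLeft g) P = 1) (hr : ap (counitRight g) P = 1) : IsTwist (P * F) := by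
  obtain ⟨h1, -, h3, h4⟩ := hF
  refine ⟨hP.mul h1, ?_, ?_, ?_⟩
  · simp only [map_mul]
    simpa only [mul_assoc] using h
  · rw [map_mul, hl, h3, one_mul]
  · rw [map_mul, hr, h4, one_mul]

end Cube

/-! ### The twist equation of a link -/

namespace LinkData

variable {g : Type} [LieRing g] [LieAlgebra ℂ g] {ι : Type} (D : LinkData (U g) ι)

theorem isUnit_L : IsUnit D.L := (isUnit_expS D.const_T).mul (isUnit_expS D.const_H)

section

variable {F : PowerSeries (U2 g)}

theorem mul_comul_σ (he : IsPrim F D.e) : F * ap (comul g) D.σ = D.S * F := by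
  rw [σ, map_log1p, S]
  exact mul_log1p (constantCoeff_ap _ D.const_e)
    (constantCoeff_add_eq_zero (constantCoeff_ap _ D.const_e) (constantCoeff_ap _ D.const_e)) he

theorem mul_comul_β (he : IsPrim F D.e) {i : ι} (hb : IsPrim F (D.b i)) :
    F * ap (comul g) (D.β i) = D.B i * F := by
  have : F * ap (comul g) D.q = expS (-((1 / 2 : ℂ) • D.S)) * F := by
    rw [q, map_expS]
    refine mul_expS (constantCoeff_ap _ D.const_neg_half) D.const_neg_half_S ?_
    rw [map_neg, ap_smul, mul_neg, mul_smul_comm, D.mul_comul_σ he, neg_mul, smul_mul_assoc]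
  rw [β, map_mul, ← mul_assoc, hb, mul_assoc, this, B, mul_assoc]

theorem isPrim_L_σ (he : IsPrim F D.e) : IsPrim (D.L * F) D.σ := by
  rw [IsPrim, mul_assoc, D.mul_comul_σ he, ← mul_assoc, D.L_mul_S, mul_assoc]

theorem isPrim_L_deformed [DecidableEq ι] {i j : ι} (hi : i ∈ D.idx) (hj : j ∈ D.idx)
    {y : PowerSeries (U g)} (η : ℂ)
    (hh : Commute D.h y) (he : Commute y D.e) (hb : ∀ l ∈ D.idx, Commute y (D.b l))
    (ha : ∀ l ∈ D.idx, D.a l * y = y * D.a l +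
      η • ((if l = i then D.b j else 0) + (if l = j then D.b i else 0)))
    (pe : IsPrim F D.e) (pb : ∀ l ∈ D.idx, IsPrim F (D.b l)) (py : IsPrim F y) :
    IsPrim (D.L * F) (y - η • (D.β i * D.β j)) := by
  have : F * ap (comul g) (y - η • (D.β i * D.β j)) =
      (inL y + inR y - η • (D.B i * D.B j)) * F := by
    rw [map_sub, ap_smul, map_mul, mul_sub, py, mul_smul_comm, ← mul_assoc,
      D.mul_comul_β pe (pb i hi), mul_assoc, D.mul_comul_β pe (pb j hj), ← mul_assoc, sub_mul,
      smul_mul_assoc]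
  rw [IsPrim, mul_assoc, this, ← mul_assoc, D.L_mul_deformed hi hj η hh he hb ha, mul_assoc]

/-- The first legs `h` and `a_i` of the exponents are primitive for `Δ_F`, so each exponent splits
into its `13` and `23` copies. -/
theorem leg12_mul_comulLeft_L (ph : IsPrim F D.h) (pa : ∀ i ∈ D.idx, IsPrim F (D.a i)) :
    ap (leg12 g) F * ap (comulLeft g) D.L =
      expS (∑ i ∈ D.idx, (tri (D.a i) 1 (D.β i) + tri 1 (D.a i) (D.β i))) *
        expS (tri D.h 1 D.σ + tri 1 D.h D.σ) * ap (leg12 g) F := by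
  have key : ∀ x y, IsPrim F x → ap (leg12 g) F * ap (comulLeft g) (tens x y) =
      (tri x 1 y + tri 1 x y) * ap (leg12 g) F := by
    intro x y hx
    rw [tens_eq, map_mul, ap_comulLeft_inL, ap_comulLeft_inR, ← mul_assoc, ← map_mul, hx, map_mul,
      mul_assoc, (commute_leg12_leg3 _ _).eq, ← mul_assoc, map_add, ap_leg12_inL, ap_leg12_inR,
      tri, tri, map_one, map_one, mul_one, one_mul, add_mul]
  rw [L, J, map_mul, map_expS, map_expS, ← mul_assoc,
    mul_expS (constantCoeff_ap _ D.const_T) (g := ∑ i ∈ D.idx, (tri (D.a i) 1 (D.β i) +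
      tri 1 (D.a i) (D.β i))), mul_assoc, mul_expS (constantCoeff_ap _ D.const_H)
      (g := tri D.h 1 D.σ + tri 1 D.h D.σ), mul_assoc]
  · exact constantCoeff_add_eq_zero (constantCoeff_tri_right D.const_σ)
      (constantCoeff_tri_right D.const_σ)
  · exact key _ _ ph
  · rw [map_sum]
    exact Finset.sum_eq_zero fun i _ => constantCoeff_add_eq_zero
      (constantCoeff_tri_right (D.const_β i)) (constantCoeff_tri_right (D.const_β i))
  · rw [T, map_sum, Finset.mul_sum, Finset.sum_mul]
    exact Finset.sum_congr rfl fun i hi => key _ _ (pa i hi)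

/-- The second legs `σ` and `β_i` are functions of the primitive `e` and `b_i`; under `Δ_F` they
become `S` and `B i`. -/
theorem leg23_mul_comulRight_L (pe : IsPrim F D.e) (pb : ∀ i ∈ D.idx, IsPrim F (D.b i)) :
    ap (leg23 g) F * ap (comulRight g) D.L =
      expS (∑ i ∈ D.idx, ap (leg1 g) (D.a i) * ap (leg23 g) (D.B i)) *
        expS (ap (leg1 g) D.h * ap (leg23 g) D.S) * ap (leg23 g) F := by
  have key : ∀ x y y', F * ap (comul g) y = y' * F →
      ap (leg23 g) F * ap (comulRight g) (tens x y) =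
      ap (leg1 g) x * ap (leg23 g) y' * ap (leg23 g) F := by
    intro x y y' h
    rw [tens_eq, map_mul, ap_comulRight_inL, ap_comulRight_inR, ← mul_assoc,
      (commute_leg23_leg1 _ _).eq, mul_assoc, ← map_mul, h, map_mul, mul_assoc]
  have cS : constantCoeff (ap (leg1 g) D.h * ap (leg23 g) D.S) = 0 := by
    rw [map_mul, constantCoeff_ap _ D.const_S, mul_zero]
  have cB : ∀ i, constantCoeff (D.B i) = 0 := fun i => constantCoeff_mul_eq_zero _
    (constantCoeff_add_eq_zero (constantCoeff_ap _ (D.const_b i)) (constantCoeff_ap _ (D.const_b i)))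
  rw [L, J, map_mul, map_expS, map_expS, ← mul_assoc,
    mul_expS (constantCoeff_ap _ D.const_T)
      (g := ∑ i ∈ D.idx, ap (leg1 g) (D.a i) * ap (leg23 g) (D.B i)), mul_assoc,
    mul_expS (constantCoeff_ap _ D.const_H) cS, mul_assoc]
  · exact key _ _ _ (D.mul_comul_σ pe)
  · rw [map_sum]
    exact Finset.sum_eq_zero fun i _ => by rw [map_mul, constantCoeff_ap _ (cB i), mul_zero]
  · rw [T, map_sum, Finset.mul_sum, Finset.sum_mul]
    exact Finset.sum_congr rfl fun i hi => key _ _ _ (D.mul_comul_β pe (pb i hi))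

end

theorem const_sum_tri_left {f k : ι → PowerSeries (U g)} :
    constantCoeff (∑ i ∈ D.idx, tri (f i) (D.β i) (k i)) = 0 := by
  rw [map_sum]; exact Finset.sum_eq_zero fun i _ => constantCoeff_tri_left (D.const_β i)

theorem const_sum_tri_right {f k : ι → PowerSeries (U g)} :
    constantCoeff (∑ i ∈ D.idx, tri (f i) (k i) (D.β i)) = 0 := by
  rw [map_sum]; exact Finset.sum_eq_zero fun i _ => constantCoeff_tri_right (D.const_β i)

theorem a_σ {i : ι} (hi : i ∈ D.idx) : Commute (D.a i) D.σ := D.commute_σ (D.e_a i hi).symm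
theorem β_σ {i : ι} (hi : i ∈ D.idx) : Commute (D.β i) D.σ := D.commute_σ (D.e_β hi).symm
theorem a_r {i : ι} (hi : i ∈ D.idx) : Commute (D.a i) D.r := D.commute_r (D.e_a i hi).symm
theorem β_r {i : ι} (hi : i ∈ D.idx) : Commute (D.β i) D.r := D.commute_r (D.e_β hi).symm

theorem ap_leg12_L : ap (leg12 g) D.L =
    expS (∑ i ∈ D.idx, tri (D.a i) (D.β i) 1) * expS (tri D.h D.σ 1) := by
  rw [L, J, map_mul, map_expS, map_expS, T, map_sum]
  simp only [tens_eq, map_mul, ap_leg12_inL, ap_leg12_inR, tri, map_one, mul_one]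

theorem ap_leg23_L : ap (leg23 g) D.L =
    expS (∑ i ∈ D.idx, tri 1 (D.a i) (D.β i)) * expS (tri 1 D.h D.σ) := by
  rw [L, J, map_mul, map_expS, map_expS, T, map_sum]
  simp only [tens_eq, map_mul, ap_leg23_inL, ap_leg23_inR, tri, map_one, one_mul]

/-- The common value of both sides of the twist equation. -/
def cubeProd : PowerSeries (U3 g) :=
  expS (∑ i ∈ D.idx, tri (D.a i) (D.β i) 1) * expS (∑ i ∈ D.idx, tri (D.a i) D.r (D.β i)) *
    expS (∑ i ∈ D.idx, tri 1 (D.a i) (D.β i)) *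
    (expS (tri D.h D.σ 1) * expS (tri D.h 1 D.σ) * expS (tri 1 D.h D.σ))

/-- Only the jordanian factor on legs `12` has to move. It fixes the `23` exponents and multiplies
the middle leg of `a_i ⊗ 1 ⊗ β_i` by `r`, since `a_i` has weight `1/2`. -/
theorem left_eq_cubeProd : ap (leg12 g) D.L *
    (expS (∑ i ∈ D.idx, (tri (D.a i) 1 (D.β i) + tri 1 (D.a i) (D.β i))) *
      expS (tri D.h 1 D.σ + tri 1 D.h D.σ)) = D.cubeProd := by
  have cH : constantCoeff (tri D.h D.σ 1) = 0 := constantCoeff_tri_left D.const_σ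
  have hJ : expS (tri D.h D.σ 1) = ap (leg12 g) D.J := by
    rw [J, map_expS, tens_eq, map_mul, ap_leg12_inL, ap_leg12_inR, tri, map_one, mul_one]
  have h1 : expS (tri D.h D.σ 1) *
      (∑ i ∈ D.idx, (tri (D.a i) 1 (D.β i) + tri 1 (D.a i) (D.β i))) =
      ((∑ i ∈ D.idx, tri (D.a i) D.r (D.β i)) + ∑ i ∈ D.idx, tri 1 (D.a i) (D.β i)) *
        expS (tri D.h D.σ 1) := by
    rw [← Finset.sum_add_distrib, Finset.mul_sum, Finset.sum_mul]
    refine Finset.sum_congr rfl fun i hi => ?_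
    have e1 : expS (tri D.h D.σ 1) * tri 1 (D.a i) (D.β i) =
        tri 1 (D.a i) (D.β i) * expS (tri D.h D.σ 1) :=
      (commute_expS cH (commute_tri (Commute.one_left _) (D.a_σ hi) (Commute.one_right _))).symm.eq
    have e2 : expS (tri D.h D.σ 1) * tri (D.a i) 1 (D.β i) =
        tri (D.a i) D.r (D.β i) * expS (tri D.h D.σ 1) := by
      have := congrArg (ap (leg12 g)) (D.J_mul_inL _ (D.h_a i hi))
      rw [map_mul, map_mul, map_mul, ap_leg12_inL, ap_leg12_inR] at this
      rw [hJ, tri, map_one, mul_one, ← mul_assoc, this, mul_assoc, (commute_leg12_leg3 _ _).eq,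
        ← mul_assoc]
      rfl
    rw [mul_add, e1, e2, add_mul]
  have c13 := D.const_sum_tri_right (f := D.a) (k := fun _ => D.r)
  have c23 := D.const_sum_tri_right (f := fun _ => 1) (k := D.a)
  have h2 := mul_expS (by
    rw [map_sum]
    exact Finset.sum_eq_zero fun i _ => constantCoeff_add_eq_zero
      (constantCoeff_tri_right (D.const_β i)) (constantCoeff_tri_right (D.const_β i)))
    (constantCoeff_add_eq_zero c13 c23) h1
  have h3 : Commute (∑ i ∈ D.idx, tri (D.a i) D.r (D.β i)) (∑ i ∈ D.idx, tri 1 (D.a i) (D.β i)) :=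
    Commute.sum_left _ _ _ fun i hi => Commute.sum_right _ _ _ fun j hj =>
      commute_tri (Commute.one_right _) (D.a_r hj).symm (D.β_β hi hj)
  rw [ap_leg12_L, mul_assoc, ← mul_assoc (expS (tri D.h D.σ 1)), h2, expS_add c13 c23 h3,
    expS_add (constantCoeff_tri_right D.const_σ) (constantCoeff_tri_right D.const_σ)
      (commute_tri (Commute.one_right _) (Commute.one_left _) (Commute.refl _)), cubeProd]
  simp only [mul_assoc]

/-- Moving `L₂₃` to the right applies `L_mul_B` and `L_mul_S` in legs `23`. The resulting exponents
commute and split, and `T₂₃` commutes with the jordanian exponents on `12` and `13`. -/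
theorem right_eq_cubeProd [DecidableEq ι] : ap (leg23 g) D.L *
    (expS (∑ i ∈ D.idx, ap (leg1 g) (D.a i) * ap (leg23 g) (D.B i)) *
      expS (ap (leg1 g) D.h * ap (leg23 g) D.S)) = D.cubeProd := by
  have cS : constantCoeff (ap (leg1 g) D.h * ap (leg23 g) D.S) = 0 := by
    rw [map_mul, constantCoeff_ap _ D.const_S, mul_zero]
  have cB : ∀ i, constantCoeff (D.B i) = 0 := fun i => constantCoeff_mul_eq_zero _
    (constantCoeff_add_eq_zero (constantCoeff_ap _ (D.const_b i)) (constantCoeff_ap _ (D.const_b i)))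
  have cB' : constantCoeff (∑ i ∈ D.idx, ap (leg1 g) (D.a i) * ap (leg23 g) (D.B i)) = 0 := by
    rw [map_sum]
    exact Finset.sum_eq_zero fun i _ => by rw [map_mul, constantCoeff_ap _ (cB i), mul_zero]
  have c12 := D.const_sum_tri_left (f := D.a) (k := fun _ => 1)
  have c13 := D.const_sum_tri_right (f := D.a) (k := fun _ => D.r)
  have c23 := D.const_sum_tri_right (f := fun _ => 1) (k := D.a)
  have k12 : constantCoeff (tri D.h D.σ 1) = 0 := constantCoeff_tri_left D.const_σ
  have k13 : constantCoeff (tri D.h 1 D.σ) = 0 := constantCoeff_tri_right D.const_σ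
  have h1 : ap (leg23 g) D.L * (∑ i ∈ D.idx, ap (leg1 g) (D.a i) * ap (leg23 g) (D.B i)) =
      ((∑ i ∈ D.idx, tri (D.a i) (D.β i) 1) + ∑ i ∈ D.idx, tri (D.a i) D.r (D.β i)) *
        ap (leg23 g) D.L := by
    rw [← Finset.sum_add_distrib, Finset.mul_sum, Finset.sum_mul]
    refine Finset.sum_congr rfl fun i hi => ?_
    rw [← mul_assoc, (commute_leg23_leg1 _ _).eq, mul_assoc, ← map_mul, D.L_mul_B hi, map_mul,
      map_add, map_mul, ap_leg23_inL, ap_leg23_inL, ap_leg23_inR, tri, tri, map_one, mul_one,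
      ← mul_assoc, mul_add, ← mul_assoc]
  have h2 : ap (leg23 g) D.L * (ap (leg1 g) D.h * ap (leg23 g) D.S) =
      (tri D.h D.σ 1 + tri D.h 1 D.σ) * ap (leg23 g) D.L := by
    rw [← mul_assoc, (commute_leg23_leg1 _ _).eq, mul_assoc, ← map_mul, D.L_mul_S, map_mul,
      map_add, ap_leg23_inL, ap_leg23_inR, tri, tri, map_one, map_one, mul_one, mul_one,
      ← mul_assoc, mul_add]
  have h3 : Commute (∑ i ∈ D.idx, tri (D.a i) (D.β i) 1)
      (∑ i ∈ D.idx, tri (D.a i) D.r (D.β i)) :=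
    Commute.sum_left _ _ _ fun i hi => Commute.sum_right _ _ _ fun j hj =>
      commute_tri (D.a_a i hi j hj) (D.β_r hi) (Commute.one_left _)
  have h4 : Commute (tri D.h D.σ 1) (tri D.h 1 D.σ) :=
    commute_tri (Commute.refl _) (Commute.one_right _) (Commute.one_left _)
  have h5 : Commute (expS (tri D.h D.σ 1) * expS (tri D.h 1 D.σ))
      (expS (∑ i ∈ D.idx, tri 1 (D.a i) (D.β i))) := by
    refine Commute.mul_left ?_ ?_
    · refine (commute_expS k12 (commute_expS c23 ?_).symm).symm
      exact Commute.sum_right _ _ _ fun i hi =>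
        commute_tri (Commute.one_right _) (D.a_σ hi).symm (Commute.one_left _)
    · refine (commute_expS k13 (commute_expS c23 ?_).symm).symm
      exact Commute.sum_right _ _ _ fun i hi =>
        commute_tri (Commute.one_right _) (Commute.one_left _) (D.β_σ hi).symm
  rw [← mul_assoc, mul_expS cB' (constantCoeff_add_eq_zero c12 c13) h1, mul_assoc,
    mul_expS cS (constantCoeff_add_eq_zero k12 k13) h2, expS_add c12 c13 h3, expS_add k12 k13 h4,
    ap_leg23_L, ← mul_assoc (_ * _) (expS (∑ i ∈ D.idx, tri 1 (D.a i) (D.β i))), h5.eq, cubeProd]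
  simp only [mul_assoc]

theorem isTwist_L_mul [DecidableEq ι] {F : PowerSeries (U2 g)} (hF : IsTwist F)
    (ph : IsPrim F D.h) (pe : IsPrim F D.e) (pa : ∀ i ∈ D.idx, IsPrim F (D.a i))
    (pb : ∀ i ∈ D.idx, IsPrim F (D.b i)) (hl : ap (counitLeft g) D.L = 1)
    (hr : ap (counitRight g) D.L = 1) : IsTwist (D.L * F) := by
  refine isTwist_mul D.isUnit_L hF ?_ hl hr
  rw [D.leg12_mul_comulLeft_L ph pa, D.leg23_mul_comulRight_L pe pb, ← mul_assoc (ap (leg12 g) D.L),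
    D.left_eq_cubeProd, ← mul_assoc (ap (leg23 g) D.L), D.right_eq_cubeProd, mul_assoc, mul_assoc,
    hF.2.1]

end LinkData

/-! ### Commutation relations of the symplectic algebra -/

section Relations

variable {N : ℕ}

theorem ePlus_comm (i j : Fin N) : ePlus i j = ePlus j i :=
  Subtype.ext (add_comm _ _)

theorem single_mul_single_eq {n : Type} [Fintype n] [DecidableEq n] (a b c d : n) :
    (Matrix.single a b 1 * Matrix.single c d 1 : Matrix n n ℂ) =
      if b = c then Matrix.single a d 1 else 0 := by
  split_ifs with h
  · subst h; simp
  · exact Matrix.single_mul_single_of_ne _ _ _ _ h _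

/-- Equal indices are allowed: `eMinus i i` is `2 H_{ii}`, so the Cartan relations are included here
and in `lie_eMinus_ePlus`. -/
theorem lie_eMinus_eMinus (i j k l : Fin N) : ⁅eMinus i j, eMinus k l⁆ =
    (if j = k then eMinus i l else 0) - if l = i then eMinus k j else 0 := by
  apply Subtype.ext
  rw [LieSubalgebra.coe_bracket, LieRing.of_associative_ring_bracket]
  simp only [eMinus, eMinusMat, sub_mul, mul_sub, single_mul_single_eq, Sum.inl.injEq,
    Sum.inr.injEq, reduceCtorEq, if_false, eq_comm (a := i) (b := l), eq_comm (a := k) (b := j)]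
  split_ifs <;> simp <;> abel

theorem lie_eMinus_ePlus (i j k l : Fin N) : ⁅eMinus i j, ePlus k l⁆ =
    (if j = k then ePlus i l else 0) + if j = l then ePlus k i else 0 := by
  apply Subtype.ext
  rw [LieSubalgebra.coe_bracket, LieRing.of_associative_ring_bracket]
  simp only [eMinus, eMinusMat, ePlus, ePlusMat, sub_mul, mul_sub, mul_add, add_mul,
    single_mul_single_eq, Sum.inl.injEq, Sum.inr.injEq, reduceCtorEq, if_false,
    eq_comm (a := k) (b := j), eq_comm (a := l) (b := j)]
  split_ifs <;> simp <;> abel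

theorem lie_ePlus_ePlus (i j k l : Fin N) : ⁅ePlus i j, ePlus k l⁆ = 0 := by
  apply Subtype.ext
  rw [LieSubalgebra.coe_bracket, LieRing.of_associative_ring_bracket]
  simp [ePlus, ePlusMat, mul_add, add_mul]

theorem inc_mul {g : Type} [LieRing g] [LieAlgebra ℂ g] (x y : g) :
    inc x * inc y = inc y * inc x + inc ⁅x, y⁆ := by
  have : inc ⁅x, y⁆ = inc x * inc y - inc y * inc x := by
    rw [inc, LieHom.coe_toLinearMap, LieHom.map_lie, LieRing.of_associative_ring_bracket]
  rw [this]; abel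

/-- `E_{i-j}` as a constant series. -/
def gl (i j : Fin N) : PowerSeries (U (spN N)) := C (inc (eMinus i j))

theorem gl_mul_gl (i j k l : Fin N) : gl i j * gl k l = gl k l * gl i j +
    ((if j = k then gl i l else 0) - if l = i then gl k j else 0) := by
  simp only [gl]
  rw [← map_mul, inc_mul, lie_eMinus_eMinus, map_add, map_mul, map_sub, map_sub]
  congr 2 <;> split_ifs <;> simp

theorem hh_eq (i : Fin N) : hh i = (1 / 2 : ℂ) • eMinus i i := rfl

theorem C_hh (i : Fin N) : C (inc (hh i)) = (1 / 2 : ℂ) • gl i i := by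
  ext n
  rw [hh_eq, map_smul, gl, coeff_smul, coeff_C, coeff_C]
  split_ifs <;> simp

end Relations

/-! ### The iterated generators -/

section Iterated

variable {N : ℕ} (η κ : Fin N → ℂ)

theorem constantCoeff_X_mul_smul {A : Type} [Ring A] [Algebra ℂ A] (c : ℂ) (f : PowerSeries A) :
    constantCoeff (X * (c • f)) = 0 := by simp

theorem constantCoeff_logOne (c : ℂ) (f : PowerSeries (U (spN N))) :
    constantCoeff (logOne c f) = 0 := constantCoeff_log1p _

theorem commute_logOne {y f : PowerSeries (U (spN N))} (c : ℂ) (h : Commute y f) :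
    Commute y (logOne c f) :=
  commute_log1p (constantCoeff_X_mul_smul _ _) ((commute_X y).mul_right (h.smul_right c))

theorem eIter_succ {m : ℕ} (h : m < N) (i j : Fin N) :
    eIter η κ (m + 1) i j = eIter η κ m i j - X * ((κ ⟨m, h⟩ * η ⟨m, h⟩) •
      (eIter η κ m ⟨m, h⟩ i * eIter η κ m ⟨m, h⟩ j * expS (-sigma η κ ⟨m, h⟩))) := by
  rw [eIter, dif_pos h]; rfl

/-- Each `eIter` is built from the commuting `E_{a+b}` by algebra operations, logarithms and
exponentials. Used twice, this gives `commute_eIter`. -/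
theorem commute_eIter_of_forall {y : PowerSeries (U (spN N))}
    (h : ∀ a b : Fin N, Commute y (C (inc (ePlus a b)))) (m : ℕ) :
    ∀ a b : Fin N, Commute y (eIter η κ m a b) := by
  induction m with
  | zero => exact h
  | succ m ih =>
    intro a b
    rw [eIter]
    split_ifs with hm
    · refine (ih a b).sub_right ((commute_X y).mul_right (Commute.smul_right ?_ _))
      refine ((ih _ _).mul_right (ih _ _)).mul_right ?_
      exact commute_expS (constantCoeff_neg_eq_zero (constantCoeff_logOne _ _))
        (commute_logOne _ (ih _ _)).neg_right
    · exact ih a b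

theorem commute_eIter (m m' : ℕ) (a b c d : Fin N) :
    Commute (eIter η κ m a b) (eIter η κ m' c d) := by
  refine commute_eIter_of_forall η κ (fun a' b' => ?_) _ _ _
  refine (commute_eIter_of_forall η κ (fun c' d' => ?_) _ _ _).symm
  rw [commute_iff_eq, ← map_mul, inc_mul, lie_ePlus_ePlus, map_zero, add_zero, map_mul]

theorem eIter_comm (m : ℕ) (a b : Fin N) : eIter η κ m a b = eIter η κ m b a := by
  induction m with
  | zero => rw [eIter, eIter, ePlus_comm]
  | succ m ih =>
    rw [eIter, eIter]
    split_ifs with hm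
    · rw [ih, (commute_eIter η κ m m _ a _ b).eq]
    · exact ih

/-- The remaining `gl` acts on the deformed `E^{(m)}` as on the original symmetric tensor `E`. In
the induction `E_{i-j}` commutes with `σ_k`, and by the Leibniz rule the quadratic correction is
covariant. -/
theorem gl_mul_eIter (m : ℕ) {i j : Fin N} (hi : m ≤ i.val) (hj : m ≤ j.val) (a b : Fin N) :
    gl i j * eIter η κ m a b = eIter η κ m a b * gl i j +
      ((if j = a then eIter η κ m i b else 0) + if j = b then eIter η κ m a i else 0) := by
  induction m generalizing a b with
  | zero =>
    simp only [eIter, gl]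
    rw [← map_mul, inc_mul, lie_eMinus_ePlus, map_add, map_mul, map_add, map_add]
    congr 2 <;> split_ifs <;> simp
  | succ m ih =>
    have hm : m < N := lt_of_lt_of_le hi i.isLt.le
    have ih := ih (by omega) (by omega)
    set k : Fin N := ⟨m, hm⟩ with hk
    -- Indices still in play lie strictly beyond the link `k = m`, so `E_{i-j}` does not act on an
    -- index `k`.
    have hjk : j ≠ k := by rintro rfl; simp [hk] at hj
    have h0 : Commute (gl i j) (eIter η κ m k k) := by
      rw [commute_iff_eq, ih, if_neg hjk, if_neg hjk, add_zero, add_zero]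
    set s := expS (-sigma η κ k) with hs
    have h1 : Commute (gl i j) s :=
      commute_expS (constantCoeff_neg_eq_zero (constantCoeff_logOne _ _))
        (commute_logOne _ h0).neg_right
    have h2 : ∀ c, gl i j * eIter η κ m k c = eIter η κ m k c * gl i j +
        if j = c then eIter η κ m k i else 0 := by
      intro c; rw [ih, if_neg hjk, zero_add]
    have h3 : gl i j * (eIter η κ m k a * eIter η κ m k b * s) =
        (eIter η κ m k a * eIter η κ m k b * s) * gl i j +
        ((if j = a then eIter η κ m k i * eIter η κ m k b * s else 0) +
          if j = b then eIter η κ m k a * eIter η κ m k i * s else 0) := by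
      rw [← mul_assoc, ← mul_assoc, h2, add_mul, add_mul, mul_assoc (eIter η κ m k a), h2, mul_add,
        add_mul, mul_assoc _ s, ← h1.eq]
      split_ifs <;> (try simp only [mul_zero, zero_mul, add_zero, zero_add]) <;> noncomm_ring
    have h4 : ∀ (P : Prop) [Decidable P] (x y : PowerSeries (U (spN N))) (c : ℂ),
        (if P then x - X * (c • y) else 0) =
          (if P then x else 0) - X * (c • if P then y else 0) := by
      intro P _ x y c; split_ifs <;> simp
    simp only [eIter_succ η κ hm]
    rw [mul_sub, sub_mul, ih, ← mul_assoc (gl i j), (commute_X (gl i j)).eq, mul_assoc X,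
      mul_smul_comm, h3, mul_assoc X, smul_mul_assoc, smul_add, mul_add, smul_add, mul_add, h4, h4]
    abel

theorem mul_X_mul_of_lie {A : Type} [Ring A] {y f z : PowerSeries A} (h : y * f = f * y + z) :
    y * (X * f) = X * f * y + X * z := by
  rw [← mul_assoc, (commute_X y).eq, mul_assoc, h, mul_add, mul_assoc]

theorem mul_smul_of_lie {A : Type} [Ring A] [Algebra ℂ A] {y f z : PowerSeries A}
    (h : y * f = f * y + z) (c : ℂ) : y * (c • f) = c • f * y + c • z := by
  rw [mul_smul_comm, h, smul_add, smul_mul_assoc]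

theorem smul_mul_of_lie {A : Type} [Ring A] [Algebra ℂ A] {y f z : PowerSeries A}
    (h : y * f = f * y + z) (c : ℂ) : c • y * f = f * (c • y) + c • z := by
  rw [mul_smul_comm, smul_mul_assoc, h, smul_add]

theorem gl_mul_eIter_of_ne {k i : Fin N} (hki : i ≠ k) (hle : k ≤ i) (j : Fin N) :
    gl k i * eIter η κ k.val k j = eIter η κ k.val k j * gl k i +
      if i = j then eIter η κ k.val k k else 0 := by
  rw [gl_mul_eIter η κ k.val le_rfl hle, if_neg hki, zero_add]

/-- The data of the `k`-th link. -/
def linkData (k : Fin N) : LinkData (U (spN N)) (Fin N) where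
  -- With `κ k = 0` the index set is empty, so `T = 0` and the same structure describes a purely
  -- jordanian link.
  idx := if κ k = 0 then ∅ else Finset.univ.filter (k < ·)
  h := C (inc (hh k))
  e := X * (η k • eIter η κ k.val k k)
  -- The factor `η k` goes to `a` and `ξ` to `b`: then `[a_i, b_i] = e`, and `b` has no constant
  -- term.
  a i := η k • gl k i
  b i := X * eIter η κ k.val k i
  const_e := constantCoeff_X_mul_smul _ _
  const_b i := by simp
  h_e := by
    have h := gl_mul_eIter η κ k.val (le_refl k.val) (le_refl k.val) k k
    rw [if_pos rfl, ← two_smul ℂ] at h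
    rw [C_hh, mul_X_mul_of_lie (mul_smul_of_lie (smul_mul_of_lie h (1 / 2)) (η k))]
    congr 2; module
  h_a i hi := by
    have hki : k ≠ i := by
      split_ifs at hi
      · simp at hi
      · exact (Finset.mem_filter.mp hi).2.ne
    have h := gl_mul_gl k k k i
    rw [if_pos rfl, if_neg hki.symm, sub_zero] at h
    rw [C_hh, mul_smul_of_lie (smul_mul_of_lie h (1 / 2)) (η k)]
    module
  h_b i hi := by
    have hki : k ≠ i := by
      split_ifs at hi
      · simp at hi
      · exact (Finset.mem_filter.mp hi).2.ne
    have h := gl_mul_eIter η κ k.val (le_refl k.val) (le_refl k.val) k i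
    rw [if_pos rfl, if_neg hki, add_zero] at h
    rw [C_hh, mul_X_mul_of_lie (smul_mul_of_lie h (1 / 2)),
      mul_smul_comm (1 / 2 : ℂ) X]
  a_a i hi j hj := by
    have hki : ∀ i ∈ (if κ k = 0 then ∅ else Finset.univ.filter (k < ·)), i ≠ k := by
      intro i hi
      split_ifs at hi
      · simp at hi
      · exact (Finset.mem_filter.mp hi).2.ne'
    refine (Commute.smul_right (Commute.smul_left ?_ _) _)
    rw [commute_iff_eq, gl_mul_gl, if_neg (hki i hi), if_neg (hki j hj), sub_zero, add_zero]
  b_b i hi j hj := ((commute_X _).symm.mul_left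
    ((commute_X _).mul_right (commute_eIter η κ _ _ _ _ _ _)))
  e_a i hi := by
    have hki : i ≠ k ∧ k.val ≤ i.val := by
      split_ifs at hi
      · simp at hi
      · exact ⟨(Finset.mem_filter.mp hi).2.ne', (Finset.mem_filter.mp hi).2.le⟩
    refine (commute_X _).symm.mul_left (Commute.smul_right (Commute.smul_left ?_ _) _)
    refine Commute.symm ?_
    rw [commute_iff_eq, gl_mul_eIter_of_ne η κ hki.1 hki.2, if_neg hki.1, add_zero]
  e_b i hi := ((commute_X _).symm.mul_left
    ((commute_X _).mul_right ((commute_eIter η κ _ _ _ _ _ _).smul_left _)))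
  a_b_self i hi := by
    have hki : i ≠ k ∧ k.val ≤ i.val := by
      split_ifs at hi
      · simp at hi
      · exact ⟨(Finset.mem_filter.mp hi).2.ne', (Finset.mem_filter.mp hi).2.le⟩
    have h := gl_mul_eIter_of_ne η κ hki.1 hki.2 i
    rw [if_pos rfl] at h
    exact mul_X_mul_of_lie (smul_mul_of_lie h (η k))
  a_b_ne i hi j hj hij := by
    have hki : i ≠ k ∧ k.val ≤ i.val := by
      split_ifs at hi
      · simp at hi
      · exact ⟨(Finset.mem_filter.mp hi).2.ne', (Finset.mem_filter.mp hi).2.le⟩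
    refine (commute_X _).mul_right (Commute.smul_left ?_ _)
    rw [commute_iff_eq, gl_mul_eIter_of_ne η κ hki.1 hki.2, if_neg hij, add_zero]

theorem linkData_σ (k : Fin N) : (linkData η κ k).σ = sigma η κ k := rfl

theorem mem_linkData_idx {k i : Fin N} : i ∈ (linkData η κ k).idx ↔ κ k ≠ 0 ∧ k < i := by
  simp only [linkData]
  split_ifs with h <;> simp [h]

/-- The extension factors of one link commute, so their ordered product is a single exponential. -/
theorem list_prod_expS {A ι : Type} [Ring A] [Algebra ℂ A] (l : List ι) (f : ι → PowerSeries A)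
    (h0 : ∀ i ∈ l, constantCoeff (f i) = 0) (hc : ∀ i ∈ l, ∀ j ∈ l, Commute (f i) (f j)) :
    (l.map fun i => expS (f i)).prod = expS (l.map f).sum := by
  induction l with
  | nil => simp [expS_zero]
  | cons i l ih =>
    rw [List.map_cons, List.prod_cons, List.map_cons, List.sum_cons, expS_add (h0 i (by simp)),
      ih (fun j hj => h0 j (by simp [hj])) fun j hj k hk => hc j (by simp [hj]) k (by simp [hk])]
    · rw [map_list_sum]
      refine List.sum_eq_zero fun x hx => ?_
      simp only [List.map_map, List.mem_map] at hx
      obtain ⟨j, hj, rfl⟩ := hx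
      exact h0 j (by simp [hj])
    · refine Commute.list_sum_right _ _ fun x hx => ?_
      obtain ⟨j, hj, rfl⟩ := List.mem_map.mp hx
      exact hc i (by simp) j (by simp [hj])

theorem LinkData.commute_T_summand {A ι : Type} [Ring A] [Algebra ℂ A] (D : LinkData A ι) {i j : ι}
    (hi : i ∈ D.idx) (hj : j ∈ D.idx) :
    Commute (tens (D.a i) (D.β i)) (tens (D.a j) (D.β j)) :=
  (((D.a_a i hi j hj).map inL).mul_right (commute_inL_inR _ _)).mul_left
    ((commute_inL_inR _ _).symm.mul_right ((D.β_β hi hj).map inR))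

theorem extension_eq_expS {k : Fin N} (hk : κ k = 1) (i : Fin N) :
    extension η κ k i = expS (tens ((linkData η κ k).a i) ((linkData η κ k).β i)) := by
  rw [extension, hk, one_mul]
  congr 1
  change X * η k • tens (gl k i) (eIter η κ k.val k i * (linkData η κ k).q) =
    tens (η k • gl k i) (X * eIter η κ k.val k i * (linkData η κ k).q)
  rw [tens_eq, tens_eq, ap_smul, mul_assoc, map_mul inR X, map_X, ← mul_assoc (_ • _) X,
    (commute_X (η k • inL (gl k i))).eq, mul_assoc, smul_mul_assoc]

/-- Passage from the chain as defined to the abstract `LinkData`; from here on the factors of a link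
are not needed separately. -/
theorem link_eq {k : Fin N} (hκ : κ k = 0 ∨ κ k = 1) : link η κ k = (linkData η κ k).L := by
  set D := linkData η κ k with hD
  have hJ : jordanian η κ k = D.J := rfl
  rw [link, hJ, LinkData.L]
  congr 1
  rcases hκ with h | h
  · have h1 : extension η κ k = fun _ => 1 := by
      funext i; rw [extension, h, zero_mul, zero_smul, mul_zero, expS_zero]
    have h2 : D.T = 0 := by
      rw [LinkData.T, Finset.sum_eq_zero]
      intro i hi
      exact absurd h (mem_linkData_idx η κ |>.mp hi).1
    rw [h1, h2, expS_zero]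
    simp
  · have h1 : extension η κ k = fun i => expS (tens (D.a i) (D.β i)) :=
      funext fun i => extension_eq_expS η κ h i
    have hm : ∀ i ∈ (List.finRange N).reverse.filter (fun i => k < i), i ∈ D.idx := by
      intro i hi
      rw [mem_linkData_idx]
      exact ⟨by rw [h]; exact one_ne_zero, by simpa using hi⟩
    rw [h1, list_prod_expS _ _ (fun i _ => constantCoeff_tens (D.const_β i))
      fun i hi j hj => D.commute_T_summand (hm i hi) (hm j hj), LinkData.T,
      ← List.sum_toFinset _ ((List.nodup_reverse.mpr (List.nodup_finRange N)).filter _)]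
    congr 1
    refine Finset.sum_congr ?_ fun _ _ => rfl
    ext i
    rw [mem_linkData_idx]
    simp [h]

end Iterated

/-! ### Counits -/

section Counit

variable {g : Type} [LieRing g] [LieAlgebra ℂ g]

theorem ap_counit_C_inc (x : g) : ap (counit g) (C (inc x)) = 0 := by
  rw [map_C]
  change C (counit g (UniversalEnvelopingAlgebra.ι ℂ x)) = 0
  rw [counit, UniversalEnvelopingAlgebra.lift_ι_apply]
  simp

theorem ap_counitLeft_inL (x : PowerSeries (U g)) :
    ap (counitLeft g) (inL x) = ap (Algebra.ofId ℂ (U g)) (ap (counit g) x) :=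
  ap_eq_of_forall (fun a => by simp [counitLeft, Algebra.ofId_apply, Algebra.algebraMap_eq_smul_one])
    x

theorem ap_counitRight_inR (x : PowerSeries (U g)) :
    ap (counitRight g) (inR x) = ap (Algebra.ofId ℂ (U g)) (ap (counit g) x) :=
  ap_eq_of_forall (fun a => by simp [counitRight, Algebra.ofId_apply, Algebra.algebraMap_eq_smul_one])
    x

theorem ap_counitLeft_tens {x : PowerSeries (U g)} (h : ap (counit g) x = 0)
    (y : PowerSeries (U g)) : ap (counitLeft g) (tens x y) = 0 := by
  rw [tens_eq, map_mul, ap_counitLeft_inL, h, map_zero, zero_mul]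

theorem ap_counitRight_tens {y : PowerSeries (U g)} (h : ap (counit g) y = 0)
    (x : PowerSeries (U g)) : ap (counitRight g) (tens x y) = 0 := by
  rw [tens_eq, map_mul, ap_counitRight_inR, h, map_zero, mul_zero]

namespace LinkData

variable {ι : Type} (D : LinkData (U g) ι)

theorem ap_counitLeft_L (hh : ap (counit g) D.h = 0) (ha : ∀ i ∈ D.idx, ap (counit g) (D.a i) = 0) :
    ap (counitLeft g) D.L = 1 := by
  rw [L, J, map_mul, map_expS, map_expS, T, map_sum, ap_counitLeft_tens hh,
    Finset.sum_eq_zero fun i hi => ap_counitLeft_tens (ha i hi) _, expS_zero, mul_one]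

theorem ap_counit_σ (he : ap (counit g) D.e = 0) : ap (counit g) D.σ = 0 := by
  rw [σ, map_log1p, he, log1p_zero]

theorem ap_counitRight_L (he : ap (counit g) D.e = 0)
    (hb : ∀ i ∈ D.idx, ap (counit g) (D.b i) = 0) : ap (counitRight g) D.L = 1 := by
  rw [L, J, map_mul, map_expS, map_expS, T, map_sum, ap_counitRight_tens (D.ap_counit_σ he),
    Finset.sum_eq_zero, expS_zero, mul_one]
  intro i hi
  exact ap_counitRight_tens (by rw [β, map_mul, hb i hi, zero_mul]) _

end LinkData

end Counit

/-! ### The chain -/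

section Chain

variable {N : ℕ} (η κ : Fin N → ℂ)

theorem ap_counit_eIter (m : ℕ) : ∀ a b : Fin N, ap (counit (spN N)) (eIter η κ m a b) = 0 := by
  induction m with
  | zero => exact fun a b => ap_counit_C_inc _
  | succ m ih =>
    intro a b
    rw [eIter]
    split_ifs with hm
    · rw [map_sub, ih, map_mul, ap_smul, map_mul, map_mul, ih]
      simp
    · exact ih a b

theorem ap_counit_sigma (k : Fin N) : ap (counit (spN N)) (sigma η κ k) = 0 :=
  (linkData η κ k).ap_counit_σ (by
    change ap (counit (spN N)) (X * (η k • eIter η κ k.val k k)) = 0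
    rw [map_mul, ap_smul, ap_counit_eIter, smul_zero, mul_zero])

theorem chain_succ {m : ℕ} (h : m < N) (hκ : ∀ k, κ k = 0 ∨ κ k = 1) :
    chain η κ (m + 1) = (linkData η κ ⟨m, h⟩).L * chain η κ m := by
  rw [chain, dif_pos h, link_eq η κ (hκ _)]

theorem commute_sigma (i k : Fin N) : Commute (sigma η κ i) (sigma η κ k) :=
  commute_logOne _ (commute_logOne _ (commute_eIter η κ _ _ _ _ _ _)).symm

theorem gl_commute_sigma {i j k : Fin N} (hi : k ≤ i) (hj : k < j) :
    Commute (gl i j) (sigma η κ k) := by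
  refine commute_logOne _ ?_
  rw [commute_iff_eq, gl_mul_eIter η κ k.val hi hj.le, if_neg hj.ne', if_neg hj.ne', add_zero,
    add_zero]

/-- The twist property of the chain, and the elements known to be primitive for it. -/
structure ChainInvariant (m : ℕ) : Prop where
  isTwist : IsTwist (chain η κ m)
  isPrim_gl : ∀ i j : Fin N, m ≤ i.val → m ≤ j.val → IsPrim (chain η κ m) (gl i j)
  isPrim_eIter : ∀ i j : Fin N, m ≤ i.val → m ≤ j.val → IsPrim (chain η κ m) (eIter η κ m i j)
  isPrim_sigma : ∀ k : Fin N, k.val < m → IsPrim (chain η κ m) (sigma η κ k)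

theorem chainInvariant_zero : ChainInvariant η κ 0 where
  isTwist := ⟨isUnit_one, by simp [chain], by simp [chain], by simp [chain]⟩
  isPrim_gl _ _ _ _ := isPrim_one_C_inc _
  isPrim_eIter _ _ _ _ := isPrim_one_C_inc _
  isPrim_sigma k hk := absurd hk (Nat.not_lt_zero _)

variable {η κ}

/-- The invariant at `m` makes the generators of link `m` primitive, which gives the new twist. Of
the elements with indices beyond `m`, the `E_{i-j}` survive by invariance and the `E^{(m)}_{i+j}`
are replaced by their corrections. The old `σ`'s commute with the whole link, and `σ_m` is new. -/
theorem ChainInvariant.succ (hκ : ∀ k, κ k = 0 ∨ κ k = 1) {m : ℕ} (hm : m < N)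
    (I : ChainInvariant η κ m) : ChainInvariant η κ (m + 1) := by
  set k : Fin N := ⟨m, hm⟩ with hk
  set D := linkData η κ k with hD
  have hc : chain η κ (m + 1) = D.L * chain η κ m := chain_succ η κ hm hκ
  have hidx : ∀ i ∈ D.idx, k < i := fun i hi => ((mem_linkData_idx η κ).mp hi).2
  have ph : IsPrim (chain η κ m) D.h := by
    change IsPrim _ (C (inc (hh k)))
    rw [C_hh]
    exact (I.isPrim_gl k k le_rfl le_rfl).smul _
  have pe : IsPrim (chain η κ m) D.e := ((I.isPrim_eIter k k le_rfl le_rfl).smul _).X_mul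
  have pa : ∀ i ∈ D.idx, IsPrim (chain η κ m) (D.a i) := fun i hi =>
    (I.isPrim_gl k i le_rfl (hidx i hi).le).smul _
  have pb : ∀ i ∈ D.idx, IsPrim (chain η κ m) (D.b i) := fun i hi =>
    (I.isPrim_eIter k i le_rfl (hidx i hi).le).X_mul
  have hgl : ∀ i j : Fin N, k < i → k < j → Commute D.h (gl i j) ∧ Commute (gl i j) D.e := by
    intro i j hi hj
    constructor
    · change Commute (C (inc (hh k))) _
      rw [C_hh]
      refine Commute.smul_left ?_ _
      rw [commute_iff_eq, gl_mul_gl, if_neg hi.ne, if_neg hj.ne', sub_zero, add_zero]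
    · refine (commute_X _).mul_right (Commute.smul_right ?_ _)
      rw [commute_iff_eq, gl_mul_eIter η κ k.val hi.le hj.le, if_neg hj.ne', if_neg hj.ne',
        add_zero, add_zero]
  have hE : ∀ i j : Fin N, k < i → k < j → Commute D.h (eIter η κ m i j) := by
    intro i j hi hj
    change Commute (C (inc (hh k))) _
    rw [C_hh]
    refine Commute.smul_left ?_ _
    rw [commute_iff_eq, gl_mul_eIter η κ m le_rfl le_rfl, if_neg hi.ne, if_neg hj.ne, add_zero,
      add_zero]
  have hEe : ∀ i j : Fin N, Commute (eIter η κ m i j) D.e := fun i j =>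
    (commute_X _).mul_right ((commute_eIter η κ _ _ _ _ _ _).smul_right _)
  have hEb : ∀ i j l : Fin N, Commute (eIter η κ m i j) (D.b l) := fun i j l =>
    (commute_X _).mul_right (commute_eIter η κ _ _ _ _ _ _)
  refine ⟨?_, ?_, ?_, ?_⟩
  · rw [hc]
    refine D.isTwist_L_mul I.isTwist ph pe pa pb (D.ap_counitLeft_L (ap_counit_C_inc _) ?_)
      (D.ap_counitRight_L ?_ ?_)
    · intro i _
      change ap (counit (spN N)) (η k • gl k i) = 0
      rw [ap_smul, gl, ap_counit_C_inc, smul_zero]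
    · change ap (counit (spN N)) (X * (η k • eIter η κ m k k)) = 0
      rw [map_mul, ap_smul, ap_counit_eIter, smul_zero, mul_zero]
    · intro i _
      change ap (counit (spN N)) (X * eIter η κ m k i) = 0
      rw [map_mul, ap_counit_eIter, mul_zero]
  · intro i j hi hj
    have hi' : k < i := hi
    have hj' : k < j := hj
    rw [hc]
    refine (I.isPrim_gl i j (by omega) (by omega)).of_commute ?_
    obtain ⟨h1, h2⟩ := hgl i j hi' hj'
    rcases hκ k with h | h
    · have he : ∀ l, l ∉ D.idx := fun l hl => ((mem_linkData_idx η κ).mp hl).1 h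
      have := D.L_mul_commuting h1 h2 (fun l hl => absurd hl (he l)) (fun l hl => absurd hl (he l))
      exact this.1.add_right this.2
    · have hmem : ∀ l, k < l → l ∈ D.idx := fun l hl =>
        (mem_linkData_idx η κ).mpr ⟨by rw [h]; exact one_ne_zero, hl⟩
      refine D.L_mul_invariant (hmem i hi') (hmem j hj') h1 h2 (fun l hl => ?_) fun l hl => ?_
      · change gl i j * (η k • gl k l) =
          η k • gl k l * gl i j - if l = i then η k • gl k j else 0
        rw [mul_smul_of_lie (gl_mul_gl i j k l), if_neg hj'.ne']
        split_ifs <;> simp [sub_eq_add_neg]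
      · change gl i j * (X * eIter η κ m k l) =
          X * eIter η κ m k l * gl i j +
            if l = j then X * eIter η κ m k i else 0
        rw [mul_X_mul_of_lie (gl_mul_eIter η κ m (by omega) (by omega) k l), if_neg hj'.ne',
          zero_add, mul_ite, mul_zero]
        simp only [eq_comm (a := j) (b := l)]
  · intro i j hi hj
    have hi' : k < i := hi
    have hj' : k < j := hj
    rw [hc, eIter_succ η κ hm]
    rcases hκ k with h | h
    · have he : ∀ l, l ∉ D.idx := fun l hl => ((mem_linkData_idx η κ).mp hl).1 h
      have := D.L_mul_commuting (hE i j hi' hj') (hEe i j) (fun l hl => absurd hl (he l))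
        (fun l hl => absurd hl (he l))
      rw [← hk, h, zero_mul, zero_smul, mul_zero, sub_zero]
      exact (I.isPrim_eIter i j (by omega) (by omega)).of_commute (this.1.add_right this.2)
    · have hmem : ∀ l, k < l → l ∈ D.idx := fun l hl =>
        (mem_linkData_idx η κ).mpr ⟨by rw [h]; exact one_ne_zero, hl⟩
      refine IsPrim.of_X_mul ?_
      -- The factor `e^{-σ}` splits into the two `e^{-σ/2}` of `β i` and `β j`, and each `b` brings
      -- one `X`: the recursion for `eIter` is the correction of `L_mul_deformed`.
      have hβ : X * (eIter η κ m i j - X * ((κ k * η k) •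
          (eIter η κ m k i * eIter η κ m k j *
            expS (-sigma η κ k)))) =
          X * eIter η κ m i j - η k • (D.β i * D.β j) := by
        have hq : D.q * D.q = expS (-sigma η κ k) := by
          rw [LinkData.q, ← expS_add D.const_neg_half D.const_neg_half (Commute.refl _),
            ← neg_add, ← add_smul, hD, linkData_σ]
          norm_num
        have : D.β i * D.β j = X * (X * (eIter η κ m k i * eIter η κ m k j *
            expS (-sigma η κ k))) := by
          rw [LinkData.β, LinkData.β, mul_assoc, ← mul_assoc D.q,
            ← (D.b_q (hmem j hj')).eq, mul_assoc (D.b j), hq]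
          change X * eIter η κ m k i * (X * eIter η κ m k j * _) = _
          rw [mul_assoc X, ← mul_assoc (eIter η κ m k i), ← mul_assoc _ X,
            (commute_X (eIter η κ m k i)).eq]
          simp only [mul_assoc]
        rw [this, h, one_mul, mul_sub, mul_smul_comm, mul_smul_comm]
      rw [hβ]
      refine D.isPrim_L_deformed (hmem i hi') (hmem j hj') (η k)
        ((commute_X _).mul_right (hE i j hi' hj'))
        ((commute_X _).symm.mul_left (hEe i j))
        (fun l _ => (commute_X _).symm.mul_left (hEb i j l)) (fun l hl => ?_) pe pb
        (I.isPrim_eIter i j (by omega) (by omega)).X_mul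
      change η k • gl k l * (X * eIter η κ m i j) =
        X * eIter η κ m i j * (η k • gl k l) +
          η k • ((if l = i then X * eIter η κ m k j else 0) +
            if l = j then X * eIter η κ m k i else 0)
      -- The commutator produces `E_{i+k}` where the lemma expects `b i = ξ E_{k+i}`; `eIter_comm`
      -- exchanges the indices.
      rw [mul_X_mul_of_lie (smul_mul_of_lie (gl_mul_eIter η κ m (le_refl k.val) (hidx l hl).le i j)
        (η k)), eIter_comm η κ m i k, mul_smul_comm (η k) X, mul_add, mul_ite, mul_ite, mul_zero]
  · intro k' hk'
    rw [hc]
    rcases Nat.lt_succ_iff_lt_or_eq.mp hk' with hlt | heq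
    · have hlt' : k' < k := hlt
      have hs : ∀ a b : Fin N, Commute (sigma η κ k') (eIter η κ m a b) :=
        fun a b => (commute_logOne _ (commute_eIter η κ _ _ _ _ _ _)).symm
      have := D.L_mul_commuting (z := sigma η κ k') (by
          change Commute (C (inc (hh k))) _
          rw [C_hh]
          exact (gl_commute_sigma η κ hlt'.le hlt').smul_left _)
        ((commute_X _).mul_right ((hs _ _).smul_right _))
        (fun l hl => ((gl_commute_sigma η κ hlt'.le (hlt'.trans (hidx l hl))).smul_left _).symm)
        (fun l _ => (commute_X _).mul_right (hs _ _))
      exact (I.isPrim_sigma k' hlt).of_commute (this.1.add_right this.2)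
    · have : k' = k := Fin.ext heq
      subst this
      exact D.isPrim_L_σ pe

theorem chainInvariant (hκ : ∀ k, κ k = 0 ∨ κ k = 1) {m : ℕ} (hm : m ≤ N) :
    ChainInvariant η κ m := by
  induction m with
  | zero => exact chainInvariant_zero η κ
  | succ m ih => exact (ih (by omega)).succ hκ hm

end Chain

/-! ### Twists built from commuting primitive elements -/

section Abelian

variable {g : Type} [LieRing g] [LieAlgebra ℂ g]

theorem commute_scal {A : Type} [Ring A] [Algebra ℂ A] (c : PowerSeries ℂ) (f : PowerSeries A) :
    Commute (scal c) f := by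
  refine commute_of_coeff fun m n => ?_
  rw [scal, coeff_map]
  exact Algebra.commutes _ _

theorem ap_scal {A B : Type} [Ring A] [Algebra ℂ A] [Ring B] [Algebra ℂ B] (F : A →ₐ[ℂ] B)
    (c : PowerSeries ℂ) : ap F (scal c) = scal c := by
  ext n
  simp only [scal, coeff_map]
  exact F.commutes _

theorem X_mul_divXi {A : Type} [Ring A] [Algebra ℂ A] {f : PowerSeries A}
    (h : constantCoeff f = 0) : X * divXi f = f := by
  ext n
  rcases n with _ | n
  · simp [h]
  · rw [coeff_succ_X_mul, divXi, coeff_mk]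

theorem commute_of_X_mul {A : Type} [Ring A] {f h : PowerSeries A}
    (H : Commute (X * f) (X * h)) : Commute f h := by
  have key : ∀ u v : PowerSeries A, X * u * (X * v) = X * (X * (u * v)) := by
    intro u v
    rw [mul_assoc, ← mul_assoc u, (commute_X u).eq, mul_assoc]
  rw [commute_iff_eq, key, key] at H
  exact X_mul_cancel (X_mul_cancel H)

theorem coeff_zero_mul' {A : Type} [Ring A] (f h : PowerSeries A) :
    coeff 0 (f * h) = coeff 0 f * coeff 0 h := by
  rw [coeff_mul]
  simp

theorem coeff_one_mul' {A : Type} [Ring A] (f h : PowerSeries A) :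
    coeff 1 (f * h) = coeff 0 f * coeff 1 h + coeff 1 f * coeff 0 h := by
  rw [coeff_mul, show Finset.HasAntidiagonal.antidiagonal 1 = {(0, 1), (1, 0)} from rfl]
  simp

theorem coeff_two_mul {A : Type} [Ring A] (f h : PowerSeries A) :
    coeff 2 (f * h) = coeff 0 f * coeff 2 h + coeff 1 f * coeff 1 h + coeff 2 f * coeff 0 h := by
  rw [coeff_mul, show Finset.HasAntidiagonal.antidiagonal 2 = {(0, 2), (1, 1), (2, 0)} from rfl]
  simp [add_assoc]

theorem coeff_one_tens {A : Type} [Ring A] [Algebra ℂ A] {x y : PowerSeries A}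
    (hy : constantCoeff y = 0) : coeff 1 (tens x y) = coeff 0 x ⊗ₜ[ℂ] coeff 1 y := by
  rw [tens_eq, coeff_one_mul']
  simp only [coeff_map]
  simp [hy]

theorem coeff_two_tens {A : Type} [Ring A] [Algebra ℂ A] {x y : PowerSeries A}
    (hx : constantCoeff x = 0) (hy : constantCoeff y = 0) :
    coeff 2 (tens x y) = coeff 1 x ⊗ₜ[ℂ] coeff 1 y := by
  rw [tens_eq, coeff_two_mul]
  simp only [coeff_map]
  simp [hx, hy]

/-- `∑_{i, j ∈ s} (c_{ij} / ξ) σᵢ ⊗ σⱼ`. -/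
def abelianExponent {ι : Type} (s : Finset ι) (σ : ι → PowerSeries (U g))
    (c : ι → ι → PowerSeries ℂ) : PowerSeries (U2 g) :=
  ∑ i ∈ s, ∑ j ∈ s, scal (c i j) * divXi (tens (σ i) (σ j))

theorem ap_leg13_inL (x : PowerSeries (U g)) : ap (leg13 g) (inL x) = ap (leg1 g) x :=
  ap_ap_eq (fun a => by simp [leg13, leg1, Algebra.TensorProduct.one_def]) x

theorem ap_leg13_inR (x : PowerSeries (U g)) : ap (leg13 g) (inR x) = ap (leg3 g) x :=
  ap_ap_eq (fun a => by simp [leg13, leg3]) x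

variable {ι : Type} {s : Finset ι} {σ : ι → PowerSeries (U g)} (c : ι → ι → PowerSeries ℂ)
  (h0 : ∀ i ∈ s, constantCoeff (σ i) = 0)
include h0

/-- Multiplication by `X` undoes the division by `ξ`. Identities for the exponent are proved after
this step, and then `X` is cancelled. -/
theorem X_mul_abelianExponent : X * abelianExponent s σ c =
    ∑ i ∈ s, ∑ j ∈ s, scal (c i j) * tens (σ i) (σ j) := by
  rw [abelianExponent, Finset.mul_sum]
  refine Finset.sum_congr rfl fun i _ => ?_
  rw [Finset.mul_sum]
  refine Finset.sum_congr rfl fun j hj => ?_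
  rw [← mul_assoc, ← (commute_X _).eq, mul_assoc, X_mul_divXi (constantCoeff_tens (h0 j hj))]

/-- Each `σᵢ ⊗ σⱼ` is of order `ξ²`, so a pole of order one is harmless and the exponential makes
sense. -/
theorem constantCoeff_abelianExponent : constantCoeff (abelianExponent s σ c) = 0 := by
  rw [abelianExponent, map_sum]
  refine Finset.sum_eq_zero fun i hi => ?_
  rw [map_sum]
  refine Finset.sum_eq_zero fun j hj => ?_
  rw [map_mul, divXi, constantCoeff_mk, coeff_one_tens (h0 j hj), coeff_zero_eq_constantCoeff_apply,
    h0 i hi, TensorProduct.zero_tmul, mul_zero]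

theorem coeff_one_abelianExponent : coeff 1 (abelianExponent s σ c) =
    ∑ i ∈ s, ∑ j ∈ s, constantCoeff (c i j) • (coeff 1 (σ i) ⊗ₜ[ℂ] coeff 1 (σ j)) := by
  have := congrArg (coeff 2) (X_mul_abelianExponent c h0)
  rw [coeff_succ_X_mul] at this
  rw [this, map_sum]
  refine Finset.sum_congr rfl fun i hi => ?_
  rw [map_sum]
  refine Finset.sum_congr rfl fun j hj => ?_
  have h1 : coeff 1 (tens (σ i) (σ j)) = 0 := by
    rw [coeff_one_tens (h0 j hj), coeff_zero_eq_constantCoeff_apply, h0 i hi,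
      TensorProduct.zero_tmul]
  have h00 : constantCoeff (tens (σ i) (σ j)) = 0 := constantCoeff_tens (h0 j hj)
  rw [coeff_two_mul]
  simp [h1, h00, scal, coeff_two_tens (h0 i hi) (h0 j hj), Algebra.smul_def]

theorem X_mul_ap_abelianExponent {B : Type} [Ring B] [Algebra ℂ B] (F : U2 g →ₐ[ℂ] B) :
    X * ap F (abelianExponent s σ c) =
      ∑ i ∈ s, ∑ j ∈ s, scal (c i j) * ap F (tens (σ i) (σ j)) := by
  have := congrArg (ap F) (X_mul_abelianExponent c h0)
  rw [map_mul, map_X] at this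
  rw [this, map_sum]
  refine Finset.sum_congr rfl fun i _ => ?_
  rw [map_sum]
  exact Finset.sum_congr rfl fun j _ => by rw [map_mul, ap_scal]

theorem commute_ap_abelianExponent {B : Type} [Ring B] [Algebra ℂ B] (F G : U2 g →ₐ[ℂ] B)
    (h : ∀ i ∈ s, ∀ j ∈ s, ∀ k ∈ s, ∀ l ∈ s,
      Commute (ap F (tens (σ i) (σ j))) (ap G (tens (σ k) (σ l)))) :
    Commute (ap F (abelianExponent s σ c)) (ap G (abelianExponent s σ c)) := by
  refine commute_of_X_mul ?_
  rw [X_mul_ap_abelianExponent c h0, X_mul_ap_abelianExponent c h0]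
  refine Commute.sum_left _ _ _ fun i hi => Commute.sum_left _ _ _ fun j hj =>
    Commute.sum_right _ _ _ fun k hk => Commute.sum_right _ _ _ fun l hl => ?_
  exact (commute_scal _ _).mul_left ((commute_scal _ _).symm.mul_right (h i hi j hj k hk l hl))

theorem ap_abelianExponent_eq_zero {B : Type} [Ring B] [Algebra ℂ B] (F : U2 g →ₐ[ℂ] B)
    (h : ∀ i ∈ s, ∀ j ∈ s, ap F (tens (σ i) (σ j)) = 0) :
    ap F (abelianExponent s σ c) = 0 := by
  have := X_mul_ap_abelianExponent c h0 F
  rw [Finset.sum_eq_zero fun i hi => Finset.sum_eq_zero fun j hj => by rw [h i hi j hj, mul_zero],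
    ← mul_zero X] at this
  exact X_mul_cancel this

variable {F : PowerSeries (U2 g)} (hp : ∀ i ∈ s, IsPrim F (σ i))
include hp

theorem leg12_mul_comulLeft_abelianExponent :
    ap (leg12 g) F * ap (comulLeft g) (abelianExponent s σ c) =
      (ap (leg13 g) (abelianExponent s σ c) + ap (leg23 g) (abelianExponent s σ c)) *
        ap (leg12 g) F := by
  refine X_mul_cancel ?_
  rw [← mul_assoc, ← (commute_X _).eq, mul_assoc, ← mul_assoc X, mul_add,
    X_mul_ap_abelianExponent c h0, X_mul_ap_abelianExponent c h0, X_mul_ap_abelianExponent c h0,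
    ← Finset.sum_add_distrib, Finset.mul_sum, Finset.sum_mul]
  refine Finset.sum_congr rfl fun i hi => ?_
  rw [← Finset.sum_add_distrib, Finset.mul_sum, Finset.sum_mul]
  refine Finset.sum_congr rfl fun j _ => ?_
  rw [← mul_assoc, ← (commute_scal _ _).eq, mul_assoc, ← mul_add, mul_assoc, tens_eq, map_mul,
    ap_comulLeft_inL, ap_comulLeft_inR, ← mul_assoc (ap _ F), ← map_mul, hp i hi, map_mul,
    mul_assoc, (commute_leg12_leg3 F _).eq, ← mul_assoc, map_add, map_mul, map_mul, ap_leg12_inL,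
    ap_leg12_inR, ap_leg13_inL, ap_leg13_inR, ap_leg23_inL, ap_leg23_inR]
  noncomm_ring

theorem leg23_mul_comulRight_abelianExponent :
    ap (leg23 g) F * ap (comulRight g) (abelianExponent s σ c) =
      (ap (leg12 g) (abelianExponent s σ c) + ap (leg13 g) (abelianExponent s σ c)) *
        ap (leg23 g) F := by
  refine X_mul_cancel ?_
  rw [← mul_assoc, ← (commute_X _).eq, mul_assoc, ← mul_assoc X, mul_add,
    X_mul_ap_abelianExponent c h0, X_mul_ap_abelianExponent c h0, X_mul_ap_abelianExponent c h0,
    ← Finset.sum_add_distrib, Finset.mul_sum, Finset.sum_mul]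
  refine Finset.sum_congr rfl fun i _ => ?_
  rw [← Finset.sum_add_distrib, Finset.mul_sum, Finset.sum_mul]
  refine Finset.sum_congr rfl fun j hj => ?_
  rw [← mul_assoc, ← (commute_scal _ _).eq, mul_assoc, ← mul_add, mul_assoc, tens_eq, map_mul,
    ap_comulRight_inL, ap_comulRight_inR, ← mul_assoc (ap _ F), (commute_leg23_leg1 F _).eq,
    mul_assoc, ← map_mul, hp j hj, map_mul, map_add, map_mul, map_mul, ap_leg12_inL,
    ap_leg12_inR, ap_leg13_inL, ap_leg13_inR, ap_leg23_inL, ap_leg23_inR]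
  noncomm_ring

variable (hc : ∀ i ∈ s, ∀ j ∈ s, Commute (σ i) (σ j))
include hc

/-- With `A` the exponent, both sides contain `exp(A₁₂ + A₁₃ + A₂₃)`; the three summands commute
because the `σ`'s do. -/
theorem abelian_twist_equation :
    ap (leg12 g) (expS (abelianExponent s σ c)) *
        (ap (leg12 g) F * ap (comulLeft g) (expS (abelianExponent s σ c))) =
      expS (ap (leg12 g) (abelianExponent s σ c) + ap (leg13 g) (abelianExponent s σ c) +
        ap (leg23 g) (abelianExponent s σ c)) * ap (leg12 g) F ∧
    ap (leg23 g) (expS (abelianExponent s σ c)) *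
        (ap (leg23 g) F * ap (comulRight g) (expS (abelianExponent s σ c))) =
      expS (ap (leg12 g) (abelianExponent s σ c) + ap (leg13 g) (abelianExponent s σ c) +
        ap (leg23 g) (abelianExponent s σ c)) * ap (leg23 g) F := by
  have eL := leg12_mul_comulLeft_abelianExponent c h0 hp
  have eR := leg23_mul_comulRight_abelianExponent c h0 hp
  have t12 : ∀ x y : PowerSeries (U g), ap (leg12 g) (tens x y) = tri x y 1 := by
    intro x y; rw [tens_eq, map_mul, ap_leg12_inL, ap_leg12_inR, tri, map_one, mul_one]
  have t13 : ∀ x y : PowerSeries (U g), ap (leg13 g) (tens x y) = tri x 1 y := by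
    intro x y; rw [tens_eq, map_mul, ap_leg13_inL, ap_leg13_inR, tri, map_one, mul_one]
  have t23 : ∀ x y : PowerSeries (U g), ap (leg23 g) (tens x y) = tri 1 x y := by
    intro x y; rw [tens_eq, map_mul, ap_leg23_inL, ap_leg23_inR, tri, map_one, one_mul]
  have c1 := commute_ap_abelianExponent c h0 (leg12 g) (leg13 g) fun i hi j hj k hk l hl => by
    rw [t12, t13]
    exact commute_tri (hc i hi k hk) (Commute.one_right _) (Commute.one_left _)
  have c2 := commute_ap_abelianExponent c h0 (leg12 g) (leg23 g) fun i hi j hj k hk l hl => by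
    rw [t12, t23]
    exact commute_tri (Commute.one_right _) (hc j hj k hk) (Commute.one_left _)
  have c3 := commute_ap_abelianExponent c h0 (leg13 g) (leg23 g) fun i hi j hj k hk l hl => by
    rw [t13, t23]
    exact commute_tri (Commute.one_right _) (Commute.one_left _) (hc j hj l hl)
  have cst := constantCoeff_abelianExponent c h0
  have k12 := constantCoeff_ap (leg12 g) cst
  have k13 := constantCoeff_ap (leg13 g) cst
  have k23 := constantCoeff_ap (leg23 g) cst
  simp only [map_expS]
  rw [mul_expS (constantCoeff_ap _ cst) (constantCoeff_add_eq_zero k13 k23) eL,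
    mul_expS (constantCoeff_ap _ cst) (constantCoeff_add_eq_zero k12 k13) eR, ← mul_assoc,
    ← mul_assoc, ← expS_add k12 (constantCoeff_add_eq_zero k13 k23) (c1.add_right c2),
    ← expS_add k23 (constantCoeff_add_eq_zero k12 k13) (c2.symm.add_right c3.symm)]
  constructor
  · rw [add_assoc]
  · rw [add_comm]

theorem abelian_isTwist (hF : IsTwist F) (he : ∀ i ∈ s, ap (counit g) (σ i) = 0) :
    IsTwistOver F (expS (abelianExponent s σ c)) ∧
      IsTwist (expS (abelianExponent s σ c) * F) := by
  obtain ⟨e1, e2⟩ := abelian_twist_equation c h0 hp hc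
  have hu := isUnit_expS (constantCoeff_abelianExponent c h0)
  have hl : ap (counitLeft g) (expS (abelianExponent s σ c)) = 1 := by
    rw [map_expS, ap_abelianExponent_eq_zero c h0 _ fun i hi j _ =>
      ap_counitLeft_tens (he i hi) _, expS_zero]
  have hr : ap (counitRight g) (expS (abelianExponent s σ c)) = 1 := by
    rw [map_expS, ap_abelianExponent_eq_zero c h0 _ fun i _ j hj =>
      ap_counitRight_tens (he j hj) _, expS_zero]
  refine ⟨⟨hu, ?_, hl, hr⟩, isTwist_mul hu hF ?_ hl hr⟩
  · rw [← mul_assoc, e1, ← mul_assoc, e2, mul_assoc, mul_assoc, ← map_mul, ← map_mul,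
      Ring.mul_inverse_cancel _ hF.1, map_one, map_one]
  · rw [e1, e2, mul_assoc, mul_assoc, hF.2.1]

end Abelian

/-! ### Classical limits and the classical Yang-Baxter equation -/

section Classical

variable {g : Type} [LieRing g] [LieAlgebra ℂ g]

theorem comm_inc2 (f : g ⊗[ℂ] g) :
    Algebra.TensorProduct.comm ℂ (U g) (U g) (inc2 f) = inc2 (TensorProduct.comm ℂ g g f) := by
  induction f using TensorProduct.induction_on with
  | zero => simp
  | add x y hx hy => simp only [map_add, hx, hy]
  | tmul x y => simp [inc2]

/-- To first order `F₂₁ F⁻¹ = (1 + ξ f₂₁)(1 - ξ f)`. -/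
theorem hasClassicalLimit_of_coeff {F : PowerSeries (U2 g)} {f : g ⊗[ℂ] g} (hF : IsUnit F)
    (h0 : coeff 0 F = 1) (h1 : coeff 1 F = inc2 f) :
    HasClassicalLimit F (f - TensorProduct.comm ℂ g g f) := by
  have hi := Ring.mul_inverse_cancel F hF
  have i0 : coeff 0 (Ring.inverse F) = 1 := by
    have := congrArg (coeff 0) hi
    rw [coeff_zero_mul'] at this
    simpa [h0] using this
  have i1 : coeff 1 (Ring.inverse F) = -inc2 f := by
    have := congrArg (coeff 1) hi
    rw [coeff_one_mul', h0, h1, i0, coeff_one, if_neg one_ne_zero, one_mul, mul_one] at this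
    exact eq_neg_of_add_eq_zero_left this
  have c0 : coeff 0 (ap (Algebra.TensorProduct.comm ℂ (U g) (U g)).toAlgHom F) = 1 := by
    rw [coeff_map, h0]; exact map_one (Algebra.TensorProduct.comm ℂ (U g) (U g))
  have c1 : coeff 1 (ap (Algebra.TensorProduct.comm ℂ (U g) (U g)).toAlgHom F) =
      inc2 (TensorProduct.comm ℂ g g f) := by
    rw [coeff_map, h1]; exact comm_inc2 f
  constructor
  · rw [rMatrix, coeff_zero_mul', c0, i0, one_mul]
  · rw [rMatrix, coeff_one_mul', c0, c1, i0, i1, map_sub]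
    simp [add_comm, sub_eq_add_neg]

theorem comulLeft_inc2 (f : g ⊗[ℂ] g) :
    comulLeft g (inc2 f) = leg13 g (inc2 f) + leg23 g (inc2 f) := by
  induction f using TensorProduct.induction_on with
  | zero => simp
  | add x y hx hy => simp only [map_add, hx, hy]; abel
  | tmul x y =>
    have : comul g (inc x) = inc x ⊗ₜ 1 + 1 ⊗ₜ inc x := by
      rw [comul]; exact UniversalEnvelopingAlgebra.lift_ι_apply _ _ _
    simp [inc2, comulLeft, leg13, leg23, this, TensorProduct.add_tmul]

theorem comulRight_inc2 (f : g ⊗[ℂ] g) :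
    comulRight g (inc2 f) = leg12 g (inc2 f) + leg13 g (inc2 f) := by
  induction f using TensorProduct.induction_on with
  | zero => simp
  | add x y hx hy => simp only [map_add, hx, hy]; abel
  | tmul x y =>
    have : comul g (inc y) = inc y ⊗ₜ 1 + 1 ⊗ₜ inc y := by
      rw [comul]; exact UniversalEnvelopingAlgebra.lift_ι_apply _ _ _
    simp [inc2, comulRight, leg13, leg12, this, TensorProduct.tmul_add]

/-! ### The symmetric group on the tensor cube. -/

variable (g) in
/-- `a ⊗ b ↦ b ⊗ a`. -/
def flip : U2 g →ₐ[ℂ] U2 g := (Algebra.TensorProduct.comm ℂ (U g) (U g)).toAlgHom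

variable (g) in
/-- `a ⊗ b ⊗ c ↦ b ⊗ a ⊗ c`. -/
def swap12 : U3 g →ₐ[ℂ] U3 g :=
  (Algebra.TensorProduct.leftComm ℂ (U g) (U g) (U g)).toAlgHom

variable (g) in
/-- `a ⊗ b ⊗ c ↦ a ⊗ c ⊗ b`. -/
def swap23 : U3 g →ₐ[ℂ] U3 g := Algebra.TensorProduct.map (AlgHom.id ℂ (U g)) (flip g)

@[simp] theorem flip_tmul (a b : U g) : flip g (a ⊗ₜ b) = b ⊗ₜ a := rfl

/-- Cocommutativity, checked on the generators. It makes the `Δ`-terms of second order drop out of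
the alternating sum in `isCYBE_of_isTwist`. -/
theorem flip_comul (x : U g) : flip g (comul g x) = comul g x := by
  have : (flip g).comp (comul g) = comul g := by
    refine UniversalEnvelopingAlgebra.hom_ext (R := ℂ) (L := g) ?_
    ext x
    have : comul g (UniversalEnvelopingAlgebra.ι ℂ x) = inc x ⊗ₜ 1 + 1 ⊗ₜ inc x := by
      rw [comul]; exact UniversalEnvelopingAlgebra.lift_ι_apply _ _ _
    change flip g (comul g (UniversalEnvelopingAlgebra.ι ℂ x)) =
      comul g (UniversalEnvelopingAlgebra.ι ℂ x)
    rw [this, map_add, flip_tmul, flip_tmul, add_comm]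
  exact DFunLike.congr_fun this x

theorem eq_of_eq_on_tmul {A B : Type} [AddCommGroup A] [Module ℂ A] [AddCommGroup B] [Module ℂ B]
    {C : Type} [AddCommGroup C] [Module ℂ C] {F G : A ⊗[ℂ] B →ₗ[ℂ] C}
    (h : ∀ a b, F (a ⊗ₜ b) = G (a ⊗ₜ b)) (x : A ⊗[ℂ] B) : F x = G x :=
  DFunLike.congr_fun (TensorProduct.ext' h) x

theorem swap12_comulLeft (x : U2 g) : swap12 g (comulLeft g x) = comulLeft g x := by
  refine eq_of_eq_on_tmul (F := ((swap12 g).comp (comulLeft g)).toLinearMap)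
    (G := (comulLeft g).toLinearMap) (fun a b => ?_) x
  change swap12 g (Algebra.TensorProduct.assoc ℂ ℂ ℂ (U g) (U g) (U g) (comul g a ⊗ₜ b)) =
    Algebra.TensorProduct.assoc ℂ ℂ ℂ (U g) (U g) (U g) (comul g a ⊗ₜ b)
  conv_rhs => rw [← flip_comul]
  generalize comul g a = y
  induction y using TensorProduct.induction_on with
  | zero => simp
  | add u v hu hv => simp only [map_add, TensorProduct.add_tmul, hu, hv]
  | tmul u v => rfl

theorem swap23_comulRight (x : U2 g) : swap23 g (comulRight g x) = comulRight g x := by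
  refine eq_of_eq_on_tmul (F := ((swap23 g).comp (comulRight g)).toLinearMap)
    (G := (comulRight g).toLinearMap) (fun a b => ?_) x
  change a ⊗ₜ flip g (comul g b) = a ⊗ₜ comul g b
  rw [flip_comul]

theorem swap_braid (x : U3 g) :
    swap12 g (swap23 g (swap12 g x)) = swap23 g (swap12 g (swap23 g x)) := by
  induction x using TensorProduct.induction_on with
  | zero => simp
  | add u v hu hv => simp only [map_add, hu, hv]
  | tmul a y =>
    induction y using TensorProduct.induction_on with
    | zero => simp
    | add u v hu hv => simp only [map_add, TensorProduct.tmul_add, hu, hv]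
    | tmul u v => rfl

theorem swap12_leg12 (x : U2 g) : swap12 g (leg12 g x) = leg12 g (flip g x) :=
  eq_of_eq_on_tmul (F := ((swap12 g).comp (leg12 g)).toLinearMap)
    (G := ((leg12 g).comp (flip g)).toLinearMap) (fun _ _ => rfl) x

theorem swap12_leg13 (x : U2 g) : swap12 g (leg13 g x) = leg23 g x :=
  eq_of_eq_on_tmul (F := ((swap12 g).comp (leg13 g)).toLinearMap)
    (G := (leg23 g).toLinearMap) (fun _ _ => rfl) x

theorem swap12_leg23 (x : U2 g) : swap12 g (leg23 g x) = leg13 g x :=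
  eq_of_eq_on_tmul (F := ((swap12 g).comp (leg23 g)).toLinearMap)
    (G := (leg13 g).toLinearMap) (fun _ _ => rfl) x

theorem swap23_leg12 (x : U2 g) : swap23 g (leg12 g x) = leg13 g x :=
  eq_of_eq_on_tmul (F := ((swap23 g).comp (leg12 g)).toLinearMap)
    (G := (leg13 g).toLinearMap) (fun _ _ => rfl) x

theorem swap23_leg13 (x : U2 g) : swap23 g (leg13 g x) = leg12 g x :=
  eq_of_eq_on_tmul (F := ((swap23 g).comp (leg13 g)).toLinearMap)
    (G := (leg12 g).toLinearMap) (fun _ _ => rfl) x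

theorem swap23_leg23 (x : U2 g) : swap23 g (leg23 g x) = leg23 g (flip g x) :=
  eq_of_eq_on_tmul (F := ((swap23 g).comp (leg23 g)).toLinearMap)
    (G := ((leg23 g).comp (flip g)).toLinearMap) (fun _ _ => rfl) x

/-- The classical Yang-Baxter equation, as the antisymmetrization of the second-order part of the
twist equation. -/
theorem isCYBE_of_isTwist {F : PowerSeries (U2 g)} {f : g ⊗[ℂ] g} (hF : IsTwist F)
    (h0 : coeff 0 F = 1) (h1 : coeff 1 F = inc2 f) :
    IsCYBE (f - TensorProduct.comm ℂ g g f) := by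
  have e := congrArg (coeff 2) hF.2.1
  have k0 : ∀ G : U2 g →ₐ[ℂ] U3 g, coeff 0 (ap G F) = 1 := fun G => by
    rw [coeff_map, h0]; exact map_one G
  have k1 : ∀ G : U2 g →ₐ[ℂ] U3 g, coeff 1 (ap G F) = G (inc2 f) := fun G => by
    rw [coeff_map, h1]; rfl
  have k2 : ∀ G : U2 g →ₐ[ℂ] U3 g, coeff 2 (ap G F) = G (coeff 2 F) := fun G => by
    rw [coeff_map]; rfl
  rw [coeff_two_mul, coeff_two_mul, k0, k0, k0, k0, k1, k1, k1, k1, k2, k2, k2, k2,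
    comulLeft_inc2, comulRight_inc2, one_mul, mul_one, one_mul, mul_one] at e
  -- The five nontrivial permutations of the `ξ²` equation are formed, to be added with signs.
  have es := congrArg (swap12 g) e
  have et := congrArg (swap23 g) e
  have est := congrArg (swap12 g) et
  have ets := congrArg (swap23 g) es
  have etst := congrArg (swap23 g) est
  -- The braid relation identifies the two words in the swaps that reach the same copy of `(Δ ⊗
  -- id)F₂`; otherwise these terms would not visibly cancel.
  have hb := swap_braid (comulLeft g (coeff 2 F))
  rw [swap12_comulLeft] at hb
  simp only [map_add, map_mul, swap12_leg12, swap12_leg13, swap12_leg23, swap23_leg12,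
    swap23_leg13, swap23_leg23, swap12_comulLeft, swap23_comulRight, ← hb]
    at es et est ets etst
  have hflip : inc2 (TensorProduct.comm ℂ g g f) = flip g (inc2 f) := (comm_inc2 f).symm
  rw [IsCYBE, map_sub, hflip]
  simp only [map_sub, LieRing.of_associative_ring_bracket]
  -- The `Δ`-terms cancel by cocommutativity. The terms `F₂` on legs `12` and on legs `23` cancel
  -- because a cyclic, hence even, permutation relates them. Only products of two copies of `f`
  -- remain.
  linear_combination (norm := skip) e - es - et + est + ets - etst
  simp only [mul_add, mul_sub, sub_mul]
  abel

end Classical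

/-! ### The classical limit of the chain -/

section Limit

variable {N : ℕ} (η κ : Fin N → ℂ)

/-- All corrections carry a factor `ξ`, so the classical limit sees only the undeformed root
vectors. -/
theorem coeff_zero_eIter (m : ℕ) (a b : Fin N) :
    coeff 0 (eIter η κ m a b) = inc (ePlus a b) := by
  induction m with
  | zero => rw [eIter, coeff_zero_C]
  | succ m ih =>
    rw [eIter]
    split_ifs
    · rw [map_sub, ih, coeff_zero_mul', coeff_zero_X, zero_mul, sub_zero]
    · exact ih

theorem coeff_one_sigma (k : Fin N) : coeff 1 (sigma η κ k) = η k • inc (ePlus k k) := by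
  rw [sigma, logOne, coeff_one_log1p, coeff_succ_X_mul, coeff_smul, coeff_zero_eIter]

theorem constantCoeff_sigma (k : Fin N) : constantCoeff (sigma η κ k) = 0 :=
  constantCoeff_logOne _ _

theorem coeff_zero_link (k : Fin N) : coeff 0 (linkData η κ k).L = 1 := by
  rw [LinkData.L, LinkData.J, coeff_zero_mul', coeff_zero_expS, coeff_zero_expS, one_mul]

/-- The first-order part of the `k`-th link. -/
def linkTensor (k : Fin N) : spN N ⊗[ℂ] spN N :=
  η k • (hh k ⊗ₜ ePlus k k + κ k • ∑ i ∈ Finset.univ.filter (fun i : Fin N => k < i),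
    eMinus k i ⊗ₜ ePlus k i)

theorem coeff_one_link {k : Fin N} (hκ : κ k = 0 ∨ κ k = 1) :
    coeff 1 (linkData η κ k).L = inc2 (linkTensor η κ k) := by
  set D := linkData η κ k with hD
  have h1 : coeff 1 (tens D.h D.σ) = η k • inc2 (hh k ⊗ₜ ePlus k k) := by
    rw [coeff_one_tens D.const_σ, hD, linkData_σ, coeff_one_sigma, TensorProduct.tmul_smul]
    congr 1
    change coeff 0 (C (inc (hh k))) ⊗ₜ _ = _
    rw [coeff_zero_C]
    rfl
  have h2 : ∀ i, coeff 1 (tens (D.a i) (D.β i)) = η k • inc2 (eMinus k i ⊗ₜ ePlus k i) := by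
    intro i
    have ha : coeff 0 (D.a i) = η k • inc (eMinus k i) := by
      change coeff 0 (η k • gl k i) = _
      rw [coeff_smul, gl, coeff_zero_C]
    have hβ : coeff 1 (D.β i) = inc (ePlus k i) := by
      change coeff 1 (X * eIter η κ k.val k i * expS _) = _
      rw [mul_assoc, coeff_succ_X_mul, coeff_zero_mul', coeff_zero_expS, mul_one, coeff_zero_eIter]
    rw [coeff_one_tens (D.const_β i), ha, hβ, ← TensorProduct.smul_tmul']
    rfl
  have h3 : coeff 1 D.T = (η k * κ k) • ∑ i ∈ Finset.univ.filter (fun i : Fin N => k < i),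
      inc2 (eMinus k i ⊗ₜ ePlus k i) := by
    rw [LinkData.T, map_sum, Finset.sum_congr rfl fun i _ => h2 i, ← Finset.smul_sum]
    rcases hκ with h | h
    · have : D.idx = ∅ := Finset.eq_empty_of_forall_notMem fun l hl =>
        ((mem_linkData_idx η κ).mp hl).1 h
      rw [this, h]; simp
    · have : D.idx = Finset.univ.filter (fun i : Fin N => k < i) := by
        ext l
        rw [mem_linkData_idx]
        simp [h]
      rw [this, h, mul_one]
  rw [LinkData.L, LinkData.J, coeff_one_mul', coeff_zero_expS, coeff_zero_expS, coeff_one_expS,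
    coeff_one_expS, h1, h3, linkTensor, map_smul, map_add, map_smul, map_sum, one_mul, mul_one]
  module

/-- The first-order part of the chain. -/
def chainTensor (p : ℕ) : spN N ⊗[ℂ] spN N := ∑ k ∈ links N p, linkTensor η κ k

theorem links_succ {p : ℕ} (h : p < N) : links N (p + 1) = insert ⟨p, h⟩ (links N p) := by
  ext k
  simp only [links, Finset.mem_filter, Finset.mem_univ, true_and, Finset.mem_insert, Fin.ext_iff]
  omega

theorem coeff_chain (hκ : ∀ k, κ k = 0 ∨ κ k = 1) {p : ℕ} (hp : p ≤ N) :
    coeff 0 (chain η κ p) = 1 ∧ coeff 1 (chain η κ p) = inc2 (chainTensor η κ p) := by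
  induction p with
  | zero => simp [chain, chainTensor, links, coeff_one]
  | succ p ih =>
    obtain ⟨i0, i1⟩ := ih (by omega)
    rw [chain_succ η κ hp hκ]
    constructor
    · rw [coeff_zero_mul', coeff_zero_link, i0, one_mul]
    · rw [coeff_one_mul', coeff_zero_link, i0, i1, coeff_one_link η κ (hκ _), one_mul, mul_one,
        chainTensor, chainTensor, links_succ hp, Finset.sum_insert (by simp [links]), map_add,
        add_comm]

theorem chainTensor_sub_comm (p : ℕ) : chainTensor η κ p -
    TensorProduct.comm ℂ (spN N) (spN N) (chainTensor η κ p) = rCl p η κ := by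
  rw [chainTensor, map_sum, ← Finset.sum_sub_distrib, rCl]
  refine Finset.sum_congr rfl fun k _ => ?_
  simp only [linkTensor, map_smul, map_add, map_sum, TensorProduct.comm_tmul, wedge,
    Finset.sum_sub_distrib]
  module

/-- The first-order part of `Φ_R`. -/
def phiTensor (p : ℕ) (c : Fin N → Fin N → PowerSeries ℂ) : spN N ⊗[ℂ] spN N :=
  ∑ i ∈ links N p, ∑ j ∈ links N p,
    (constantCoeff (c i j) * (η i * η j)) • (ePlus i i ⊗ₜ ePlus j j)

theorem phiR_eq (p : ℕ) (c : Fin N → Fin N → PowerSeries ℂ) :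
    phiR p η κ c = expS (abelianExponent (links N p) (sigma η κ) c) := rfl

theorem coeff_phiR (p : ℕ) (c : Fin N → Fin N → PowerSeries ℂ) :
    coeff 0 (phiR p η κ c) = 1 ∧ coeff 1 (phiR p η κ c) = inc2 (phiTensor η p c) := by
  rw [phiR_eq]
  refine ⟨coeff_zero_expS, ?_⟩
  rw [coeff_one_expS, coeff_one_abelianExponent c fun i _ => constantCoeff_sigma η κ i, phiTensor,
    map_sum]
  refine Finset.sum_congr rfl fun i _ => ?_
  rw [map_sum]
  refine Finset.sum_congr rfl fun j _ => ?_
  rw [coeff_one_sigma, coeff_one_sigma, map_smul, TensorProduct.smul_tmul_smul, smul_smul]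
  rfl

theorem sum_links_eq_sum_pairs {M : Type} [AddCommGroup M] (p : ℕ) {G : Fin N → Fin N → M}
    (h0 : ∀ i, G i i = 0) : ∑ i ∈ links N p, ∑ j ∈ links N p, G i j =
      ∑ q ∈ pairs N p, (G q.1 q.2 + G q.2 q.1) := by
  have hs : ∑ q ∈ pairs N p, G q.2 q.1 =
      ∑ q ∈ (links N p ×ˢ links N p).filter (fun q => q.2 < q.1), G q.1 q.2 := by
    refine Finset.sum_bij' (fun q _ => q.swap) (fun q _ => q.swap) ?_ ?_ ?_ ?_ ?_
    · intro q hq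
      simp only [pairs, links, Finset.mem_filter, Finset.mem_univ, true_and, Finset.mem_product,
        Prod.fst_swap, Prod.snd_swap] at hq ⊢
      have := Fin.lt_def.mp hq.1
      exact ⟨⟨hq.2, by omega⟩, hq.1⟩
    · intro q hq
      simp only [pairs, links, Finset.mem_filter, Finset.mem_univ, true_and, Finset.mem_product,
        Prod.fst_swap, Prod.snd_swap] at hq ⊢
      exact ⟨hq.2, hq.1.1⟩
    · intro q _; exact Prod.swap_swap q
    · intro q _; exact Prod.swap_swap q
    · intro q _; rfl
  have hp : pairs N p = (links N p ×ˢ links N p).filter (fun q => q.1 < q.2) := by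
    ext q
    simp only [pairs, links, Finset.mem_filter, Finset.mem_univ, true_and, Finset.mem_product]
    constructor
    · intro hq
      have := Fin.lt_def.mp hq.1
      exact ⟨⟨by omega, hq.2⟩, hq.1⟩
    · intro hq; exact ⟨hq.2, hq.1.2⟩
  rw [Finset.sum_add_distrib, hs, hp, ← Finset.sum_product',
    ← Finset.sum_filter_add_sum_filter_not _ (fun q : Fin N × Fin N => q.1 < q.2)]
  congr 1
  symm
  refine Finset.sum_subset ?_ ?_
  · intro q hq
    rw [Finset.mem_filter] at hq ⊢
    exact ⟨hq.1, not_lt.mpr hq.2.le⟩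
  · intro q hq hq'
    rw [Finset.mem_filter] at hq hq'
    have : q.1 = q.2 := le_antisymm (not_lt.mp fun h => hq' ⟨hq.1, h⟩) (not_lt.mp hq.2)
    rw [this, h0]

/-- Antisymmetrization kills the diagonal and merges `(i, k)` with `(k, i)`, so only `c_{ik} -
c_{ki}` matters. -/
theorem phiTensor_sub_comm (p : ℕ) (c : Fin N → Fin N → PowerSeries ℂ) : phiTensor η p c -
    TensorProduct.comm ℂ (spN N) (spN N) (phiTensor η p c) =
      ∑ q ∈ pairs N p, ((constantCoeff (c q.1 q.2) - constantCoeff (c q.2 q.1)) *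
        (η q.1 * η q.2)) • wedge (ePlus q.1 q.1) (ePlus q.2 q.2) := by
  have h : phiTensor η p c - TensorProduct.comm ℂ (spN N) (spN N) (phiTensor η p c) =
      ∑ i ∈ links N p, ∑ j ∈ links N p, (constantCoeff (c i j) * (η i * η j)) •
        wedge (ePlus i i) (ePlus j j) := by
    simp only [phiTensor, map_sum, ← Finset.sum_sub_distrib, map_smul, TensorProduct.comm_tmul,
      ← smul_sub, wedge]
  rw [h, sum_links_eq_sum_pairs p fun i => by rw [wedge, sub_self, smul_zero]]
  refine Finset.sum_congr rfl fun q _ => ?_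
  simp only [wedge]
  module

theorem rCl_add_eq_rHat (p : ℕ) (c : Fin N → Fin N → PowerSeries ℂ) :
    (chainTensor η κ p + phiTensor η p c) -
      TensorProduct.comm ℂ (spN N) (spN N) (chainTensor η κ p + phiTensor η p c) =
    rHat p η κ fun i k => (constantCoeff (c i k) - constantCoeff (c k i)) * (η i * η k) := by
  rw [map_add, add_sub_add_comm, chainTensor_sub_comm, phiTensor_sub_comm, rHat]

theorem coeff_phiR_mul_chain (hκ : ∀ k, κ k = 0 ∨ κ k = 1) {p : ℕ} (hp : p ≤ N)
    (c : Fin N → Fin N → PowerSeries ℂ) : coeff 0 (phiR p η κ c * chain η κ p) = 1 ∧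
      coeff 1 (phiR p η κ c * chain η κ p) = inc2 (chainTensor η κ p + phiTensor η p c) := by
  obtain ⟨h0, h1⟩ := coeff_chain η κ hκ hp
  obtain ⟨k0, k1⟩ := coeff_phiR η κ p c
  constructor
  · rw [coeff_zero_mul', h0, k0, one_mul]
  · rw [coeff_one_mul', h0, h1, k0, k1, one_mul, mul_one, map_add]

theorem quantum_side {p : ℕ} (hp : p ≤ N) (hκ : ∀ k, κ k = 0 ∨ κ k = 1) :
    IsTwist (chain η κ p) ∧ HasClassicalLimit (chain η κ p) (rCl p η κ) ∧
    IsCYBE (rCl p η κ) ∧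
    (∀ k ∈ links N p, twistedComul (chain η κ p) (sigma η κ k) =
      tens (sigma η κ k) 1 + tens 1 (sigma η κ k)) ∧
    (∀ i ∈ links N p, ∀ k ∈ links N p, Commute (sigma η κ i) (sigma η κ k)) ∧
    ∀ c : Fin N → Fin N → PowerSeries ℂ,
      IsTwistOver (chain η κ p) (phiR p η κ c) ∧
      IsTwist (phiR p η κ c * chain η κ p) ∧
      HasClassicalLimit (phiR p η κ c * chain η κ p) (rHat p η κ fun i k =>
        (constantCoeff (c i k) - constantCoeff (c k i)) * (η i * η k)) ∧
      IsCYBE (rHat p η κ fun i k =>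
        (constantCoeff (c i k) - constantCoeff (c k i)) * (η i * η k)) := by
  have I := chainInvariant (η := η) hκ hp
  have hprim : ∀ k ∈ links N p, IsPrim (chain η κ p) (sigma η κ k) := fun k hk =>
    I.isPrim_sigma k (Finset.mem_filter.mp hk).2
  obtain ⟨h0, h1⟩ := coeff_chain η κ hκ hp
  refine ⟨I.isTwist, ?_, ?_, fun k hk => (isPrim_iff_twistedComul I.isTwist.1 _).mp (hprim k hk),
    fun i _ k _ => commute_sigma η κ i k, fun c => ?_⟩
  · rw [← chainTensor_sub_comm]
    exact hasClassicalLimit_of_coeff I.isTwist.1 h0 h1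
  · rw [← chainTensor_sub_comm]
    exact isCYBE_of_isTwist I.isTwist h0 h1
  · obtain ⟨t1, t2⟩ := abelian_isTwist c (fun i _ => constantCoeff_sigma η κ i) hprim
      (fun i _ k _ => commute_sigma η κ i k) I.isTwist fun i _ => ap_counit_sigma η κ i
    rw [← phiR_eq] at t1 t2
    obtain ⟨k0, k1⟩ := coeff_phiR_mul_chain η κ hκ hp c
    rw [← rCl_add_eq_rHat]
    exact ⟨t1, t2, hasClassicalLimit_of_coeff t2.1 k0 k1, isCYBE_of_isTwist t2 k0 k1⟩

end Limit

/-! ### Cocycles -/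

section Cocycles

variable {l : Type} [LieRing l] [LieAlgebra ℂ l]

theorem cobForm_apply (f : Module.Dual ℂ l) (x y : l) : cobForm f x y = f ⁅x, y⁆ := rfl

theorem wedgeForm_apply (f g : Module.Dual ℂ l) (x y : l) :
    wedgeForm f g x y = f x * g y - g x * f y := rfl

theorem IsTwoCocycle.cobForm (f : Module.Dual ℂ l) : IsTwoCocycle (cobForm f) := by
  refine ⟨fun x => by rw [cobForm_apply, lie_self, map_zero], fun x y z => ?_⟩
  rw [cobForm_apply, cobForm_apply, cobForm_apply, ← map_add, ← map_add]
  rw [← lie_skew ⁅x, y⁆ z, ← lie_skew ⁅z, x⁆ y, ← lie_skew ⁅y, z⁆ x, ← neg_add, ← neg_add,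
    show ⁅z, ⁅x, y⁆⁆ + ⁅y, ⁅z, x⁆⁆ + ⁅x, ⁅y, z⁆⁆ = 0 by rw [← lie_jacobi x y z]; abel,
    neg_zero, map_zero]

/-- Functionals that vanish on brackets are 1-cocycles, and every term of the cyclic sum contains
one of them on a bracket. -/
theorem IsTwoCocycle.wedgeForm {f g : Module.Dual ℂ l} (hf : ∀ x y : l, f ⁅x, y⁆ = 0)
    (hg : ∀ x y : l, g ⁅x, y⁆ = 0) : IsTwoCocycle (wedgeForm f g) := by
  refine ⟨fun x => by rw [wedgeForm_apply]; ring, fun x y z => ?_⟩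
  simp only [wedgeForm_apply, hf, hg]
  ring

theorem IsTwoCocycle.add {a b : LinearMap.BilinForm ℂ l} (ha : IsTwoCocycle a)
    (hb : IsTwoCocycle b) : IsTwoCocycle (a + b) := by
  refine ⟨fun x => ?_, fun x y z => ?_⟩
  · rw [LinearMap.add_apply, LinearMap.add_apply, ha.1, hb.1, add_zero]
  · simp only [LinearMap.add_apply]
    linear_combination ha.2 x y z + hb.2 x y z

theorem IsTwoCocycle.smul {a : LinearMap.BilinForm ℂ l} (c : ℂ) (ha : IsTwoCocycle a) :
    IsTwoCocycle (c • a) := by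
  refine ⟨fun x => ?_, fun x y z => ?_⟩
  · rw [LinearMap.smul_apply, LinearMap.smul_apply, ha.1, smul_zero]
  · simp only [LinearMap.smul_apply, smul_eq_mul]
    linear_combination c * ha.2 x y z

theorem IsTwoCocycle.sum {ι : Type} (s : Finset ι) {b : ι → LinearMap.BilinForm ℂ l}
    (h : ∀ i ∈ s, IsTwoCocycle (b i)) : IsTwoCocycle (∑ i ∈ s, b i) :=
  Finset.sum_induction _ _ (fun _ _ => IsTwoCocycle.add)
    ⟨fun _ => rfl, fun _ _ _ => by simp⟩ h

theorem cobForm_sum {ι : Type} (s : Finset ι) (c : ι → ℂ) (f : ι → Module.Dual ℂ l) :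
    ∑ i ∈ s, c i • cobForm (f i) = cobForm (∑ i ∈ s, c i • f i) := by
  ext x y
  simp [cobForm_apply]

end Cocycles

/-! ### Contractions -/

section Contraction

variable {V : Type} [AddCommGroup V] [Module ℂ V]

theorem contract_wedge (a b : V) (f : Module.Dual ℂ V) :
    contract (wedge a b) f = f b • a - f a • b := by
  simp [contract, wedge]

theorem contract_add (s t : V ⊗[ℂ] V) (f : Module.Dual ℂ V) :
    contract (s + t) f = contract s f + contract t f := by
  simp [contract]

theorem contract_smul (c : ℂ) (t : V ⊗[ℂ] V) (f : Module.Dual ℂ V) :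
    contract (c • t) f = c • contract t f := by
  simp [contract]

theorem contract_sum {ι : Type} (s : Finset ι) (t : ι → V ⊗[ℂ] V) (f : Module.Dual ℂ V) :
    contract (∑ i ∈ s, t i) f = ∑ i ∈ s, contract (t i) f := by
  simp [contract]

/-- The contribution of one link to the contraction, in terms of the values of `f` on its
generators. `W` stands for the part of `f h` that comes from the `H* ∧ H*` terms; it survives as a
multiple of `e`. -/
theorem contract_link {ι : Type} (s : Finset ι) (f : Module.Dual ℂ V) (h e : V) (m n : ι → V)
    (a b W : ℂ) (c d : ι → ℂ) {γ : ℂ} (hγ : γ ≠ 0) (he : f e = γ * a) (hh : f h = -(γ * b) + W)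
    (hn : ∀ i ∈ s, f (n i) = γ * c i) (hm : ∀ i ∈ s, f (m i) = -(γ * d i)) :
    contract ((1 / γ) • (wedge h e + ∑ i ∈ s, wedge (m i) (n i))) f =
      ((a • h + b • e) + ∑ i ∈ s, (c i • m i + d i • n i)) - (1 / γ * W) • e := by
  have hi : ∀ i ∈ s, (1 / γ) • contract (wedge (m i) (n i)) f = c i • m i + d i • n i := by
    intro i hi
    rw [contract_wedge, hn i hi, hm i hi]
    match_scalars <;> field_simp
  rw [contract_smul, contract_add, contract_sum, smul_add, Finset.smul_sum,
    Finset.sum_congr rfl hi, contract_wedge, he, hh]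
  match_scalars <;> field_simp
  ring

theorem map_wedge {W : Type} [AddCommGroup W] [Module ℂ W] (φ : V →ₗ[ℂ] W) (a b : V) :
    TensorProduct.map φ φ (wedge a b) = wedge (φ a) (φ b) := by
  simp [wedge]

/-- In finite dimension a one-sided inverse of a form is two-sided. -/
theorem apply_contract_of_contract_apply [FiniteDimensional ℂ V] {b : LinearMap.BilinForm ℂ V}
    {t : V ⊗[ℂ] V} (h : ∀ x, contract t (b x) = x) (f : Module.Dual ℂ V) :
    b (contract t f) = f := by
  have hinj : Function.Injective b := fun x y hxy => by rw [← h x, ← h y, hxy]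
  obtain ⟨x, rfl⟩ := (LinearMap.injective_iff_surjective_of_finrank_eq_finrank
    (Subspace.dual_finrank_eq (K := ℂ) (V := V)).symm).mp hinj f
  rw [h]

/-- A left inverse gives a trivial left kernel; an alternating form is skew, so its right kernel is
the same. -/
theorem nondegenerate_of_inverse {l : Type} [LieRing l] [LieAlgebra ℂ l]
    {L : LieSubalgebra ℂ l} {b : LinearMap.BilinForm ℂ L} {r : l ⊗[ℂ] l}
    (hb : ∀ x, b x x = 0) (h : IsInverseOf L b r) : b.Nondegenerate := by
  obtain ⟨t, -, ht, -⟩ := h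
  have hl : ∀ x, (∀ y, b x y = 0) → x = 0 := by
    intro x hx
    rw [← ht x, show b x = 0 from LinearMap.ext hx]
    simp [contract]
  refine ⟨hl, fun y hy => hl y fun x => ?_⟩
  have h1 := hb (x + y)
  rw [map_add, map_add, LinearMap.add_apply, LinearMap.add_apply, hb, hb, hy] at h1
  simpa using h1

end Contraction

/-! ### The carrier algebra -/

section Carrier

variable {N : ℕ}

/-! ### Block structure of symplectic matrices and the shape of the carrier. -/

theorem spN_apply (x : spN N) (i j : Fin N) :
    x.1 (Sum.inr i) (Sum.inr j) = -x.1 (Sum.inl j) (Sum.inl i) ∧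
      x.1 (Sum.inl i) (Sum.inr j) = x.1 (Sum.inl j) (Sum.inr i) := by
  have h := (mem_skewAdjointMatricesSubmodule (Matrix.J (Fin N) ℂ) _).mp x.2
  rw [Matrix.IsSkewAdjoint, Matrix.IsAdjointPair, ← Matrix.fromBlocks_toBlocks x.1,
    Matrix.fromBlocks_transpose, Matrix.fromBlocks_neg, Matrix.J,
    Matrix.fromBlocks_multiply, Matrix.fromBlocks_multiply, Matrix.fromBlocks_inj] at h
  obtain ⟨-, h1, -, h2⟩ := h
  have h1 := congrFun (congrFun h1 i) j
  have h2 := congrFun (congrFun h2 j) i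
  simp only [Matrix.toBlocks₁₁, Matrix.toBlocks₁₂, Matrix.toBlocks₂₂, mul_neg, mul_one, mul_zero,
    zero_mul, neg_mul, one_mul, neg_neg, add_zero, zero_add, neg_zero, Matrix.neg_apply,
    Matrix.transpose_apply, Matrix.of_apply, neg_inj] at h1 h2
  exact ⟨h1.symm, h2⟩

/-- In blocks `[A, B; C, D]` one has `D = -Aᵀ` and `B` symmetric, so the two halves of the matrix
product contribute equally and the factor `1/2` disappears. -/
theorem ePlusDual_lie (x y : spN N) (m : Fin N) : ePlusDual m ⁅x, y⁆ =
    ∑ l, (x.1 (Sum.inl m) (Sum.inl l) * y.1 (Sum.inl l) (Sum.inr m) -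
      y.1 (Sum.inl m) (Sum.inl l) * x.1 (Sum.inl l) (Sum.inr m)) := by
  change (1 / 2 : ℂ) * (x.1 * y.1 - y.1 * x.1) (Sum.inl m) (Sum.inr m) = _
  rw [Matrix.sub_apply, Matrix.mul_apply, Matrix.mul_apply, Fintype.sum_sum_type,
    Fintype.sum_sum_type, add_sub_add_comm, ← Finset.sum_sub_distrib, ← Finset.sum_sub_distrib,
    ← Finset.sum_add_distrib, Finset.mul_sum]
  refine Finset.sum_congr rfl fun l _ => ?_
  rw [(spN_apply x l m).1, (spN_apply y l m).1, (spN_apply x m l).2, (spN_apply y m l).2]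
  ring

/-- Matrices `[A, B; 0, D]` with `A` upper triangular, such that the rows of `A` from the `p`-th on
and the corresponding block of `B` vanish. -/
structure Shape (p : ℕ) (M : Matrix (Fin N ⊕ Fin N) (Fin N ⊕ Fin N) ℂ) : Prop where
  lower (i j : Fin N) : M (Sum.inr i) (Sum.inl j) = 0
  triangular (i j : Fin N) (h : j < i) : M (Sum.inl i) (Sum.inl j) = 0
  row (i j : Fin N) (h : p ≤ i.val) : M (Sum.inl i) (Sum.inl j) = 0
  block (i j : Fin N) (hi : p ≤ i.val) (hj : p ≤ j.val) : M (Sum.inl i) (Sum.inr j) = 0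

/-- The shape is preserved already by the associative product. For the vanishing block one needs `y`
symplectic: its lower right block is minus the transpose of the upper left one, whose late rows are
zero. -/
theorem Shape.mul {p : ℕ} {x y : spN N} (hx : Shape p x.1) (hy : Shape p y.1) :
    Shape p (x.1 * y.1) := by
  constructor
  · intro i j
    rw [Matrix.mul_apply, Fintype.sum_sum_type]
    simp [hx.lower, hy.lower]
  · intro i j h
    rw [Matrix.mul_apply, Fintype.sum_sum_type]
    simp only [hy.lower, mul_zero, Finset.sum_const_zero, add_zero]
    refine Finset.sum_eq_zero fun l _ => ?_
    rcases lt_or_ge l i with hl | hl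
    · rw [hx.triangular i l hl, zero_mul]
    · rw [hy.triangular l j (h.trans_le hl), mul_zero]
  · intro i j h
    rw [Matrix.mul_apply, Fintype.sum_sum_type]
    simp [hy.lower, hx.row i _ h]
  · intro i j hi hj
    rw [Matrix.mul_apply, Fintype.sum_sum_type]
    simp [hx.row i _ hi, (spN_apply y _ j).1, hy.row j _ hj]

theorem Shape.add {p : ℕ} {x y : Matrix (Fin N ⊕ Fin N) (Fin N ⊕ Fin N) ℂ} (hx : Shape p x)
    (hy : Shape p y) : Shape p (x + y) where
  lower i j := by rw [Matrix.add_apply, hx.lower, hy.lower, add_zero]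
  triangular i j h := by rw [Matrix.add_apply, hx.triangular i j h, hy.triangular i j h, add_zero]
  row i j h := by rw [Matrix.add_apply, hx.row i j h, hy.row i j h, add_zero]
  block i j hi hj := by
    rw [Matrix.add_apply, hx.block i j hi hj, hy.block i j hi hj, add_zero]

theorem Shape.smul {p : ℕ} {x : Matrix (Fin N ⊕ Fin N) (Fin N ⊕ Fin N) ℂ} (c : ℂ)
    (hx : Shape p x) : Shape p (c • x) where
  lower i j := by rw [Matrix.smul_apply, hx.lower, smul_zero]
  triangular i j h := by rw [Matrix.smul_apply, hx.triangular i j h, smul_zero]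
  row i j h := by rw [Matrix.smul_apply, hx.row i j h, smul_zero]
  block i j hi hj := by rw [Matrix.smul_apply, hx.block i j hi hj, smul_zero]

variable (N) in
/-- The elements of `sp(N)` of the given shape. -/
def shapeSubalgebra (p : ℕ) : LieSubalgebra ℂ (spN N) where
  carrier := {x | Shape p x.1}
  zero_mem' := ⟨fun _ _ => rfl, fun _ _ _ => rfl, fun _ _ _ => rfl, fun _ _ _ _ => rfl⟩
  add_mem' hx hy := Shape.add hx hy
  smul_mem' c _ hx := Shape.smul c hx
  lie_mem' := by
    intro x y hx hy
    change Shape p (x.1 * y.1 - y.1 * x.1)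
    rw [sub_eq_add_neg, ← neg_one_smul ℂ (y.1 * x.1)]
    exact (Shape.mul hx hy).add ((Shape.mul hy hx).smul _)

theorem ePlusMat_apply (i j a b : Fin N) :
    ePlusMat i j (Sum.inl a) (Sum.inl b) = 0 ∧
    ePlusMat i j (Sum.inr a) (Sum.inl b) = 0 ∧
    ePlusMat i j (Sum.inl a) (Sum.inr b) =
      (if i = a ∧ j = b then 1 else 0) + (if j = a ∧ i = b then 1 else 0) := by
  simp [ePlusMat, Matrix.single_apply]

theorem eMinusMat_apply (i j a b : Fin N) :
    eMinusMat i j (Sum.inl a) (Sum.inl b) = (if i = a ∧ j = b then 1 else 0) ∧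
    eMinusMat i j (Sum.inr a) (Sum.inl b) = 0 ∧
    eMinusMat i j (Sum.inl a) (Sum.inr b) = 0 := by
  simp [eMinusMat, Matrix.single_apply]

/-- An upper bound for the generated subalgebra. Together with `eq_sum_of_mem_carrier` it shows that
the generators span the carrier linearly. -/
theorem carrier_le_shapeSubalgebra (p : ℕ) : carrier N p ≤ shapeSubalgebra N p := by
  have hm : ∀ k i : Fin N, k.val < p → k ≤ i → Shape p (eMinusMat k i) := by
    intro k i hk hi
    constructor
    · exact fun a b => (eMinusMat_apply k i a b).2.1
    · intro a b h
      rw [(eMinusMat_apply k i a b).1, if_neg]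
      rintro ⟨rfl, rfl⟩
      exact h.not_ge hi
    · intro a b h
      rw [(eMinusMat_apply k i a b).1, if_neg]
      rintro ⟨rfl, rfl⟩
      omega
    · exact fun a b _ _ => (eMinusMat_apply k i a b).2.2
  refine LieSubalgebra.lieSpan_le.mpr ?_
  rintro x ((⟨k, hk, rfl⟩ | ⟨k, i, hk, hi, rfl⟩) | ⟨k, i, hk, hi, rfl⟩)
  · exact (hm k k hk le_rfl).smul _
  · constructor
    · exact fun a b => (ePlusMat_apply k i a b).2.1
    · exact fun a b _ => (ePlusMat_apply k i a b).1
    · exact fun a b _ => (ePlusMat_apply k i a b).1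
    · intro a b ha hb
      change ePlusMat k i _ _ = 0
      rw [(ePlusMat_apply k i a b).2.2, if_neg, if_neg, add_zero]
      · rintro ⟨rfl, rfl⟩; omega
      · rintro ⟨rfl, rfl⟩; omega
  · exact hm k i hk hi.le

theorem shape_of_mem {p : ℕ} (x : carrier N p) : Shape p x.1.1 :=
  carrier_le_shapeSubalgebra p x.2

theorem hh_mem {p : ℕ} {k : Fin N} (hk : k ∈ links N p) : hh k ∈ carrier N p :=
  LieSubalgebra.subset_lieSpan (Or.inl (Or.inl ⟨k, (Finset.mem_filter.mp hk).2, rfl⟩))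

theorem ePlus_mem {p : ℕ} {k i : Fin N} (hk : k ∈ links N p) (hi : k ≤ i) :
    ePlus k i ∈ carrier N p :=
  LieSubalgebra.subset_lieSpan (Or.inl (Or.inr ⟨k, i, (Finset.mem_filter.mp hk).2, hi, rfl⟩))

theorem eMinus_mem {p : ℕ} {k i : Fin N} (hk : k ∈ links N p) (hi : k < i) :
    eMinus k i ∈ carrier N p :=
  LieSubalgebra.subset_lieSpan (Or.inr ⟨k, i, (Finset.mem_filter.mp hk).2, hi, rfl⟩)

/-- For triangular matrices the diagonal of a product is the product of the diagonals, so
commutators have zero diagonal. -/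
theorem hDual_lie {p : ℕ} (k : Fin N) (x y : carrier N p) : res p (hDual k) ⁅x, y⁆ = 0 := by
  change (2 : ℂ) * (x.1.1 * y.1.1 - y.1.1 * x.1.1) (Sum.inl k) (Sum.inl k) = 0
  have key : ∀ x y : carrier N p, (x.1.1 * y.1.1) (Sum.inl k) (Sum.inl k) =
      x.1.1 (Sum.inl k) (Sum.inl k) * y.1.1 (Sum.inl k) (Sum.inl k) := by
    intro x y
    rw [Matrix.mul_apply, Fintype.sum_sum_type, Finset.sum_eq_single k]
    · simp [(shape_of_mem y).lower]
    · intro l _ hl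
      rcases lt_or_gt_of_ne hl with h | h
      · rw [(shape_of_mem x).triangular k l h, zero_mul]
      · rw [(shape_of_mem y).triangular l k h, mul_zero]
    · exact fun h => absurd (Finset.mem_univ k) h
  rw [Matrix.sub_apply, key, key, mul_comm (y.1.1 _ _), sub_self, mul_zero]

theorem isTwoCocycle_wedgeForm_hDual (p : ℕ) (i k : Fin N) :
    IsTwoCocycle (wedgeForm (res p (hDual i)) (res p (hDual k))) :=
  IsTwoCocycle.wedgeForm (hDual_lie i) (hDual_lie k)

/-- A coboundary vanishes on the commuting pair `H_{ii}`, `H_{kk}`, where this form has the value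
`1`. -/
theorem not_isTwoCoboundary_wedgeForm_hDual {p : ℕ} {i k : Fin N} (hik : i < k) (hk : k.val < p) :
    ¬ IsTwoCoboundary (wedgeForm (res p (hDual i)) (res p (hDual k))) := by
  rintro ⟨f, hf⟩
  have hk' : k ∈ links N p := Finset.mem_filter.mpr ⟨Finset.mem_univ k, hk⟩
  have hi' : i ∈ links N p :=
    Finset.mem_filter.mpr ⟨Finset.mem_univ i, lt_trans (Fin.lt_def.mp hik) hk⟩
  have h0 : ⁅(⟨hh i, hh_mem hi'⟩ : carrier N p), (⟨hh k, hh_mem hk'⟩ : carrier N p)⁆ = 0 := by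
    apply Subtype.ext
    change ⁅hh i, hh k⁆ = 0
    rw [hh_eq, hh_eq, smul_lie, lie_smul, lie_eMinus_eMinus, if_neg hik.ne, if_neg hik.ne',
      sub_zero, smul_zero, smul_zero]
  have h := LinearMap.congr_fun₂ hf ⟨hh i, hh_mem hi'⟩ ⟨hh k, hh_mem hk'⟩
  rw [cobForm_apply, h0, map_zero, wedgeForm_apply] at h
  change hDual i (hh i) * hDual k (hh k) - hDual k (hh i) * hDual i (hh k) = 0 at h
  simp [hDual_hh, hik.ne, hik.ne'] at h

/-! ### The inverse tensors -/

theorem omega_apply {p : ℕ} (γ : Fin N → ℂ) (x y : carrier N p) : omega p γ x y =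
    ∑ m ∈ links N p, γ m * ∑ l, (x.1.1 (Sum.inl m) (Sum.inl l) * y.1.1 (Sum.inl l) (Sum.inr m) -
      y.1.1 (Sum.inl m) (Sum.inl l) * x.1.1 (Sum.inl l) (Sum.inr m)) := by
  rw [omega, LinearMap.sum_apply, LinearMap.sum_apply]
  refine Finset.sum_congr rfl fun m _ => ?_
  rw [← ePlusDual_lie]
  rfl

theorem omegaHat_apply {p : ℕ} (γ : Fin N → ℂ) (w : Fin N → Fin N → ℂ) (x y : carrier N p) :
    omegaHat p γ w x y = omega p γ x y + ∑ q ∈ pairs N p, w q.1 q.2 *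
      (hDual q.1 x.1 * hDual q.2 y.1 - hDual q.2 x.1 * hDual q.1 y.1) := by
  rw [omegaHat, LinearMap.add_apply, LinearMap.add_apply, LinearMap.sum_apply,
    LinearMap.sum_apply]
  rfl

theorem omega_ePlus {p : ℕ} (γ : Fin N → ℂ) (x : carrier N p) {k i : Fin N}
    (hk : k ∈ links N p) (hi : k ≤ i) : omega p γ x ⟨ePlus k i, ePlus_mem hk hi⟩ =
      (if k = i then 2 else 1) * (γ k * x.1.1 (Sum.inl k) (Sum.inl i)) := by
  have h (m : Fin N) : ∑ l, (x.1.1 (Sum.inl m) (Sum.inl l) * ePlusMat k i (Sum.inl l) (Sum.inr m) -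
      ePlusMat k i (Sum.inl m) (Sum.inl l) * x.1.1 (Sum.inl l) (Sum.inr m)) =
      (if i = m then x.1.1 (Sum.inl m) (Sum.inl k) else 0) +
        if k = m then x.1.1 (Sum.inl m) (Sum.inl i) else 0 := by
    simp only [(ePlusMat_apply _ _ _ _).1, (ePlusMat_apply _ _ _ _).2.2, zero_mul, sub_zero,
      mul_add, ite_and, mul_ite, mul_one, mul_zero, Finset.sum_add_distrib]
    simp
  rw [omega_apply]
  simp only [ePlus, h, mul_add, mul_ite, mul_zero, Finset.sum_add_distrib, Finset.sum_ite_eq,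
    if_pos hk]
  rcases eq_or_lt_of_le hi with rfl | hlt
  · simp only [if_pos hk, if_true]; ring
  -- The second term contains an entry below the diagonal, so it is irrelevant whether `i` is one of
  -- the links.
  · rw [(shape_of_mem x).triangular i k hlt, if_neg hlt.ne]; simp

theorem omega_eMinus {p : ℕ} (γ : Fin N → ℂ) (x y : carrier N p) {k i : Fin N}
    (hk : k ∈ links N p) (hy : y.1 = eMinus k i) :
    omega p γ x y = -(γ k * x.1.1 (Sum.inl k) (Sum.inr i)) := by
  have h (m : Fin N) : ∑ l, (x.1.1 (Sum.inl m) (Sum.inl l) * eMinusMat k i (Sum.inl l) (Sum.inr m) -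
      eMinusMat k i (Sum.inl m) (Sum.inl l) * x.1.1 (Sum.inl l) (Sum.inr m)) =
      -if k = m then x.1.1 (Sum.inl i) (Sum.inr m) else 0 := by
    simp only [(eMinusMat_apply _ _ _ _).1, (eMinusMat_apply _ _ _ _).2.2, mul_zero, zero_sub,
      ite_and, ite_mul, one_mul, zero_mul, Finset.sum_neg_distrib]
    split_ifs <;> simp
  rw [omega_apply, hy]
  simp only [eMinus, h, mul_neg, mul_ite, mul_zero, Finset.sum_neg_distrib, Finset.sum_ite_eq,
    if_pos hk, (spN_apply x.1 i k).2]

theorem hDual_ePlus (a k i : Fin N) : hDual a (ePlus k i) = 0 := by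
  change (2 : ℂ) * ePlusMat k i _ _ = 0
  rw [(ePlusMat_apply k i a a).1, mul_zero]

theorem hDual_eMinus {k i : Fin N} (h : k ≠ i) (a : Fin N) : hDual a (eMinus k i) = 0 := by
  change (2 : ℂ) * eMinusMat k i _ _ = 0
  rw [(eMinusMat_apply k i a a).1, if_neg (by rintro ⟨rfl, rfl⟩; exact h rfl), mul_zero]

variable (p : ℕ)

/-- An element of `sp(N)` as an element of the carrier algebra, or zero. -/
def toCarrier (x : spN N) : carrier N p :=
  open Classical in if h : x ∈ carrier N p then ⟨x, h⟩ else 0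

variable {p}

theorem toCarrier_eq {x : spN N} (h : x ∈ carrier N p) : toCarrier p x = ⟨x, h⟩ := dif_pos h

variable {γ : Fin N → ℂ} {w : Fin N → Fin N → ℂ} (x : carrier N p)

theorem omegaHat_toCarrier_ePlus {k i : Fin N} (hk : k ∈ links N p) (hi : k ≤ i) :
    omegaHat p γ w x (toCarrier p (ePlus k i)) =
      (if k = i then 2 else 1) * (γ k * x.1.1 (Sum.inl k) (Sum.inl i)) := by
  rw [toCarrier_eq (ePlus_mem hk hi), omegaHat_apply, omega_ePlus γ x hk hi]
  simp [hDual_ePlus]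

theorem omegaHat_toCarrier_ePlus_self {k : Fin N} (hk : k ∈ links N p) :
    omegaHat p γ w x (toCarrier p (ePlus k k)) = γ k * hDual k x.1 := by
  rw [omegaHat_toCarrier_ePlus x hk le_rfl, if_pos rfl, mul_left_comm]
  rfl

theorem omegaHat_toCarrier_eMinus {k i : Fin N} (hk : k ∈ links N p) (hi : k < i) :
    omegaHat p γ w x (toCarrier p (eMinus k i)) = -(γ k * x.1.1 (Sum.inl k) (Sum.inr i)) := by
  rw [toCarrier_eq (eMinus_mem hk hi), omegaHat_apply, omega_eMinus γ x _ hk rfl]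
  simp [hDual_eMinus hi.ne]

theorem omegaHat_toCarrier_hh {k : Fin N} (hk : k ∈ links N p) :
    omegaHat p γ w x (toCarrier p (hh k)) = -(γ k * ePlusDual k x.1) +
      ∑ q ∈ pairs N p, ((if q.2 = k then w q.1 q.2 * hDual q.1 x.1 else 0) -
        if q.1 = k then w q.1 q.2 * hDual q.2 x.1 else 0) := by
  rw [toCarrier_eq (hh_mem hk), omegaHat_apply]
  congr 1
  · have h2 : (2 : ℂ) • (⟨hh k, hh_mem hk⟩ : carrier N p).1 = eMinus k k := by
      change (2 : ℂ) • hh k = _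
      rw [hh_eq, smul_smul]
      norm_num
    have h := omega_eMinus γ x ((2 : ℂ) • ⟨hh k, hh_mem hk⟩) hk h2
    rw [map_smul, smul_eq_mul] at h
    change _ = -(γ k * (1 / 2 * x.1.1 (Sum.inl k) (Sum.inr k)))
    linear_combination (1 / 2) * h
  · simp [hDual_hh, mul_sub]

/-- The matrix entries, as functionals on the carrier algebra. -/
def entry (p : ℕ) (a b : Fin N ⊕ Fin N) : carrier N p →ₗ[ℂ] ℂ where
  toFun x := x.1.1 a b
  map_add' _ _ := rfl
  map_smul' _ _ := rfl

/-- The other entries vanish by the shape or follow from `D = -Aᵀ` and the symmetry of `B`. -/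
theorem ext_of_entry {x y : carrier N p} (h : ∀ a ∈ links N p, ∀ b, a ≤ b →
    entry p (Sum.inl a) (Sum.inl b) x = entry p (Sum.inl a) (Sum.inl b) y ∧
    entry p (Sum.inl a) (Sum.inr b) x = entry p (Sum.inl a) (Sum.inr b) y) : x = y := by
  have hA : ∀ a b, x.1.1 (Sum.inl a) (Sum.inl b) = y.1.1 (Sum.inl a) (Sum.inl b) := by
    intro a b
    by_cases ha : a ∈ links N p
    · rcases le_or_gt a b with hab | hab
      · exact (h a ha b hab).1
      · rw [(shape_of_mem x).triangular a b hab, (shape_of_mem y).triangular a b hab]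
    · have ha : p ≤ a.val := by simpa [links] using ha
      rw [(shape_of_mem x).row a b ha, (shape_of_mem y).row a b ha]
  have hB : ∀ a b, a ≤ b → x.1.1 (Sum.inl a) (Sum.inr b) = y.1.1 (Sum.inl a) (Sum.inr b) := by
    intro a b hab
    by_cases ha : a ∈ links N p
    · exact (h a ha b hab).2
    · have ha : p ≤ a.val := by simpa [links] using ha
      have hb : p ≤ b.val := ha.trans (Fin.le_def.mp hab)
      rw [(shape_of_mem x).block a b ha hb, (shape_of_mem y).block a b ha hb]
  apply Subtype.ext
  apply Subtype.ext
  ext a b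
  rcases a with a | a <;> rcases b with b | b
  · exact hA a b
  · rcases le_total a b with hab | hab
    · exact hB a b hab
    · rw [(spN_apply x.1 a b).2, (spN_apply y.1 a b).2]
      exact hB b a hab
  · rw [(shape_of_mem x).lower, (shape_of_mem y).lower]
  · rw [(spN_apply x.1 a b).1, (spN_apply y.1 a b).1, hA]

theorem entry_toCarrier {z : spN N} (hz : z ∈ carrier N p) (a b : Fin N ⊕ Fin N) :
    entry p a b (toCarrier p z) = z.1 a b := by
  rw [toCarrier_eq hz]; rfl

theorem entry_eMinus {k i : Fin N} (hk : k ∈ links N p) (hi : k < i) (a b : Fin N) :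
    entry p (Sum.inl a) (Sum.inl b) (toCarrier p (eMinus k i)) =
      (if k = a ∧ i = b then 1 else 0) ∧
    entry p (Sum.inl a) (Sum.inr b) (toCarrier p (eMinus k i)) = 0 := by
  rw [entry_toCarrier (eMinus_mem hk hi), entry_toCarrier (eMinus_mem hk hi)]
  exact ⟨(eMinusMat_apply k i a b).1, (eMinusMat_apply k i a b).2.2⟩

theorem entry_hh {k : Fin N} (hk : k ∈ links N p) (a b : Fin N) :
    entry p (Sum.inl a) (Sum.inl b) (toCarrier p (hh k)) =
      (1 / 2) * (if k = a ∧ k = b then 1 else 0) ∧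
    entry p (Sum.inl a) (Sum.inr b) (toCarrier p (hh k)) = 0 := by
  rw [entry_toCarrier (hh_mem hk), entry_toCarrier (hh_mem hk),
    ← (eMinusMat_apply k k a b).1, ← mul_zero (1 / 2 : ℂ), ← (eMinusMat_apply k k a b).2.2]
  exact ⟨rfl, rfl⟩

theorem entry_ePlus {k i : Fin N} (hk : k ∈ links N p) (hi : k ≤ i) (a b : Fin N) :
    entry p (Sum.inl a) (Sum.inl b) (toCarrier p (ePlus k i)) = 0 ∧
    entry p (Sum.inl a) (Sum.inr b) (toCarrier p (ePlus k i)) =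
      (if k = a ∧ i = b then 1 else 0) + (if i = a ∧ k = b then 1 else 0) := by
  rw [entry_toCarrier (ePlus_mem hk hi), entry_toCarrier (ePlus_mem hk hi)]
  exact ⟨(ePlusMat_apply k i a b).1, (ePlusMat_apply k i a b).2.2⟩

/-- Coordinates of an element of the carrier algebra. -/
theorem eq_sum_of_mem_carrier : x = ∑ k ∈ links N p,
    ((hDual k x.1 • toCarrier p (hh k) + ePlusDual k x.1 • toCarrier p (ePlus k k)) +
      ∑ i ∈ Finset.univ.filter (fun i : Fin N => k < i),
        (x.1.1 (Sum.inl k) (Sum.inl i) • toCarrier p (eMinus k i) +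
          x.1.1 (Sum.inl k) (Sum.inr i) • toCarrier p (ePlus k i))) := by
  refine ext_of_entry fun a ha b hab => ⟨?_, ?_⟩
  · have h : ∀ k ∈ links N p, entry p (Sum.inl a) (Sum.inl b)
        ((hDual k x.1 • toCarrier p (hh k) + ePlusDual k x.1 • toCarrier p (ePlus k k)) +
          ∑ i ∈ Finset.univ.filter (fun i : Fin N => k < i),
            (x.1.1 (Sum.inl k) (Sum.inl i) • toCarrier p (eMinus k i) +
              x.1.1 (Sum.inl k) (Sum.inr i) • toCarrier p (ePlus k i))) =
        if k = a then entry p (Sum.inl a) (Sum.inl b) x else 0 := by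
      intro k hk
      have hs : ∀ i ∈ Finset.univ.filter (fun i : Fin N => k < i),
          entry p (Sum.inl a) (Sum.inl b) (x.1.1 (Sum.inl k) (Sum.inl i) •
            toCarrier p (eMinus k i) + x.1.1 (Sum.inl k) (Sum.inr i) • toCarrier p (ePlus k i)) =
          if i = b then (if k = a then x.1.1 (Sum.inl k) (Sum.inl i) else 0) else 0 := by
        intro i hi
        have hi := (Finset.mem_filter.mp hi).2
        rw [map_add, map_smul, map_smul, (entry_eMinus hk hi a b).1, (entry_ePlus hk hi.le a b).1,
          smul_zero, add_zero]
        by_cases h1 : k = a <;> by_cases h2 : i = b <;> simp [h1, h2]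
      -- This `2` cancels the `1/2` in `H_{kk}`; dually, the `1/2` in `ePlusDual` below cancels the
      -- entry `2` of `E_{k+k}`.
      have hd : hDual k x.1 = 2 * entry p (Sum.inl k) (Sum.inl k) x := rfl
      rw [map_add, map_add, map_smul, map_smul, map_sum, Finset.sum_congr rfl hs,
        Finset.sum_ite_eq', (entry_hh hk a b).1, (entry_ePlus hk le_rfl a b).1, hd]
      by_cases hka : k = a
      · subst hka
        rcases eq_or_lt_of_le hab with rfl | hlt
        · simp; ring
        · simp only [hlt, hlt.ne, and_false, if_false, Finset.mem_filter, Finset.mem_univ,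
            true_and, if_true, smul_zero, zero_add, mul_zero]
          rfl
      · simp [hka]
    rw [map_sum, Finset.sum_congr rfl h, Finset.sum_ite_eq', if_pos ha]
  · have h : ∀ k ∈ links N p, entry p (Sum.inl a) (Sum.inr b)
        ((hDual k x.1 • toCarrier p (hh k) + ePlusDual k x.1 • toCarrier p (ePlus k k)) +
          ∑ i ∈ Finset.univ.filter (fun i : Fin N => k < i),
            (x.1.1 (Sum.inl k) (Sum.inl i) • toCarrier p (eMinus k i) +
              x.1.1 (Sum.inl k) (Sum.inr i) • toCarrier p (ePlus k i))) =
        if k = a then entry p (Sum.inl a) (Sum.inr b) x else 0 := by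
      intro k hk
      have hs : ∀ i ∈ Finset.univ.filter (fun i : Fin N => k < i),
          entry p (Sum.inl a) (Sum.inr b) (x.1.1 (Sum.inl k) (Sum.inl i) •
            toCarrier p (eMinus k i) + x.1.1 (Sum.inl k) (Sum.inr i) • toCarrier p (ePlus k i)) =
          if i = b then (if k = a then x.1.1 (Sum.inl k) (Sum.inr i) else 0) else 0 := by
        intro i hi
        have hi := (Finset.mem_filter.mp hi).2
        -- `E_{k+i}` has a second, transposed entry; with `k < i` and `a ≤ b` it is not the one
        -- tested.
        have hne : ¬(i = a ∧ k = b) := by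
          rintro ⟨rfl, rfl⟩
          exact hi.not_ge hab
        rw [map_add, map_smul, map_smul, (entry_eMinus hk hi a b).2, (entry_ePlus hk hi.le a b).2,
          if_neg hne, smul_zero, zero_add, add_zero]
        by_cases h1 : k = a <;> by_cases h2 : i = b <;> simp [h1, h2]
      have hd : ePlusDual k x.1 = 1 / 2 * entry p (Sum.inl k) (Sum.inr k) x := rfl
      rw [map_add, map_add, map_smul, map_smul, map_sum, Finset.sum_congr rfl hs,
        Finset.sum_ite_eq', (entry_hh hk a b).2, (entry_ePlus hk le_rfl a b).2, hd]
      by_cases hka : k = a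
      · subst hka
        rcases eq_or_lt_of_le hab with rfl | hlt
        · simp; ring
        · simp only [hlt, hlt.ne, and_false, if_false, Finset.mem_filter, Finset.mem_univ,
            true_and, if_true, smul_zero, zero_add, add_zero]
          rfl
      · simp [hka]
    rw [map_sum, Finset.sum_congr rfl h, Finset.sum_ite_eq', if_pos ha]

/-- The classical `r`-matrix as a tensor over the carrier algebra. -/
def carrierTensor (p : ℕ) (η : Fin N → ℂ) (ζ : Fin N → Fin N → ℂ) : carrier N p ⊗[ℂ] carrier N p :=
  ∑ k ∈ links N p, η k • (wedge (toCarrier p (hh k)) (toCarrier p (ePlus k k)) +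
    ∑ i ∈ Finset.univ.filter (fun i : Fin N => k < i),
      wedge (toCarrier p (eMinus k i)) (toCarrier p (ePlus k i))) +
  ∑ q ∈ pairs N p, ζ q.1 q.2 •
    wedge (toCarrier p (ePlus q.1 q.1)) (toCarrier p (ePlus q.2 q.2))

theorem mem_links_of_mem_pairs {q : Fin N × Fin N} (hq : q ∈ pairs N p) :
    q.1 ∈ links N p ∧ q.2 ∈ links N p := by
  simp only [pairs, links, Finset.mem_filter, Finset.mem_univ, true_and] at hq ⊢
  exact ⟨lt_trans (Fin.lt_def.mp hq.1) hq.2, hq.2⟩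

theorem map_carrierTensor (η : Fin N → ℂ) (ζ : Fin N → Fin N → ℂ) :
    TensorProduct.map (carrier N p).toSubmodule.subtype (carrier N p).toSubmodule.subtype
      (carrierTensor p η ζ) = rHat p η 1 ζ := by
  have hw {a b : spN N} (ha : a ∈ carrier N p) (hb : b ∈ carrier N p) :
      TensorProduct.map (carrier N p).toSubmodule.subtype (carrier N p).toSubmodule.subtype
        (wedge (toCarrier p a) (toCarrier p b)) = wedge a b := by
    rw [map_wedge, toCarrier_eq ha, toCarrier_eq hb]
    rfl
  rw [carrierTensor, rHat, rCl, map_add, map_sum, map_sum]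
  congr 1
  · refine Finset.sum_congr rfl fun k hk => ?_
    rw [map_smul, map_add, map_sum, hw (hh_mem hk) (ePlus_mem hk le_rfl), Pi.one_apply, one_smul]
    congr 2
    refine Finset.sum_congr rfl fun i hi => ?_
    have hi := (Finset.mem_filter.mp hi).2
    rw [hw (eMinus_mem hk hi) (ePlus_mem hk hi.le)]
  · refine Finset.sum_congr rfl fun q hq => ?_
    obtain ⟨h1, h2⟩ := mem_links_of_mem_pairs hq
    rw [map_smul, hw (ePlus_mem h1 le_rfl) (ePlus_mem h2 le_rfl)]

/-- The coefficient `-w/(γγ)` is forced: the value of the form on `E_{k+k}` brings one factor `γ`,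
and the result must cancel the `W`-terms of `contract_link`. -/
theorem contract_pair (hγ : ∀ k ∈ links N p, γ k ≠ 0) {q : Fin N × Fin N} (hq : q ∈ pairs N p) :
    contract (-(w q.1 q.2 / (γ q.1 * γ q.2)) •
      wedge (toCarrier p (ePlus q.1 q.1)) (toCarrier p (ePlus q.2 q.2))) (omegaHat p γ w x) =
    (1 / γ q.2 * (w q.1 q.2 * hDual q.1 x.1)) • toCarrier p (ePlus q.2 q.2) -
      (1 / γ q.1 * (w q.1 q.2 * hDual q.2 x.1)) • toCarrier p (ePlus q.1 q.1) := by
  obtain ⟨hq1, hq2⟩ := mem_links_of_mem_pairs hq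
  have h1 := hγ _ hq1
  have h2 := hγ _ hq2
  rw [contract_smul, contract_wedge, omegaHat_toCarrier_ePlus_self x hq1,
    omegaHat_toCarrier_ePlus_self x hq2, ← neg_sub, smul_neg, neg_smul, neg_neg, smul_sub,
    smul_smul, smul_smul]
  congr 2 <;> field_simp

theorem sum_links_smul_eq {V : Type} [AddCommGroup V] [Module ℂ V] (e : Fin N → V)
    (g : Fin N → ℂ) (a b : Fin N × Fin N → ℂ) :
    ∑ k ∈ links N p, (g k * ∑ q ∈ pairs N p,
      ((if q.2 = k then a q else 0) - if q.1 = k then b q else 0)) • e k =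
    ∑ q ∈ pairs N p, ((g q.2 * a q) • e q.2 - (g q.1 * b q) • e q.1) := by
  simp only [Finset.mul_sum, Finset.sum_smul]
  rw [Finset.sum_comm]
  refine Finset.sum_congr rfl fun q hq => ?_
  obtain ⟨hq1, hq2⟩ := mem_links_of_mem_pairs hq
  simp only [mul_sub, sub_smul, mul_ite, mul_zero, ite_smul, zero_smul]
  rw [Finset.sum_sub_distrib, Finset.sum_ite_eq, Finset.sum_ite_eq, if_pos hq1, if_pos hq2]

/-- The link part returns `x` in coordinates minus the `W`-corrections. Summed over pairs by
`sum_links_smul_eq`, these are exactly what the `E ∧ E` part contributes. -/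
theorem contract_carrierTensor (hγ : ∀ k ∈ links N p, γ k ≠ 0) :
    contract (carrierTensor p (fun k => 1 / γ k) fun i k => -(w i k / (γ i * γ k)))
      (omegaHat p γ w x) = x := by
  have h (k) (hk : k ∈ links N p) := contract_link
    (Finset.univ.filter (fun i : Fin N => k < i)) (omegaHat p γ w x) (toCarrier p (hh k))
    (toCarrier p (ePlus k k)) (fun i => toCarrier p (eMinus k i))
    (fun i => toCarrier p (ePlus k i)) (hDual k x.1) (ePlusDual k x.1) _
    (fun i => x.1.1 (Sum.inl k) (Sum.inl i)) (fun i => x.1.1 (Sum.inl k) (Sum.inr i)) (hγ k hk)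
    (omegaHat_toCarrier_ePlus_self x hk) (omegaHat_toCarrier_hh x hk)
    (fun i hi => by
      have hi := (Finset.mem_filter.mp hi).2
      rw [omegaHat_toCarrier_ePlus x hk hi.le, if_neg hi.ne, one_mul])
    (fun i hi => omegaHat_toCarrier_eMinus x hk (Finset.mem_filter.mp hi).2)
  rw [carrierTensor, contract_add, contract_sum, contract_sum, Finset.sum_congr rfl h,
    Finset.sum_congr rfl fun q hq => contract_pair x hγ hq, Finset.sum_sub_distrib,
    sum_links_smul_eq (fun k => toCarrier p (ePlus k k)) (fun k => 1 / γ k)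
      (fun q => w q.1 q.2 * hDual q.1 x.1) fun q => w q.1 q.2 * hDual q.2 x.1, sub_add_cancel]
  exact (eq_sum_of_mem_carrier x).symm

theorem isInverseOf_omegaHat (hγ : ∀ k ∈ links N p, γ k ≠ 0) :
    IsInverseOf (carrier N p) (omegaHat p γ w)
      (rHat p (fun k => 1 / γ k) 1 fun i k => -(w i k / (γ i * γ k))) :=
  ⟨_, map_carrierTensor _ _, fun x => contract_carrierTensor x hγ,
    apply_contract_of_contract_apply fun x => contract_carrierTensor x hγ⟩

theorem omegaHat_zero : omegaHat p γ 0 = omega p γ := by simp [omegaHat]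

theorem isInverseOf_omega (hγ : ∀ k ∈ links N p, γ k ≠ 0) :
    IsInverseOf (carrier N p) (omega p γ) (rCl p (fun k => 1 / γ k) 1) := by
  have h := isInverseOf_omegaHat (w := 0) hγ
  rw [omegaHat_zero] at h
  simpa [rHat] using h

theorem omega_eq_cobForm : omega p γ = cobForm (∑ k ∈ links N p, γ k • res p (ePlusDual k)) :=
  cobForm_sum _ _ _

theorem isTwoCocycle_omega : IsTwoCocycle (omega p γ) := by
  rw [omega_eq_cobForm]
  exact IsTwoCocycle.cobForm _

theorem isTwoCocycle_omegaHat : IsTwoCocycle (omegaHat p γ w) :=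
  isTwoCocycle_omega.add (IsTwoCocycle.sum _ fun q _ =>
    (isTwoCocycle_wedgeForm_hDual p q.1 q.2).smul _)

theorem rHat_congr {η κ : Fin N → ℂ} {ζ ζ' : Fin N → Fin N → ℂ}
    (h : ∀ i k : Fin N, i < k → k.val < p → ζ i k = ζ' i k) : rHat p η κ ζ = rHat p η κ ζ' := by
  rw [rHat, rHat]
  congr 1
  refine Finset.sum_congr rfl fun q hq => ?_
  have hq := (Finset.mem_filter.mp hq).2
  rw [h _ _ hq.1 hq.2]

end Carrier

end ChainTwist

end

theorem mainTheorem6 (N p : ℕ) (hp : p ≤ N) :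
    -- the quantum side, for arbitrary multipliers and any choice of extensions
    (∀ (η κ : Fin N → ℂ), (∀ k, κ k = 0 ∨ κ k = 1) →
      ChainTwist.IsTwist (ChainTwist.chain η κ p) ∧
      ChainTwist.HasClassicalLimit (ChainTwist.chain η κ p) (ChainTwist.rCl p η κ) ∧
      ChainTwist.IsCYBE (ChainTwist.rCl p η κ) ∧
      (∀ k ∈ ChainTwist.links N p,
        ChainTwist.twistedComul (ChainTwist.chain η κ p) (ChainTwist.sigma η κ k) =
          ChainTwist.tens (ChainTwist.sigma η κ k) 1 +
            ChainTwist.tens 1 (ChainTwist.sigma η κ k)) ∧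
      (∀ i ∈ ChainTwist.links N p, ∀ k ∈ ChainTwist.links N p,
        Commute (ChainTwist.sigma η κ i) (ChainTwist.sigma η κ k)) ∧
      ∀ c : Fin N → Fin N → PowerSeries ℂ,
        ChainTwist.IsTwistOver (ChainTwist.chain η κ p) (ChainTwist.phiR p η κ c) ∧
        ChainTwist.IsTwist (ChainTwist.phiR p η κ c * ChainTwist.chain η κ p) ∧
        ChainTwist.HasClassicalLimit (ChainTwist.phiR p η κ c * ChainTwist.chain η κ p)
          (ChainTwist.rHat p η κ fun i k =>
            (PowerSeries.constantCoeff (c i k) - PowerSeries.constantCoeff (c k i)) *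
              (η i * η k)) ∧
        ChainTwist.IsCYBE (ChainTwist.rHat p η κ fun i k =>
            (PowerSeries.constantCoeff (c i k) - PowerSeries.constantCoeff (c k i)) *
              (η i * η k))) ∧
    -- the cocycles `H*_{ii} ∧ H*_{kk}` are nontrivial
    (∀ i k : Fin N, i < k → k.val < p →
      ChainTwist.IsTwoCocycle (ChainTwist.wedgeForm
        (ChainTwist.res p (ChainTwist.hDual i)) (ChainTwist.res p (ChainTwist.hDual k))) ∧
      ¬ ChainTwist.IsTwoCoboundary (ChainTwist.wedgeForm
        (ChainTwist.res p (ChainTwist.hDual i)) (ChainTwist.res p (ChainTwist.hDual k)))) ∧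
    -- the quasi-Frobenius forms and their inverses, for the full chain
    ∀ (γ : Fin N → ℂ) (w : Fin N → Fin N → ℂ), (∀ k ∈ ChainTwist.links N p, γ k ≠ 0) →
      ChainTwist.IsTwoCoboundary (ChainTwist.omega p γ) ∧
      (ChainTwist.omega p γ).Nondegenerate ∧
      ChainTwist.IsInverseOf (ChainTwist.carrier N p) (ChainTwist.omega p γ)
        (ChainTwist.rCl p (fun k => 1 / γ k) 1) ∧
      ChainTwist.IsTwoCocycle (ChainTwist.omegaHat p γ w) ∧
      (ChainTwist.omegaHat p γ w).Nondegenerate ∧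
      ChainTwist.IsInverseOf (ChainTwist.carrier N p) (ChainTwist.omegaHat p γ w)
        (ChainTwist.rHat p (fun k => 1 / γ k) 1 fun i k => -(w i k / (γ i * γ k))) ∧
      ∀ c : Fin N → Fin N → PowerSeries ℂ,
        (∀ i k : Fin N, i < k → k.val < p →
          PowerSeries.constantCoeff (c i k) - PowerSeries.constantCoeff (c k i) = -w i k) →
        ChainTwist.HasClassicalLimit
          (ChainTwist.phiR p (fun k => 1 / γ k) 1 c * ChainTwist.chain (fun k => 1 / γ k) 1 p)
          (ChainTwist.rHat p (fun k => 1 / γ k) 1 fun i k => -(w i k / (γ i * γ k))) := by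
  refine ⟨fun η κ hκ => ChainTwist.quantum_side η κ hp hκ, fun i k hik hk =>
    ⟨ChainTwist.isTwoCocycle_wedgeForm_hDual p i k,
      ChainTwist.not_isTwoCoboundary_wedgeForm_hDual hik hk⟩, fun γ w hγ => ?_⟩
  refine ⟨⟨_, ChainTwist.omega_eq_cobForm⟩, ?_, ChainTwist.isInverseOf_omega hγ,
    ChainTwist.isTwoCocycle_omegaHat, ?_, ChainTwist.isInverseOf_omegaHat hγ, fun c hc => ?_⟩
  · exact ChainTwist.nondegenerate_of_inverse ChainTwist.isTwoCocycle_omega.1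
      (ChainTwist.isInverseOf_omega hγ)
  · exact ChainTwist.nondegenerate_of_inverse ChainTwist.isTwoCocycle_omegaHat.1
      (ChainTwist.isInverseOf_omegaHat hγ)
  · have h := ((ChainTwist.quantum_side (fun k => 1 / γ k) 1 hp fun _ => Or.inr rfl).2.2.2.2.2
      c).2.2.1
    -- The condition on `c` concerns only pairs `i < k` of links, so the coefficient functions are
    -- compared on those pairs only.
    rwa [ChainTwist.rHat_congr (ζ' := fun i k => -(w i k / (γ i * γ k))) fun i k hik hk => by
      rw [hc i k hik hk]; ring] at h
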